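/- Conventions. Vectors and matrices carry the norm $\|M\|=\max_{i,j}|M_{ij}|$ and $\|M\|_p=\mathbb E(\|M\|^p)^{1/p}$. For functions of $\varepsilon>0$ write $G\sim H$ with ratio $c$ if $\lim_{\varepsilon\to0}G(\varepsilon)/H(\varepsilon)=c\in(0,\infty)$. A speed is a function $\rho(\varepsilon)>0$ with $\rho(\varepsilon)\to0$ as $\varepsilon\to0$. Setups. An indirect observability setup in $\mathbb R^r$ with speed $\rho$ consists of a strictly stationary process $(X_t)_{t\ge0}$ and processes $(Y^\varepsilon_t)_{t\ge0}$, $\varepsilon>0$, on a common probability space, such that $\|X_t\|_4\le\nu$, $\|Y^\varepsilon_t\|_4\le\nu$ and $\|Y^\varepsilon_t-X_t\|_4\le\rho(\varepsilon)$ for all $t\ge0$, $\varepsilon>0$, and such that the lagged covariances $K(u)=\mathbb E(X_tX_{t+u}^*)-\mu\mu^*$, $\mu=\mathbb E X_t$, are Lipschitz on every $[0,B]$, with constant $\Lambda(B)$. The process $X$ has integrable decorrelation rate $f$ if $f:(0,\infty)\to(0,\infty)$ is continuous and decreasing, $I(f)=\int_1^\infty f(T)\,dT<\infty$, and for any two time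 intervals $U,V\subset[0,\infty)$ with gap $T=\inf_{s\in U,\,t\in V}(t-s)>0$ one has $|\mathbb E(GH)-\mathbb E(G)\mathbb E(H)|\le f(T)$ whenever $G$ is of the form $X_s(i)$ or $X_s(i)X_{s'}(j)$ with $s,s'\in U$, and $H$ is of the same form with times in $V$. Schemes and estimators. An adaptive sub-sampling scheme is a pair $N(\varepsilon)\in\mathbb N$, $\Delta(\varepsilon)>0$ with $\Delta\to0$ and $N\Delta\to\infty$ as $\varepsilon\to0$. With $\kappa$ the closest integer to $u/\Delta$, put $$\bar Y^\varepsilon=\frac1N\sum_{n=1}^NY^\varepsilon_{n\Delta},\qquad \tau_u\bar Y^\varepsilon=\frac1N\sum_{n=1}^NY^\varepsilon_{(n+\kappa)\Delta},\qquad \hat K^\varepsilon_Y(u)=\frac1N\sum_{n=1}^NY^\varepsilon_{n\Delta}(Y^\varepsilon_{(n+\kappa)\Delta})^*-\bar Y^\varepsilon(\tau_u\bar Y^\varepsilon)^*.$$ A scheme is optimized for $\rho$ if $N\sim\rho^{-3}$ with some ratio $a$ and $\Delta\sim\rho$ with some ratio $b$ (hence also $\Delta\sim N^{-1/3}$). Theorem.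 (0) For every speed $\rho$ and all $a,b>0$ there are optimized schemes with ratios $a,b$, and every optimized scheme is an adaptive sub-sampling scheme. (1) For every $r,A,\nu,J,\Lambda,a,b$ there is a constant $C$, depending on nothing else, such that for every setup in $\mathbb R^r$ with bounds $\nu,\Lambda$ and any speed $\rho$, whose process $X$ has an integrable decorrelation rate $f$ with $I(f)\le J$, and for every optimized scheme with ratios $a,b$, one has for all sufficiently small $\varepsilon>0$ $$\|\hat K^\varepsilon_Y(u)-K(u)\|_2\le C\rho(\varepsilon)\ \text{ for all }0\le u\le A,\qquad \|\bar Y^\varepsilon-\mu\|_2\le C\rho(\varepsilon).$$ (2) This speed is the best achievable, in the worst case over the setups, and the optimized schemes minimize the growth of the observational time span $S=N\Delta$: for all $r\ge1$ and $\nu,\lambda,J>0$ there are constants $c(u)>0$, $u\ge0$, such that for every speed $\rho$ there is a setup in $\mathbb R^r$ with speed $\rho$, with $L^4$ bound $\nu$, with $K$ Lipschitz on $[0,\infty)$ with constant $\lambda$, and with an integrable decorrelation rate $f$ such that $I(f)\le J$, for which the following holds for every $u\ge0$ and every adaptive sub-sampling scheme $(N,\Delta)$: first, $\|\hat K^\varepsilon_Y(u)-K(u)\|_2\ge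 c(u)\rho(\varepsilon)$ for all sufficiently small $\varepsilon>0$; second, if $\|\hat K^\varepsilon_Y(u)-K(u)\|_2=O(\rho(\varepsilon))$ as $\varepsilon\to0$, then every optimized scheme $(N',\Delta')$ satisfies $N'\Delta'=O(N\Delta)$ as $\varepsilon\to0$. -/

import Mathlib

open MeasureTheory Filter Topology
open scoped NNReal ENNReal

namespace IndirectObs

noncomputable section

open scoped Matrix.Norms.Elementwise

/-- Similarity at `ε → 0⁺` with limiting ratio `c`: `G(ε) / H(ε) → c`, finite and strictly positive. -/
def SimilarWith (c : ℝ) (G H : ℝ → ℝ) : Prop :=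
  0 < c ∧ Tendsto (fun ε => G ε / H ε) (𝓝[>] 0) (𝓝 c)

/-- A speed function: positive for `ε > 0`, tending to zero as `ε → 0⁺`. -/
def IsSpeed (ρ : ℝ → ℝ) : Prop :=
  (∀ ε, 0 < ε → 0 < ρ ε) ∧ Tendsto ρ (𝓝[>] 0) (𝓝 0)

/-- Adaptive sub-sampling scheme: `Δ(ε) > 0`, `Δ(ε) → 0` and `N(ε) Δ(ε) → ∞`. -/
structure IsAdaptiveScheme (N : ℝ → ℕ) (Δ : ℝ → ℝ≥0) : Prop where
  step_pos : ∀ ε, 0 < ε → 0 < Δ ε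
  step_tendsto : Tendsto Δ (𝓝[>] 0) (𝓝 0)
  span_tendsto : Tendsto (fun ε => (N ε : ℝ) * (Δ ε : ℝ)) (𝓝[>] 0) atTop

/-- Optimized scheme for the speed `ρ`: `N(ε) ∼ ρ(ε)⁻³` and `Δ(ε) ∼ ρ(ε)`, with limiting
ratios `a` and `b` (so that `Δ(ε) ∼ N(ε)^(-1/3)` as well). -/
structure IsOptimizedScheme (ρ : ℝ → ℝ) (a b : ℝ) (N : ℝ → ℕ) (Δ : ℝ → ℝ≥0) : Prop where
  step_pos : ∀ ε, 0 < ε → 0 < Δ ε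
  number_similar : SimilarWith a (fun ε => (N ε : ℝ)) (fun ε => 1 / ρ ε ^ 3)
  step_similar : SimilarWith b (fun ε => (Δ ε : ℝ)) ρ

/-- The closest integer to `u / Δ`. -/
def lagIndex (Δ u : ℝ≥0) : ℕ := ⌊u / Δ + 1 / 2⌋₊

section Estimators

variable {Ω : Type*} {r : ℕ}

/-- The empirical mean of `Z_Δ, Z_{2Δ}, …, Z_{NΔ}`. -/
def empMean (Z : ℝ≥0 → Ω → Fin r → ℝ) (N : ℕ) (Δ : ℝ≥0) (ω : Ω) : Fin r → ℝ :=
  (N : ℝ)⁻¹ • ∑ n ∈ Finset.Icc 1 N, Z ((n : ℝ≥0) * Δ) ω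

/-- The empirical mean shifted in time by the lag `κ Δ` that approximates `u`. -/
def shiftedEmpMean (Z : ℝ≥0 → Ω → Fin r → ℝ) (N : ℕ) (Δ u : ℝ≥0) (ω : Ω) : Fin r → ℝ :=
  (N : ℝ)⁻¹ • ∑ n ∈ Finset.Icc 1 N, Z (((n + lagIndex Δ u : ℕ) : ℝ≥0) * Δ) ω

/-- The sub-sampled empirical covariance matrix at lag `u`. -/
def empCov (Z : ℝ≥0 → Ω → Fin r → ℝ) (N : ℕ) (Δ u : ℝ≥0) (ω : Ω) :
    Matrix (Fin r) (Fin r) ℝ :=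
  (N : ℝ)⁻¹ • ∑ n ∈ Finset.Icc 1 N,
      Matrix.vecMulVec (Z ((n : ℝ≥0) * Δ) ω) (Z (((n + lagIndex Δ u : ℕ) : ℝ≥0) * Δ) ω)
    - Matrix.vecMulVec (empMean Z N Δ ω) (shiftedEmpMean Z N Δ u ω)

end Estimators

section Processes

variable {Ω : Type*} [MeasurableSpace Ω] {r : ℕ}

/-- The mean vector of a stationary process. -/
def mean (P : Measure Ω) (X : ℝ≥0 → Ω → Fin r → ℝ) : Fin r → ℝ :=
  fun i => ∫ ω, X 0 ω i ∂P

/-- The lagged covariance matrix `K(u) = E(X_t X_{t+u}^*) - μ μ^*` of a stationary process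
(read at `t = 0`). -/
def lagCov (P : Measure Ω) (X : ℝ≥0 → Ω → Fin r → ℝ) (u : ℝ≥0) : Matrix (Fin r) (Fin r) ℝ :=
  Matrix.of fun i j => (∫ ω, X 0 ω i * X u ω j ∂P) - mean P X i * mean P X j

/-- Strict stationarity: the finite-dimensional laws are invariant under time shifts. -/
def IsStrictlyStationary (P : Measure Ω) (X : ℝ≥0 → Ω → Fin r → ℝ) : Prop :=
  ∀ (n : ℕ) (t : Fin n → ℝ≥0) (h : ℝ≥0),
    P.map (fun ω k => X (t k + h) ω) = P.map (fun ω k => X (t k) ω)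

/-- The random variables `X_s(i)` and `X_s(i) X_t(j)` with `s, t ∈ U`. -/
def lowMoments (X : ℝ≥0 → Ω → Fin r → ℝ) (U : Set ℝ≥0) : Set (Ω → ℝ) :=
  {G | (∃ s ∈ U, ∃ i, G = fun ω => X s ω i) ∨
       (∃ s ∈ U, ∃ t ∈ U, ∃ i j, G = fun ω => X s ω i * X t ω j)}

/-- `X` has integrable decorrelation rate `f`: for time intervals `U`, `V` separated by a time
gap `T = inf (v - u) > 0`, all `G ∈ F_U`, `H ∈ F_V` satisfy `|E(GH) - E(G)E(H)| ≤ f(T)`. -/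
structure HasIntegrableDecorrelationRate (P : Measure Ω) (X : ℝ≥0 → Ω → Fin r → ℝ)
    (f : ℝ → ℝ) : Prop where
  pos : ∀ T, 0 < T → 0 < f T
  antitone : AntitoneOn f (Set.Ioi 0)
  continuous : ContinuousOn f (Set.Ioi 0)
  integrable : IntegrableOn f (Set.Ioi 1)
  decorrelation : ∀ U V : Set ℝ≥0, U.OrdConnected → V.OrdConnected → ∀ T : ℝ, 0 < T →
    IsGLB {d : ℝ | ∃ s ∈ U, ∃ t ∈ V, d = (t : ℝ) - (s : ℝ)} T →
    ∀ G ∈ lowMoments X U, ∀ H ∈ lowMoments X V,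
      |(∫ ω, G ω * H ω ∂P) - (∫ ω, G ω ∂P) * ∫ ω, H ω ∂P| ≤ f T

/-- Indirect observability setup `X_t = lim Y^ε_t` with uniform `L⁴`-speed `ρ`, where `ν` bounds
all the `L⁴` norms and `Λ B` is a Lipschitz constant of the lagged covariances on `[0, B]`.
Vectors and matrices carry the norm `max |entry|`. -/
structure IsSetup (P : Measure Ω) (X : ℝ≥0 → Ω → Fin r → ℝ) (Y : ℝ → ℝ≥0 → Ω → Fin r → ℝ)
    (ρ : ℝ → ℝ) (ν : ℝ≥0) (Λ : ℝ≥0 → ℝ≥0) : Prop where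
  measurable_X : ∀ t, Measurable (X t)
  measurable_Y : ∀ ε, 0 < ε → ∀ t, Measurable (Y ε t)
  stationary : IsStrictlyStationary P X
  bound_X : ∀ t, eLpNorm (X t) 4 P ≤ ν
  bound_Y : ∀ ε, 0 < ε → ∀ t, eLpNorm (Y ε t) 4 P ≤ ν
  isSpeed : IsSpeed ρ
  speed : ∀ ε, 0 < ε → ∀ t, eLpNorm (fun ω => Y ε t ω - X t ω) 4 P ≤ ENNReal.ofReal (ρ ε)
  lipschitz : ∀ B, LipschitzOnWith (Λ B) (lagCov P X) (Set.Iic B)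

/-- The `L²` error of the observable covariance estimator at lag `u`. -/
def covError (P : Measure Ω) (X : ℝ≥0 → Ω → Fin r → ℝ) (Y : ℝ → ℝ≥0 → Ω → Fin r → ℝ)
    (N : ℝ → ℕ) (Δ : ℝ → ℝ≥0) (u : ℝ≥0) (ε : ℝ) : ℝ≥0∞ :=
  eLpNorm (fun ω => empCov (Y ε) (N ε) (Δ ε) u ω - lagCov P X u) 2 P

/-- The `L²` error of the observable empirical mean. -/
def meanError (P : Measure Ω) (X : ℝ≥0 → Ω → Fin r → ℝ) (Y : ℝ → ℝ≥0 → Ω → Fin r → ℝ)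
    (N : ℝ → ℕ) (Δ : ℝ → ℝ≥0) (ε : ℝ) : ℝ≥0∞ :=
  eLpNorm (fun ω => empMean (Y ε) (N ε) (Δ ε) ω - mean P X) 2 P

end Processes

/-- The observational time span `N(ε) Δ(ε)`. -/
def span (N : ℝ → ℕ) (Δ : ℝ → ℝ≥0) (ε : ℝ) : ℝ := (N ε : ℝ) * (Δ ε : ℝ)

end

end IndirectObs

/-! Upper bound. The error of one entry of the covariance estimator splits into three kinds of
terms. Replacing `Y` by `X` costs a multiple of `ρ`, by Hölder from `L⁴` to `L²`. Rounding the lag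
costs at most a Lipschitz constant times `Δ`. The rest is the fluctuation of averages of `X`.
Samples at distance `kΔ` are correlated by at most a constant while `kΔ < 2` and by a multiple of
`f(kΔ)` afterwards, so the correlations of one sample with all others sum to `O(1/Δ)`, and an
average of `N` samples has variance `O(1/(NΔ))`. The product of two empirical means also needs a
fourth moment; the crude order `1/(NΔ)` is enough there. An optimized scheme has `NΔ` of order `ρ⁻²`
and `Δ` of order `ρ`, so that every term is `O(ρ)`. The carriers are `variance_average_le`,
`integral_average_pow_four_le`, `sum_rateBound_le` and `eLpNorm_empCov_entry_le`.

Lower bound. Let every coordinate of `X` be `c x` with `x` a stationary Ornstein-Uhlenbeck process,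
and let `Y = (1 ± δ) X`, where the sign is one independent fair coin and `δ = min ρ 1`. The
estimator is quadratic, so the coin multiplies it by `(1 ± δ)²`. The two outcomes differ by `4δ`
times the undistorted estimator, hence no target is approximated better than `2δ` times the absolute
mean of that estimator, in quadratic mean (`sq_integral_le_integral_distortedError_sq`). This mean
tends to `K(u) ≠ 0` for every adaptive scheme, which gives the order `ρ`.

Moreover the variance of the Ornstein-Uhlenbeck estimator is at least of order `1/S`, with `S = NΔ`
(`variance_scalarCov_ge`), and the distortion does not remove it. An error `O(ρ)` therefore forces
`1/S = O(ρ²)`, so `S` grows at least like `ρ⁻²`, the span of an optimized scheme.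

The process `x` is constructed from an isonormal Gaussian process. Only its stationarity and its
moments up to order four are used afterwards. -/

namespace IndirectObs

/-! ### Isonormal Gaussian processes -/

section Gaussian

open ProbabilityTheory Complex

/-- The characteristic functional of `L²` random variables is continuous. -/
theorem continuous_integral_exp_Lp {Ω : Type*} [MeasurableSpace Ω] (P : Measure Ω)
    [IsProbabilityMeasure P] (t : ℝ) :
    Continuous fun g : Lp ℝ 2 P => ∫ ω, cexp (t * g ω * I) ∂P := by
  have hint (g : Lp ℝ 2 P) : Integrable (fun ω => cexp (t * g ω * I)) P := by
    refine Integrable.of_bound (C := 1) ?_ (ae_of_all _ fun ω => ?_)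
    · have := Lp.aestronglyMeasurable g
      fun_prop
    · have := norm_exp_ofReal_mul_I (t * g ω)
      push_cast at this
      exact this.le
  -- The map is even Lipschitz: `y ↦ exp(ity)` is `|t|`-Lipschitz, and the `L¹` distance is at most
  -- the `L²` distance on a probability space.
  have key : LipschitzWith (Real.toNNReal |t|)
      (fun g : Lp ℝ 2 P => ∫ ω, cexp (t * g ω * I) ∂P) := by
    refine LipschitzWith.of_dist_le_mul fun g h => ?_
    have hgh : Integrable (g - h : Lp ℝ 2 P) P := (Lp.memLp (g - h)).integrable one_le_two
    rw [dist_eq_norm, ← integral_sub (hint g) (hint h), Real.coe_toNNReal _ (abs_nonneg t)]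
    calc ‖∫ ω, (cexp (t * g ω * I) - cexp (t * h ω * I)) ∂P‖
        ≤ ∫ ω, |t| * ‖(g - h : Lp ℝ 2 P) ω‖ ∂P := by
          refine norm_integral_le_of_norm_le (hgh.norm.const_mul _) ?_
          filter_upwards [Lp.coeFn_sub g h] with ω hω
          rw [hω]
          have h1 : cexp (t * g ω * I) - cexp (t * h ω * I)
              = cexp ((t * h ω : ℝ) * I) * (cexp (I * (t * (g ω - h ω) : ℝ)) - 1) := by
            rw [mul_sub, ← Complex.exp_add, mul_one]
            push_cast
            ring_nf
          rw [h1, norm_mul, norm_exp_ofReal_mul_I, one_mul]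
          refine (Real.norm_exp_I_mul_ofReal_sub_one_le).trans ?_
          simp
      _ = |t| * ∫ ω, ‖(g - h : Lp ℝ 2 P) ω‖ ∂P := integral_const_mul _ _
      _ ≤ |t| * dist g h := by
          gcongr
          have h1 := eLpNorm_le_eLpNorm_of_exponent_le (μ := P) one_le_two
            (Lp.aestronglyMeasurable (g - h))
          rw [dist_eq_norm, Lp.norm_def, integral_norm_eq_lintegral_enorm
            (Lp.aestronglyMeasurable (g - h)), ← eLpNorm_one_eq_lintegral_enorm]
          exact ENNReal.toReal_mono (Lp.eLpNorm_ne_top _) h1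
  exact key.continuous

/-- Every real Hilbert space carries an isonormal Gaussian process. -/
theorem exists_isonormal (H : Type) [NormedAddCommGroup H] [InnerProductSpace ℝ H]
    [CompleteSpace H] :
    ∃ (Ω : Type) (_ : MeasurableSpace Ω) (P : Measure Ω) (_ : IsProbabilityMeasure P)
      (W : H →ₗᵢ[ℝ] Lp ℝ 2 P), ∀ h, P.map (W h) = gaussianReal 0 (‖h‖₊ ^ 2) := by
  classical
  obtain ⟨w, b, -⟩ := exists_hilbertBasis ℝ H
  -- One independent standard Gaussian per vector of a Hilbert basis; `W` will send the basis to the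
  -- coordinate functions, which are orthonormal in `L²`.
  let P : Measure (w → ℝ) := Measure.infinitePi fun _ => gaussianReal 0 1
  have hm (i : w) : Measurable fun ω : w → ℝ => ω i := measurable_pi_apply i
  have hma (i : w) : AEMeasurable (fun ω : w → ℝ => ω i) P := (hm i).aemeasurable
  have hms (i : w) : AEStronglyMeasurable (fun ω : w → ℝ => ω i) P := (hm i).aestronglyMeasurable
  have hlaw (i : w) : P.map (fun ω => ω i) = gaussianReal 0 1 := Measure.infinitePi_map_eval _ i
  have hmem (i : w) : MemLp (fun ω : w → ℝ => ω i) 2 P := by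
    have := memLp_id_gaussianReal (μ := 0) (v := 1) 2
    rw [← hlaw i] at this
    exact (memLp_map_measure_iff (by fun_prop) (hma i)).1 this
  have hmean (i : w) : ∫ ω, ω i ∂P = 0 := by
    have := integral_id_gaussianReal (μ := 0) (v := 1)
    rw [← hlaw i, integral_map (hma i) (by fun_prop)] at this
    exact this
  have hsq (i : w) : ∫ ω, ω i * ω i ∂P = 1 := by
    have := variance_id_gaussianReal (μ := 0) (v := 1)
    rw [← hlaw i, variance_map (by fun_prop) (hma i),
      Function.id_comp, variance_of_integral_eq_zero (hma i) (by simpa using hmean i)] at this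
    simpa [pow_two] using this
  have hind : iIndepFun (fun (i : w) (ω : w → ℝ) => ω i) P :=
    iIndepFun_infinitePi (X := fun _ x => x) (by fun_prop)
  let e : w → Lp ℝ 2 P := fun i => (hmem i).toLp
  have he : Orthonormal ℝ e := by
    rw [orthonormal_iff_ite]
    intro i j
    rw [L2.inner_def]
    have h1 : ∫ ω, inner ℝ (e i ω) (e j ω) ∂P = ∫ ω, ω i * ω j ∂P := by
      refine integral_congr_ae ?_
      filter_upwards [(hmem i).coeFn_toLp, (hmem j).coeFn_toLp] with ω hi hj
      simp only [e, hi, hj]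
      simp [mul_comm]
    rw [h1]
    split_ifs with hij
    · rw [hij, hsq]
    · rw [(hind.indepFun hij).integral_fun_mul_eq_mul_integral (hms i) (hms j), hmean,
        zero_mul]
  let W : H →ₗᵢ[ℝ] Lp ℝ 2 P := (he.orthogonalFamily.linearIsometry).comp
    b.repr.toLinearIsometry
  have hWb (i : w) : W (b i) = e i := by
    simp [W, HilbertBasis.repr_self, OrthogonalFamily.linearIsometry_apply_single]
  -- Both sides are continuous in `h`, so it suffices to treat the dense span of the basis. There
  -- only finitely many coordinates occur and the integral factorizes by independence.
  have hchar (t : ℝ) (h : H) :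
      ∫ ω, cexp (t * W h ω * I) ∂P = cexp (-(‖h‖ ^ 2 * t ^ 2 / 2 : ℝ)) := by
    have hcl : IsClosed {h : H |
        ∫ ω, cexp (t * W h ω * I) ∂P = cexp (-(‖h‖ ^ 2 * t ^ 2 / 2 : ℝ))} :=
      isClosed_eq ((continuous_integral_exp_Lp P t).comp W.continuous) (by fun_prop)
    have hspan : (Submodule.span ℝ (Set.range b) : Set H) ⊆ {h : H |
        ∫ ω, cexp (t * W h ω * I) ∂P = cexp (-(‖h‖ ^ 2 * t ^ 2 / 2 : ℝ))} := by
      intro h hh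
      obtain ⟨c, rfl⟩ := (Finsupp.mem_span_range_iff_exists_finsupp).1 hh
      have hW : W (c.sum fun i a => a • b i) =ᵐ[P]
          fun ω => ∑ i ∈ c.support, c i * ω i := by
        have h1 : W (c.sum fun i a => a • b i) = ∑ i ∈ c.support, c i • e i := by
          simp [Finsupp.sum, hWb]
        rw [h1]
        have h2 : ∀ᵐ ω ∂P, ∀ i ∈ c.support, (c i • e i : Lp ℝ 2 P) ω = c i * ω i := by
          refine (ae_ball_iff c.support.countable_toSet).2 fun i _ => ?_
          filter_upwards [Lp.coeFn_smul (c i) (e i), (hmem i).coeFn_toLp] with ω h3 h4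
          rw [h3, Pi.smul_apply, smul_eq_mul, h4]
        filter_upwards [Lp.coeFn_finsetSum c.support (fun i => c i • e i), h2] with ω h3 h4
        rw [h3]
        simp only [Finset.sum_apply]
        exact Finset.sum_congr rfl h4
      have hnorm : ‖c.sum fun i a => a • b i‖ ^ 2 = ∑ i ∈ c.support, c i ^ 2 := by
        rw [← real_inner_self_eq_norm_sq, Finsupp.sum, b.orthonormal.inner_sum]
        simp [pow_two]
      have h1 : ∫ ω, cexp (t * W (c.sum fun i a => a • b i) ω * I) ∂P
          = ∫ ω, (fun y : c.support → ℝ => ∏ i : c.support, cexp ((t * c i : ℝ) * y i * I))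
            (c.support.restrict ω) ∂P := by
        refine integral_congr_ae ?_
        filter_upwards [hW] with ω h2
        simp only [h2, Finset.restrict]
        rw [Finset.prod_coe_sort c.support (fun i => cexp ((t * c i : ℝ) * ω i * I)),
          ← Complex.exp_sum]
        push_cast
        rw [Finset.mul_sum, Finset.sum_mul]
        simp only [mul_assoc]
      have h2 (i : c.support) : ∫ y, cexp ((t * c i : ℝ) * y * I) ∂gaussianReal 0 1
          = cexp (-((c i) ^ 2 * t ^ 2 / 2 : ℝ)) := by
        have := charFun_gaussianReal (μ := 0) (v := 1) (t * c i)
        rw [charFun_apply_real] at this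
        rw [this]
        push_cast
        ring_nf
      rw [Set.mem_ofPred_eq]
      have h3 := integral_restrict_infinitePi (fun _ : w => gaussianReal 0 1) (s := c.support)
        (f := fun y : c.support → ℝ => ∏ i : c.support, cexp ((t * c i : ℝ) * y i * I))
        (Measurable.aestronglyMeasurable (by fun_prop))
      refine h1.trans (h3.trans ?_)
      rw [integral_fintype_prod_eq_prod (f := fun (i : c.support) (y : ℝ) =>
        cexp ((t * c i : ℝ) * y * I))]
      simp only [h2]
      rw [Finset.prod_coe_sort c.support (fun i => cexp (-((c i) ^ 2 * t ^ 2 / 2 : ℝ))),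
        ← Complex.exp_sum, hnorm]
      push_cast
      rw [Finset.sum_mul, Finset.sum_div, Finset.sum_neg_distrib]
    have hd := hcl.closure_subset_iff.2 hspan
    have : h ∈ (Submodule.span ℝ (Set.range b)).topologicalClosure := by
      rw [b.dense_span]; trivial
    exact hd this
  refine ⟨w → ℝ, inferInstance, P, inferInstance, W, fun h => ?_⟩
  have := Measure.isProbabilityMeasure_map (μ := P) (Lp.aestronglyMeasurable (W h)).aemeasurable
  refine Measure.ext_of_charFun ?_
  ext t
  rw [charFun_gaussianReal, charFun_apply_real, integral_map
    (Lp.aestronglyMeasurable (W h)).aemeasurable (by fun_prop), hchar]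
  push_cast
  ring_nf

end Gaussian

/-! ### Gaussian moments and the Ornstein-Uhlenbeck process -/

section Gaussian

open ProbabilityTheory

/-- The moments are the derivatives at `0` of the moment generating function `exp(v t² / 2)`. -/
theorem integral_pow_gaussianReal (v : ℝ≥0) :
    ∫ x, x ^ 3 ∂gaussianReal 0 v = 0 ∧ ∫ x, x ^ 4 ∂gaussianReal 0 v = 3 * (v : ℝ) ^ 2 := by
  have h0 : (0 : ℝ) ∈ interior (integrableExpSet id (gaussianReal 0 v)) := by simp
  have hm : mgf id (gaussianReal 0 v) = fun t => Real.exp (v * t ^ 2 / 2) := by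
    simp [mgf_id_gaussianReal]
  have d0 (t : ℝ) : HasDerivAt (fun t : ℝ => Real.exp (v * t ^ 2 / 2))
      (v * t * Real.exp (v * t ^ 2 / 2)) t := by
    exact (((hasDerivAt_pow 2 t).const_mul (v : ℝ)).div_const 2).exp.congr_deriv
      (by push_cast; ring)
  have h1 : deriv (fun t : ℝ => Real.exp (v * t ^ 2 / 2)) =
      fun t => v * t * Real.exp (v * t ^ 2 / 2) := funext fun t => (d0 t).deriv
  have h2 : deriv (fun t : ℝ => v * t * Real.exp (v * t ^ 2 / 2)) =
      fun t => (v + v ^ 2 * t ^ 2) * Real.exp (v * t ^ 2 / 2) := funext fun t => by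
    exact ((((hasDerivAt_id' t).const_mul (v : ℝ)).fun_mul (d0 t)).congr_deriv (by ring)).deriv
  have h3 : deriv (fun t : ℝ => (v + v ^ 2 * t ^ 2) * Real.exp (v * t ^ 2 / 2)) =
      fun t => (3 * v ^ 2 * t + v ^ 3 * t ^ 3) * Real.exp (v * t ^ 2 / 2) := funext fun t => by
    exact (((((hasDerivAt_pow 2 t).const_mul ((v : ℝ) ^ 2)).const_add (v : ℝ)).fun_mul
      (d0 t)).congr_deriv (by push_cast; ring)).deriv
  have h4 : deriv (fun t : ℝ => (3 * v ^ 2 * t + v ^ 3 * t ^ 3) * Real.exp (v * t ^ 2 / 2)) =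
      fun t => (3 * v ^ 2 + 6 * v ^ 3 * t ^ 2 + v ^ 4 * t ^ 4) * Real.exp (v * t ^ 2 / 2) :=
    funext fun t => by
    exact ((((hasDerivAt_id' t).const_mul (3 * (v : ℝ) ^ 2)).fun_add
      ((hasDerivAt_pow 3 t).const_mul ((v : ℝ) ^ 3))).fun_mul (d0 t) |>.congr_deriv
        (by push_cast; ring)).deriv
  have e3 := iteratedDeriv_mgf_zero h0 3
  have e4 := iteratedDeriv_mgf_zero h0 4
  rw [hm] at e3 e4
  simp only [iteratedDeriv_succ, iteratedDeriv_zero, h1, h2, h3, h4] at e3 e4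
  simp only [Pi.pow_apply, id_eq] at e3 e4
  constructor
  · rw [← e3]; simp
  · rw [← e4]; simp

/-- A strictly stationary process with the first four moments of a centered Gaussian process with
covariance `exp (-|t - s|)`. -/
structure IsOrnsteinUhlenbeck {Ω : Type*} [MeasurableSpace Ω] (P : Measure Ω)
    (x : ℝ≥0 → Ω → ℝ) : Prop where
  measurable : ∀ t, Measurable (x t)
  stationary : ∀ (n : ℕ) (t : Fin n → ℝ≥0) (h : ℝ≥0),
    P.map (fun ω k => x (t k + h) ω) = P.map (fun ω k => x (t k) ω)
  memLp : ∀ t, MemLp (x t) 4 P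
  integral : ∀ t, ∫ ω, x t ω ∂P = 0
  integral_mul : ∀ s t, ∫ ω, x s ω * x t ω ∂P = Real.exp (-|(t : ℝ) - s|)
  integral_mul_mul : ∀ s t u, ∫ ω, x s ω * x t ω * x u ω ∂P = 0
  integral_four : ∀ s t u v, ∫ ω, x s ω * x t ω * (x u ω * x v ω) ∂P =
    Real.exp (-|(t : ℝ) - s|) * Real.exp (-|(v : ℝ) - u|)
      + Real.exp (-|(u : ℝ) - s|) * Real.exp (-|(v : ℝ) - t|)
      + Real.exp (-|(v : ℝ) - s|) * Real.exp (-|(u : ℝ) - t|)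

-- The process is `W` evaluated along a curve of unit vectors with inner products `exp(-|t - s|)`.
-- Stationarity follows because the joint characteristic function depends on inner products only;
-- the mixed moments follow from those of a single Gaussian by polarization.
open Complex in
theorem exists_isOrnsteinUhlenbeck :
    ∃ (Ω : Type) (_ : MeasurableSpace Ω) (P : Measure Ω) (_ : IsProbabilityMeasure P)
      (x : ℝ≥0 → Ω → ℝ), IsOrnsteinUhlenbeck P x := by
  obtain ⟨Ω, mΩ, P, hP, W, hW⟩ := exists_isonormal (Lp ℝ 2 (volume : Measure ℝ))
  -- This is the time change `exp(-t) B(exp(2t))` of Brownian motion: the inner product is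
  -- `exp(-s-t) exp(2 min(s,t))`.
  let h : ℝ≥0 → Lp ℝ 2 (volume : Measure ℝ) := fun t => Real.exp (-t) •
    indicatorConstLp 2 (measurableSet_Icc (a := (0 : ℝ)) (b := Real.exp (2 * t)))
      isCompact_Icc.measure_ne_top (1 : ℝ)
  have hinner (s t : ℝ≥0) : inner ℝ (h s) (h t) = Real.exp (-|(t : ℝ) - s|) := by
    simp only [h]
    rw [real_inner_smul_left, real_inner_smul_right,
      L2.real_inner_indicatorConstLp_one_indicatorConstLp_one (hμs := isCompact_Icc.measure_ne_top)
        (hμt := isCompact_Icc.measure_ne_top), Set.Icc_inter_Icc]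
    simp only [max_self, Real.volume_real_Icc, sub_zero]
    rcases le_total s t with hst | hst
    · have h1 : Real.exp (2 * s) ≤ Real.exp (2 * t) := by gcongr
      rw [inf_eq_left.2 h1, max_eq_left (Real.exp_pos _).le,
        abs_of_nonneg (sub_nonneg.2 (NNReal.coe_le_coe.2 hst)), ← Real.exp_add, ← Real.exp_add]
      ring_nf
    · have h1 : Real.exp (2 * t) ≤ Real.exp (2 * s) := by gcongr
      rw [inf_eq_right.2 h1, max_eq_left (Real.exp_pos _).le,
        abs_of_nonpos (sub_nonpos.2 (NNReal.coe_le_coe.2 hst)), ← Real.exp_add, ← Real.exp_add]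
      ring_nf
  have hmem (g) : MemLp (W g) 4 P := by
    have := memLp_id_gaussianReal (μ := 0) (v := ‖g‖₊ ^ 2) 4
    rw [← hW g] at this
    exact (memLp_map_measure_iff (by fun_prop) (Lp.aestronglyMeasurable _).aemeasurable).1 this
  have hm (g) : AEMeasurable (W g) P := (Lp.aestronglyMeasurable _).aemeasurable
  have hone (g) : ∫ ω, W g ω ∂P = 0 := by
    have := integral_id_gaussianReal (μ := 0) (v := ‖g‖₊ ^ 2)
    rwa [← hW g, integral_map (hm g) (by fun_prop)] at this
  have hthree (g) : ∫ ω, W g ω ^ 3 ∂P = 0 := by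
    have := (integral_pow_gaussianReal (‖g‖₊ ^ 2)).1
    rwa [← hW g, integral_map (hm g) (by fun_prop)] at this
  have hfour (g) : ∫ ω, W g ω ^ 4 ∂P = 3 * (inner ℝ g g) ^ 2 := by
    have := (integral_pow_gaussianReal (‖g‖₊ ^ 2)).2
    rw [← hW g, integral_map (hm g) (by fun_prop)] at this
    rw [this, real_inner_self_eq_norm_sq]
    simp
  have hi4 (g) : Integrable (fun ω => W g ω ^ 4) P := by
    refine ((hmem g).integrable_norm_pow (by norm_num)).congr (ae_of_all _ fun ω => ?_)
    exact (even_two_mul 2).pow_abs _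
  have hi3 (g) : Integrable (fun ω => W g ω ^ 3) P := by
    have := ((hmem g).mono_exponent (p := 3) (by norm_num)).integrable_norm_pow (by norm_num)
    refine this.mono ((hm g).pow_const 3).aestronglyMeasurable (ae_of_all _ fun ω => by simp)
  have hlin (a b c d : ℝ) (g₁ g₂ g₃ g₄) :
      W (a • g₁ + b • g₂ + c • g₃ + d • g₄) =ᵐ[P]
        fun ω => a * W g₁ ω + b * W g₂ ω + c * W g₃ ω + d * W g₄ ω := by
    simp only [map_add, map_smul]
    filter_upwards [Lp.coeFn_add (a • W g₁ + b • W g₂ + c • W g₃) (d • W g₄),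
      Lp.coeFn_add (a • W g₁ + b • W g₂) (c • W g₃), Lp.coeFn_add (a • W g₁) (b • W g₂),
      Lp.coeFn_smul a (W g₁), Lp.coeFn_smul b (W g₂), Lp.coeFn_smul c (W g₃),
      Lp.coeFn_smul d (W g₄)] with ω h₁ h₂ h₃ h₄ h₅ h₆ h₇
    simp only [h₁, h₂, h₃, h₄, h₅, h₆, h₇, Pi.add_apply, Pi.smul_apply, smul_eq_mul]
  let sg : Fin 2 → ℝ := ![1, -1]
  refine ⟨Ω, mΩ, P, hP, fun t => W (h t), ?_, ?_, fun t => hmem _, fun t => hone _, ?_, ?_, ?_⟩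
  · exact fun t => (Lp.stronglyMeasurable (W (h t))).measurable
  · intro n t k
    have hmeas (t : Fin n → ℝ≥0) : AEMeasurable (fun ω k => W (h (t k)) ω) P :=
      aemeasurable_pi_lambda _ fun _ => hm _
    -- A linear functional of the sampled vector is `W g` for one `g`, hence Gaussian with variance
    -- `‖g‖²`, and this variance involves the times only through their differences.
    have key (t : Fin n → ℝ≥0) (L : StrongDual ℝ (Fin n → ℝ)) :
        charFunDual (P.map (fun ω k => W (h (t k)) ω)) L =
          cexp (-((∑ i, ∑ j, L (Pi.single i 1) * (L (Pi.single j 1) *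
            Real.exp (-|(t j : ℝ) - t i|)) : ℝ) / 2)) := by
      set g := ∑ i, L (Pi.single i 1) • h (t i) with hg
      have hLg : (fun ω => L fun k => W (h (t k)) ω) =ᵐ[P] W g := by
        have h1 : W g = ∑ i, L (Pi.single i 1) • W (h (t i)) := by simp [hg]
        have h2 : ∀ᵐ ω ∂P, ∀ i, (L (Pi.single i 1) • W (h (t i)) : Lp ℝ 2 P) ω
            = L (Pi.single i 1) * W (h (t i)) ω :=
          ae_all_iff.2 fun i => Lp.coeFn_smul _ _
        rw [h1]
        filter_upwards [Lp.coeFn_finsetSum Finset.univ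
          (fun i => L (Pi.single i 1) • W (h (t i))), h2] with ω h3 h4
        rw [h3, Finset.sum_apply]
        simp only [h4]
        conv_lhs => rw [pi_eq_sum_univ' (fun k => W (h (t k)) ω)]
        simp [mul_comm]
      have hgg : ‖g‖ ^ 2 = ∑ i, ∑ j, L (Pi.single i 1) * (L (Pi.single j 1) *
            Real.exp (-|(t j : ℝ) - t i|)) := by
        rw [← real_inner_self_eq_norm_sq, hg, sum_inner]
        refine Finset.sum_congr rfl fun i _ => ?_
        rw [inner_sum]
        refine Finset.sum_congr rfl fun j _ => ?_
        rw [real_inner_smul_left, real_inner_smul_right, hinner]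
      rw [charFunDual_apply, integral_map (hmeas t) (by fun_prop)]
      have h1 : ∫ ω, cexp ((L fun k => W (h (t k)) ω) * I) ∂P = ∫ ω, cexp (W g ω * I) ∂P := by
        refine integral_congr_ae ?_
        filter_upwards [hLg] with ω h2
        rw [h2]
      have h2 := charFun_gaussianReal (μ := 0) (v := ‖g‖₊ ^ 2) 1
      rw [← hW g, charFun_apply_real, integral_map (hm g) (by fun_prop)] at h2
      rw [h1, ← hgg]
      simp only [ofReal_one, one_mul] at h2
      rw [h2]
      simp
    have h1 := Measure.isProbabilityMeasure_map (hmeas t)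
    have h2 := Measure.isProbabilityMeasure_map (hmeas fun j => t j + k)
    refine Measure.ext_of_charFunDual ?_
    ext L
    rw [key t L, key (fun j => t j + k) L]
    simp
  · intro s t
    rw [← hinner, ← W.inner_map_map, L2.inner_def]
    refine integral_congr_ae (ae_of_all _ fun ω => ?_)
    simp only [RCLike.inner_apply, conj_trivial]
    exact mul_comm _ _
  · intro s t u
    have h1 (σ : Fin 2 × Fin 2) := hlin 1 (sg σ.1) (sg σ.2) 0 (h s) (h t) (h u) 0
    -- Polarization: the signed sum of cubes over four sign patterns leaves `3! · 4 = 24` times the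
    -- product.
    have h2 : ∫ ω, W (h s) ω * W (h t) ω * W (h u) ω ∂P = ∫ ω, ∑ σ : Fin 2 × Fin 2,
        sg σ.1 * sg σ.2 / 24 *
          W ((1 : ℝ) • h s + sg σ.1 • h t + sg σ.2 • h u + (0 : ℝ) • 0) ω ^ 3 ∂P := by
      refine integral_congr_ae ?_
      filter_upwards [ae_all_iff.2 h1] with ω h3
      simp only [h3, Fintype.sum_prod_type, Fin.sum_univ_two, sg, Matrix.cons_val_zero,
        Matrix.cons_val_one]
      ring
    rw [h2, integral_finsetSum _ fun σ _ => (hi3 _).const_mul _]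
    simp only [integral_const_mul, hthree, mul_zero, Finset.sum_const_zero]
  · intro s t u v
    have h1 (σ : Fin 2 × Fin 2 × Fin 2) :=
      hlin 1 (sg σ.1) (sg σ.2.1) (sg σ.2.2) (h s) (h t) (h u) (h v)
    -- The same with fourth powers and eight sign patterns: `4! · 8 = 192`. Inserting `3 ‖g‖⁴` then
    -- produces the three pairings.
    have h2 : ∫ ω, W (h s) ω * W (h t) ω * (W (h u) ω * W (h v) ω) ∂P =
        ∫ ω, ∑ σ : Fin 2 × Fin 2 × Fin 2, sg σ.1 * sg σ.2.1 * sg σ.2.2 / 192 *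
          W ((1 : ℝ) • h s + sg σ.1 • h t + sg σ.2.1 • h u + sg σ.2.2 • h v) ω ^ 4 ∂P := by
      refine integral_congr_ae ?_
      filter_upwards [ae_all_iff.2 h1] with ω h3
      simp only [h3, Fintype.sum_prod_type, Fin.sum_univ_two, sg, Matrix.cons_val_zero,
        Matrix.cons_val_one]
      ring
    rw [h2, integral_finsetSum _ fun σ _ => (hi4 _).const_mul _]
    have h3 (a b c d : ℝ) : inner ℝ (a • h s + b • h t + c • h u + d • h v)
        (a • h s + b • h t + c • h u + d • h v) =
        a ^ 2 * inner ℝ (h s) (h s) + b ^ 2 * inner ℝ (h t) (h t) + c ^ 2 * inner ℝ (h u) (h u)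
        + d ^ 2 * inner ℝ (h v) (h v) + 2 * (a * b * inner ℝ (h s) (h t)
        + a * c * inner ℝ (h s) (h u) + a * d * inner ℝ (h s) (h v) + b * c * inner ℝ (h t) (h u)
        + b * d * inner ℝ (h t) (h v) + c * d * inner ℝ (h u) (h v)) := by
      simp only [inner_add_left, inner_add_right, real_inner_smul_left, real_inner_smul_right]
      rw [real_inner_comm (h s) (h t), real_inner_comm (h s) (h u), real_inner_comm (h s) (h v),
        real_inner_comm (h t) (h u), real_inner_comm (h t) (h v), real_inner_comm (h u) (h v)]
      ring
    simp only [integral_const_mul, hfour, h3, Fintype.sum_prod_type, Fin.sum_univ_two, sg,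
      Matrix.cons_val_zero, Matrix.cons_val_one]
    rw [← hinner s t, ← hinner u v, ← hinner s u, ← hinner t v, ← hinner s v, ← hinner t u]
    ring

end Gaussian

instance holderTriple_four_four_two : ENNReal.HolderTriple 4 4 2 where
  inv_add_inv_eq_inv := by
    rw [← two_mul, show (4 : ℝ≥0∞) = 2 * 2 by norm_num, ENNReal.mul_inv (by simp) (by simp),
      ← mul_assoc, ENNReal.mul_inv_cancel (by simp) (by simp), one_mul]

theorem memLp_two_mul {Ω : Type*} [MeasurableSpace Ω] {P : Measure Ω} {f g : Ω → ℝ}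
    (hf : MemLp f 4 P) (hg : MemLp g 4 P) :
    MemLp (fun ω => f ω * g ω) 2 P :=
  hg.mul' hf

/-! ### Sums of weights over distances of indices -/

section Sums

variable {φ : ℕ → ℝ} {B : ℝ}

theorem sum_comp_le_of_injOn (hφ : ∀ j, 0 ≤ φ j) (hB : ∀ n, ∑ j ∈ Finset.range n, φ j ≤ B)
    (s : Finset ℕ) (g : ℕ → ℕ) (hg : Set.InjOn g s) : ∑ m ∈ s, φ (g m) ≤ B := by
  rw [← Finset.sum_image hg]
  refine le_trans (Finset.sum_le_sum_of_subset_of_nonneg ?_ fun i _ _ => hφ i)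
    (hB ((s.image g).sup id + 1))
  intro i hi
  exact Finset.mem_range.2 (Nat.lt_succ_of_le (Finset.le_sup (f := id) hi))

/-- Each distance from `n` occurs at most once on each side of `n`, whence the factor `2`. -/
theorem sum_dist_le (hφ : ∀ j, 0 ≤ φ j) (hB : ∀ n, ∑ j ∈ Finset.range n, φ j ≤ B)
    (s : Finset ℕ) (n : ℕ) : ∑ m ∈ s, φ (Nat.dist n m) ≤ 2 * B := by
  rw [← Finset.sum_filter_add_sum_filter_not s (fun m => m ≤ n), two_mul]
  refine add_le_add (sum_comp_le_of_injOn hφ hB _ _ ?_) (sum_comp_le_of_injOn hφ hB _ _ ?_)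
  · intro a ha b hb hab
    simp only [Finset.coe_filter, Set.mem_ofPred_eq] at ha hb
    simp only [Nat.dist] at hab
    omega
  · intro a ha b hb hab
    simp only [Finset.coe_filter, Set.mem_ofPred_eq] at ha hb
    simp only [Nat.dist] at hab
    omega

end Sums

/-! ### Second and fourth moments of averages under weak correlation -/

section Moments

open ProbabilityTheory

variable {Ω : Type*} [MeasurableSpace Ω] {P : Measure Ω} {φ : ℕ → ℝ} {B : ℝ}

/-- The variance of the average of weakly correlated random variables. -/
theorem variance_average_le [IsProbabilityMeasure P] (hφ : ∀ j, 0 ≤ φ j) (hB : ∀ n, ∑ j ∈ Finset.range n, φ j ≤ B)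
    (s : Finset ℕ) (w : ℕ → Ω → ℝ) (hw : ∀ n, MemLp (w n) 2 P)
    (hcov : ∀ n m, |cov[w n, w m; P]| ≤ φ (Nat.dist n m)) :
    Var[fun ω => (s.card : ℝ)⁻¹ * ∑ n ∈ s, w n ω; P] ≤ 2 * B / s.card := by
  rcases s.eq_empty_or_nonempty with rfl | hs
  · simp only [Finset.sum_empty, mul_zero, Finset.card_empty, Nat.cast_zero, div_zero]
    exact (variance_zero P).le
  have hN : (0 : ℝ) < s.card := by exact_mod_cast hs.card_pos
  rw [variance_const_mul, variance_fun_sum' fun i _ => hw i]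
  calc ((s.card : ℝ)⁻¹) ^ 2 * ∑ i ∈ s, ∑ j ∈ s, cov[w i, w j; P]
      ≤ ((s.card : ℝ)⁻¹) ^ 2 * ∑ i ∈ s, 2 * B := by
        gcongr with i hi
        refine le_trans (Finset.sum_le_sum fun j _ => (le_abs_self _).trans (hcov i j)) ?_
        exact sum_dist_le hφ hB s i
    _ = 2 * B / s.card := by
        rw [Finset.sum_const, nsmul_eq_mul]
        field_simp

/-- The fourth moment of the average of weakly correlated centered random variables. -/
theorem integral_average_pow_four_le (hφ : ∀ j, 0 ≤ φ j)
    (hB : ∀ n, ∑ j ∈ Finset.range n, φ j ≤ B) {M : ℝ}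
    (s : Finset ℕ) (z : ℕ → Ω → ℝ) (hz : ∀ n, MemLp (z n) 4 P)
    (hM : ∀ a b, |∫ ω, z a ω * z b ω ∂P| ≤ M)
    (h2 : ∀ a b, a ≤ b → |∫ ω, z a ω * z b ω ∂P| ≤ φ (b - a))
    (h4 : ∀ a b c d, a ≤ b → b ≤ c → c ≤ d →
      |(∫ ω, z a ω * z b ω * (z c ω * z d ω) ∂P)
        - (∫ ω, z a ω * z b ω ∂P) * ∫ ω, z c ω * z d ω ∂P| ≤ φ (c - b)) :
    ∫ ω, ((s.card : ℝ)⁻¹ * ∑ n ∈ s, z n ω) ^ 4 ∂P ≤ 24 * (1 + M) * B / s.card := by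
  have hM0 : 0 ≤ M := (abs_nonneg _).trans (hM 0 0)
  rcases s.eq_empty_or_nonempty with rfl | hs
  · simp
  have hN : (0 : ℝ) < s.card := by exact_mod_cast hs.card_pos
  -- A majorant over all pairs of indices: it is wasteful, but symmetric, so that a bound for
  -- ordered indices extends to all of them.
  let R : (Fin 4 → ℕ) → ℝ := fun t => ∑ i, ∑ j, if i = j then 0 else φ (Nat.dist (t i) (t j))
  -- Splitting at the middle gap costs `φ (t 2 - t 1)`; the product of the two pair correlations
  -- that remains is at most `φ (t 1 - t 0) * M`.
  have hsorted (t : Fin 4 → ℕ) (ht : Monotone t) :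
      |∫ ω, ∏ i, z (t i) ω ∂P| ≤ (1 + M) * R t := by
    have h01 : t 0 ≤ t 1 := ht (by decide)
    have h12 : t 1 ≤ t 2 := ht (by decide)
    have h23 : t 2 ≤ t 3 := ht (by decide)
    have e1 : Nat.dist (t 1) (t 2) = t 2 - t 1 := Nat.dist_eq_sub_of_le h12
    have e2 : Nat.dist (t 0) (t 1) = t 1 - t 0 := Nat.dist_eq_sub_of_le h01
    have hR : φ (t 2 - t 1) + φ (t 1 - t 0) ≤ R t := by
      simp only [R, Fin.sum_univ_four]
      simp only [Fin.isValue, reduceIte, Fin.reduceEq, e1, e2]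
      have := fun i j => hφ (Nat.dist (t i) (t j))
      linarith [this 0 2, this 0 3, this 1 0, this 1 3, this 2 0, this 2 1, this 2 3, this 3 0,
        this 3 1, this 3 2]
    have e3 : ∫ ω, ∏ i, z (t i) ω ∂P =
        ∫ ω, z (t 0) ω * z (t 1) ω * (z (t 2) ω * z (t 3) ω) ∂P := by
      simp only [Fin.prod_univ_four, mul_assoc]
    rw [e3]
    have h5 := h4 _ _ _ _ h01 h12 h23
    have h6 : |(∫ ω, z (t 0) ω * z (t 1) ω ∂P) * ∫ ω, z (t 2) ω * z (t 3) ω ∂P|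
        ≤ φ (t 1 - t 0) * M := by
      rw [abs_mul]
      exact mul_le_mul (h2 _ _ h01) (hM _ _) (abs_nonneg _) (hφ _)
    have h7 := abs_sub_abs_le_abs_sub (∫ ω, z (t 0) ω * z (t 1) ω * (z (t 2) ω * z (t 3) ω) ∂P)
      ((∫ ω, z (t 0) ω * z (t 1) ω ∂P) * ∫ ω, z (t 2) ω * z (t 3) ω ∂P)
    have h8 := mul_le_mul_of_nonneg_left hR (by linarith : 0 ≤ 1 + M)
    nlinarith [mul_nonneg hM0 (hφ (t 2 - t 1)), hφ (t 1 - t 0)]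
  have hall (t : Fin 4 → ℕ) : |∫ ω, ∏ i, z (t i) ω ∂P| ≤ (1 + M) * R t := by
    have h1 := hsorted (t ∘ Tuple.sort t) (Tuple.monotone_sort t)
    have h2 : ∫ ω, ∏ i, z ((t ∘ Tuple.sort t) i) ω ∂P = ∫ ω, ∏ i, z (t i) ω ∂P := by
      congr 1
      ext ω
      exact Equiv.prod_comp (Tuple.sort t) fun i => z (t i) ω
    have h3 : R (t ∘ Tuple.sort t) = R t := by
      simp only [R, Function.comp_apply]
      conv_rhs => rw [← Equiv.sum_comp (Tuple.sort t)]
      refine Finset.sum_congr rfl fun i _ => ?_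
      conv_rhs => rw [← Equiv.sum_comp (Tuple.sort t)]
      simp only [EmbeddingLike.apply_eq_iff_eq]
    rwa [h2, h3] at h1
  have hint (a b c d : ℕ) : Integrable (fun ω => z a ω * (z b ω * (z c ω * z d ω))) P := by
    have h1 (a b : ℕ) : MemLp (fun ω => z a ω * z b ω) 2 P := memLp_two_mul (hz a) (hz b)
    refine ((h1 a b).integrable_mul (h1 c d)).congr (ae_of_all _ fun ω => ?_)
    simp [mul_assoc]
  have hexp : ∫ ω, (∑ n ∈ s, z n ω) ^ 4 ∂P = ∑ a ∈ s, ∑ b ∈ s, ∑ c ∈ s, ∑ d ∈ s,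
      ∫ ω, z a ω * (z b ω * (z c ω * z d ω)) ∂P := by
    have h1 (ω : Ω) : (∑ n ∈ s, z n ω) ^ 4 = ∑ a ∈ s, ∑ b ∈ s, ∑ c ∈ s, ∑ d ∈ s,
        z a ω * (z b ω * (z c ω * z d ω)) := by
      simp only [← Finset.mul_sum, ← Finset.sum_mul]
      ring
    simp only [h1]
    rw [integral_finsetSum _ fun a _ => integrable_finsetSum _ fun b _ =>
      integrable_finsetSum _ fun c _ => integrable_finsetSum _ fun d _ => hint a b c d]
    refine Finset.sum_congr rfl fun a _ => ?_
    rw [integral_finsetSum _ fun b _ =>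
      integrable_finsetSum _ fun c _ => integrable_finsetSum _ fun d _ => hint a b c d]
    refine Finset.sum_congr rfl fun b _ => ?_
    rw [integral_finsetSum _ fun c _ => integrable_finsetSum _ fun d _ => hint a b c d]
    refine Finset.sum_congr rfl fun c _ => ?_
    rw [integral_finsetSum _ fun d _ => hint a b c d]
  have hbound : ∫ ω, (∑ n ∈ s, z n ω) ^ 4 ∂P ≤ (1 + M) * (24 * s.card ^ 3 * B) := by
    rw [hexp]
    have h1 : ∑ a ∈ s, ∑ b ∈ s, ∑ c ∈ s, ∑ d ∈ s, ∫ ω, z a ω * (z b ω * (z c ω * z d ω)) ∂P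
        ≤ ∑ a ∈ s, ∑ b ∈ s, ∑ c ∈ s, ∑ d ∈ s, (1 + M) * R ![a, b, c, d] := by
      gcongr with a _ b _ c _ d _
      refine (le_abs_self _).trans ?_
      have := hall ![a, b, c, d]
      simpa [Fin.prod_univ_four, mul_assoc] using this
    refine h1.trans ?_
    simp only [← Finset.mul_sum]
    gcongr
    have hD : ∑ a ∈ s, ∑ b ∈ s, φ (Nat.dist a b) ≤ s.card * (2 * B) := by
      rw [← nsmul_eq_mul, ← Finset.sum_const]
      exact Finset.sum_le_sum fun a _ => sum_dist_le hφ hB s a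
    -- Six pairs, each counted twice. With two indices free, the sum over a pair is at most `N² · N
    -- · 2B`, where `N` is the number of terms; in total `24 N³ B`.
    have hR (a b c d : ℕ) : R ![a, b, c, d] = 2 * (φ (Nat.dist a b) + φ (Nat.dist a c)
        + φ (Nat.dist a d) + φ (Nat.dist b c) + φ (Nat.dist b d) + φ (Nat.dist c d)) := by
      simp only [R, Fin.sum_univ_four]
      simp only [Fin.isValue, reduceIte, Fin.reduceEq, Matrix.cons_val]
      rw [Nat.dist_comm b a, Nat.dist_comm c a, Nat.dist_comm d a, Nat.dist_comm c b,
        Nat.dist_comm d b, Nat.dist_comm d c]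
      ring
    simp only [hR, ← Finset.mul_sum, Finset.sum_add_distrib, Finset.sum_const, nsmul_eq_mul]
    nlinarith [mul_le_mul_of_nonneg_left hD (by positivity : (0 : ℝ) ≤ s.card ^ 2)]
  simp only [mul_pow]
  rw [integral_const_mul]
  calc ((s.card : ℝ)⁻¹) ^ 4 * ∫ ω, (∑ n ∈ s, z n ω) ^ 4 ∂P
      ≤ ((s.card : ℝ)⁻¹) ^ 4 * ((1 + M) * (24 * s.card ^ 3 * B)) := by gcongr
    _ = 24 * (1 + M) * B / s.card := by field_simp

end Moments

/-! ### Summing a decorrelation rate along a sampling grid -/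

section Rates

/-- The bound of a correlation at the time distance `k Δ`, given by a crude constant `M` at short
distances and by a decorrelation rate `f` at long distances. -/
noncomputable def rateBound (f : ℝ → ℝ) (M Δ : ℝ) (k : ℕ) : ℝ :=
  if k * Δ < 2 then M else f (k * Δ)

variable {f : ℝ → ℝ} {M Δ : ℝ}

theorem rateBound_nonneg (hf : ∀ T, 0 < T → 0 ≤ f T) (hM : 0 ≤ M) (k : ℕ) :
    0 ≤ rateBound f M Δ k := by
  unfold rateBound
  split_ifs with h
  · exact hM
  · exact hf _ (by linarith)

/-- At most `3/Δ` indices are at short distance; the other terms form a Riemann sum of a decreasing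
function. Comparison with the integral moves back by one step `Δ ≤ 1`, so the threshold `2` keeps
the integration inside `[1, ∞)`. -/
theorem sum_rateBound_le (hf : ∀ T, 0 < T → 0 ≤ f T) (hanti : AntitoneOn f (Set.Ioi 0))
    (hint : IntegrableOn f (Set.Ioi 1)) (hM : 0 ≤ M) (hΔ : 0 < Δ) (hΔ1 : Δ ≤ 1) (n : ℕ) :
    ∑ j ∈ Finset.range n, rateBound f M Δ j ≤ (3 * M + ∫ T in Set.Ioi 1, f T) / Δ := by
  set k := ⌈2 / Δ⌉₊ with hk
  have hk1 : 2 / Δ ≤ k := Nat.le_ceil _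
  have hk2 : (k : ℝ) < 2 / Δ + 1 := Nat.ceil_lt_add_one (by positivity)
  have hk3 : (k : ℝ) * Δ ≤ 3 := by
    have := mul_le_mul_of_nonneg_right hk2.le hΔ.le
    rw [add_mul, div_mul_cancel₀ _ hΔ.ne'] at this
    linarith
  have hk4 : 2 ≤ (k : ℝ) * Δ := (div_le_iff₀ hΔ).1 hk1
  have h1 : ∑ j ∈ Finset.range n, rateBound f M Δ j ≤
      ∑ j ∈ Finset.range (k + n), rateBound f M Δ j :=
    Finset.sum_le_sum_of_subset_of_nonneg (Finset.range_mono (by omega))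
      fun i _ _ => rateBound_nonneg hf hM i
  rw [Finset.sum_range_add] at h1
  have h2 : ∑ j ∈ Finset.range k, rateBound f M Δ j ≤ 3 * M / Δ := by
    calc ∑ j ∈ Finset.range k, rateBound f M Δ j ≤ ∑ j ∈ Finset.range k, M := by
          refine Finset.sum_le_sum fun j hj => ?_
          have : (j : ℝ) < 2 / Δ := Nat.lt_ceil.1 (Finset.mem_range.1 hj)
          rw [rateBound, if_pos ((lt_div_iff₀ hΔ).1 this)]
      _ = k * M := by simp
      _ ≤ 3 * M / Δ := by
          rw [le_div_iff₀ hΔ]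
          nlinarith
  have h3 : ∑ j ∈ Finset.range n, rateBound f M Δ (k + j) ≤ (∫ T in Set.Ioi 1, f T) / Δ := by
    have hx : (1 : ℝ) ≤ ((k : ℝ) - 1) * Δ := by linarith
    have hmap : AntitoneOn (fun y => f (y * Δ)) (Set.Icc ((k : ℝ) - 1) ((k : ℝ) - 1 + n)) := by
      intro a ha b hb hab
      have h5 := mul_le_mul_of_nonneg_right ha.1 hΔ.le
      have h6 := mul_le_mul_of_nonneg_right hab hΔ.le
      exact hanti (Set.mem_Ioi.2 (by linarith)) (Set.mem_Ioi.2 (by linarith)) h6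
    have h4 := hmap.sum_le_integral
    have h5 : ∑ j ∈ Finset.range n, rateBound f M Δ (k + j) =
        ∑ i ∈ Finset.range n, f (((k : ℝ) - 1 + ↑(i + 1)) * Δ) := by
      refine Finset.sum_congr rfl fun i _ => ?_
      rw [rateBound, if_neg]
      · congr 2
        push_cast
        ring
      · push_cast
        have : 0 ≤ (i : ℝ) * Δ := by positivity
        linarith
    rw [h5]
    refine h4.trans ?_
    rw [intervalIntegral.integral_comp_mul_right _ hΔ.ne', smul_eq_mul, div_eq_inv_mul]
    gcongr
    rw [intervalIntegral.integral_of_le (by gcongr; simp)]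
    refine setIntegral_mono_set hint ?_ ?_
    · exact (ae_restrict_iff' measurableSet_Ioi).2 (ae_of_all _ fun T hT =>
        hf T (lt_trans one_pos hT))
    · exact LE.le.eventuallyLE fun T hT => Set.mem_Ioi.2 (lt_of_le_of_lt hx hT.1)
  rw [add_div]
  linarith

/-- Meant for lagged products: two of them overlap in time when their indices differ by less than
`κ`, and they decorrelate only beyond that distance. -/
theorem sum_ite_lt_le {φ : ℕ → ℝ} {B : ℝ} (hφ : ∀ j, 0 ≤ φ j) (hM : 0 ≤ M)
    (hB : ∀ n, ∑ j ∈ Finset.range n, φ j ≤ B) (κ n : ℕ) :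
    ∑ j ∈ Finset.range n, (if j < κ then M else φ (j - κ)) ≤ κ * M + B := by
  have h0 : ∀ j, 0 ≤ (if j < κ then M else φ (j - κ)) := fun j => by
    split_ifs
    exacts [hM, hφ _]
  have h1 : ∑ j ∈ Finset.range n, (if j < κ then M else φ (j - κ)) ≤
      ∑ j ∈ Finset.range (κ + n), (if j < κ then M else φ (j - κ)) :=
    Finset.sum_le_sum_of_subset_of_nonneg (Finset.range_mono (by omega)) fun i _ _ => h0 i
  rw [Finset.sum_range_add] at h1
  refine h1.trans (add_le_add ?_ ?_)
  · rw [Finset.sum_congr rfl fun j hj => if_pos (Finset.mem_range.1 hj)]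
    simp
  · simpa using hB n

end Rates

/-! ### Integral bounds from `L²` and `L⁴` norms -/

section Norms

variable {Ω : Type*} [MeasurableSpace Ω] {P : Measure Ω}

theorem eLpNorm_two_le_ofReal {g : Ω → ℝ} (hg : MemLp g 2 P) {c : ℝ} (hc : 0 ≤ c)
    (h : ∫ ω, g ω ^ 2 ∂P ≤ c ^ 2) : eLpNorm g 2 P ≤ ENNReal.ofReal c := by
  rw [hg.eLpNorm_eq_integral_rpow_norm (by simp) (by simp)]
  refine ENNReal.ofReal_le_ofReal ?_
  simp only [ENNReal.toReal_ofNat, Real.rpow_ofNat, Real.norm_eq_abs, sq_abs]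
  calc (∫ ω, g ω ^ 2 ∂P) ^ (2 : ℝ)⁻¹ ≤ (c ^ 2) ^ (2 : ℝ)⁻¹ := by
        refine Real.rpow_le_rpow (integral_nonneg fun _ => sq_nonneg _) h (by norm_num)
    _ = c := by
        rw [← Real.rpow_natCast, ← Real.rpow_mul hc]
        norm_num

theorem integral_sq_le_of_eLpNorm {g : Ω → ℝ} (hg : MemLp g 2 P) {c : ℝ} (hc : 0 ≤ c)
    (h : eLpNorm g 2 P ≤ ENNReal.ofReal c) : ∫ ω, g ω ^ 2 ∂P ≤ c ^ 2 := by
  rw [hg.eLpNorm_eq_integral_rpow_norm (by simp) (by simp), ENNReal.ofReal_le_ofReal_iff hc] at h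
  simp only [ENNReal.toReal_ofNat, Real.rpow_ofNat, Real.norm_eq_abs, sq_abs] at h
  have h0 : 0 ≤ ∫ ω, g ω ^ 2 ∂P := integral_nonneg fun _ => sq_nonneg _
  calc ∫ ω, g ω ^ 2 ∂P = ((∫ ω, g ω ^ 2 ∂P) ^ (2 : ℝ)⁻¹) ^ 2 := by
        rw [← Real.rpow_natCast, ← Real.rpow_mul h0]
        norm_num
    _ ≤ c ^ 2 := by gcongr

theorem integral_pow_four_le_of_eLpNorm {g : Ω → ℝ} (hg : MemLp g 4 P) {c : ℝ} (hc : 0 ≤ c)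
    (h : eLpNorm g 4 P ≤ ENNReal.ofReal c) : ∫ ω, g ω ^ 4 ∂P ≤ c ^ 4 := by
  rw [hg.eLpNorm_eq_integral_rpow_norm (by simp) (by simp), ENNReal.ofReal_le_ofReal_iff hc] at h
  simp only [ENNReal.toReal_ofNat, Real.rpow_ofNat, Real.norm_eq_abs, Even.pow_abs
    (show Even 4 by decide)] at h
  have h0 : 0 ≤ ∫ ω, g ω ^ 4 ∂P := integral_nonneg fun _ => by positivity
  calc ∫ ω, g ω ^ 4 ∂P = ((∫ ω, g ω ^ 4 ∂P) ^ (4 : ℝ)⁻¹) ^ 4 := by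
        rw [← Real.rpow_natCast, ← Real.rpow_mul h0]
        norm_num
    _ ≤ c ^ 4 := by gcongr

theorem eLpNorm_four_le_ofReal {g : Ω → ℝ} (hg : MemLp g 4 P) {c : ℝ} (hc : 0 ≤ c)
    (h : ∫ ω, g ω ^ 4 ∂P ≤ c ^ 4) : eLpNorm g 4 P ≤ ENNReal.ofReal c := by
  rw [hg.eLpNorm_eq_integral_rpow_norm (by simp) (by simp)]
  refine ENNReal.ofReal_le_ofReal ?_
  simp only [ENNReal.toReal_ofNat, Real.rpow_ofNat, Real.norm_eq_abs, Even.pow_abs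
    (show Even 4 by decide)]
  calc (∫ ω, g ω ^ 4 ∂P) ^ (4 : ℝ)⁻¹ ≤ (c ^ 4) ^ (4 : ℝ)⁻¹ := by
        refine Real.rpow_le_rpow (integral_nonneg fun _ => by positivity) h (by norm_num)
    _ = c := by
        rw [← Real.rpow_natCast, ← Real.rpow_mul hc]
        norm_num

theorem eLpNorm_mul_two_le {f g : Ω → ℝ} (hf : AEStronglyMeasurable f P)
    (hg : AEStronglyMeasurable g P) :
    eLpNorm (fun ω => f ω * g ω) 2 P ≤ eLpNorm f 4 P * eLpNorm g 4 P := by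
  have := eLpNorm_smul_le_mul_eLpNorm (p := 4) (q := 4) (r := 2) hg hf
  exact this

theorem eLpNorm_average_le {p : ℝ≥0∞} (hp : 1 ≤ p) {s : Finset ℕ} (hs : s.Nonempty)
    {g : ℕ → Ω → ℝ} (hg : ∀ n, AEStronglyMeasurable (g n) P) {c : ℝ≥0∞}
    (h : ∀ n, eLpNorm (g n) p P ≤ c) :
    eLpNorm (fun ω => (s.card : ℝ)⁻¹ * ∑ n ∈ s, g n ω) p P ≤ c := by
  have h1 : eLpNorm (fun ω => (s.card : ℝ)⁻¹ * ∑ n ∈ s, g n ω) p P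
      = eLpNorm ((s.card : ℝ)⁻¹ • ∑ n ∈ s, g n) p P := by
    congr 1
    ext ω
    simp
  have h0 : (s.card : ℝ≥0∞) ≠ 0 := by simpa using hs.ne_empty
  rw [h1, eLpNorm_const_smul]
  calc ‖(s.card : ℝ)⁻¹‖ₑ * eLpNorm (∑ n ∈ s, g n) p P
      ≤ (s.card : ℝ≥0∞)⁻¹ * (s.card * c) := by
        gcongr
        · rw [enorm_inv (by simpa using hs.ne_empty)]
          simp
        · refine (eLpNorm_sum_le (fun n _ => hg n) hp).trans ?_
          refine (Finset.sum_le_sum fun n _ => h n).trans ?_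
          simp
    _ = c := by
        rw [← mul_assoc, ENNReal.inv_mul_cancel h0 (by simp), one_mul]

/-- The maximum is at most the sum of the coordinate norms. The general `E` allows a second use, for
the rows of a matrix. -/
theorem eLpNorm_pi_le {r : ℕ} {E : Type*} [NormedAddCommGroup E] {p : ℝ≥0∞} (hp : 1 ≤ p)
    {F : Ω → Fin r → E} (hF : ∀ i, AEStronglyMeasurable (fun ω => F ω i) P) {c : ℝ≥0∞}
    (h : ∀ i, eLpNorm (fun ω => F ω i) p P ≤ c) : eLpNorm F p P ≤ r * c := by
  calc eLpNorm F p P ≤ eLpNorm (∑ i, fun ω => ‖F ω i‖) p P := by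
        refine eLpNorm_mono_real fun ω => ?_
        rw [Finset.sum_apply]
        refine (pi_norm_le_iff_of_nonneg (Finset.sum_nonneg fun i _ => norm_nonneg _)).2 fun i => ?_
        exact Finset.single_le_sum (f := fun i => ‖F ω i‖) (fun i _ => norm_nonneg _)
          (Finset.mem_univ i)
    _ ≤ ∑ i : Fin r, eLpNorm (fun ω => ‖F ω i‖) p P :=
        eLpNorm_sum_le (fun i _ => (hF i).norm) hp
    _ ≤ ∑ i : Fin r, c := Finset.sum_le_sum fun i _ => by rw [eLpNorm_norm]; exact h i
    _ = r * c := by simp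

theorem abs_integral_mul_le [IsProbabilityMeasure P] {g h : Ω → ℝ} (hg : MemLp g 4 P) (hh : MemLp h 4 P) {c : ℝ}
    (hc : 0 ≤ c) (hgc : eLpNorm g 4 P ≤ ENNReal.ofReal c) (hhc : eLpNorm h 4 P ≤ ENNReal.ofReal c) :
    |∫ ω, g ω * h ω ∂P| ≤ c ^ 2 := by
  have hg2 : MemLp g 2 P := hg.mono_exponent (by norm_num)
  have hh2 : MemLp h 2 P := hh.mono_exponent (by norm_num)
  have h1 := integral_sq_le_of_eLpNorm hg2 hc
    ((eLpNorm_le_eLpNorm_of_exponent_le (by norm_num) hg.1).trans hgc)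
  have h2 := integral_sq_le_of_eLpNorm hh2 hc
    ((eLpNorm_le_eLpNorm_of_exponent_le (by norm_num) hh.1).trans hhc)
  have i1 := hg2.integrable_sq
  have i2 := hh2.integrable_sq
  calc |∫ ω, g ω * h ω ∂P| ≤ ∫ ω, (g ω ^ 2 + h ω ^ 2) / 2 ∂P := by
        refine norm_integral_le_of_norm_le (f := fun ω => g ω * h ω)
          ((i1.add i2).div_const 2) (ae_of_all _ fun ω => ?_)
        rw [Real.norm_eq_abs, abs_mul]
        have := sq_nonneg (|g ω| - |h ω|)
        have e1 := sq_abs (g ω)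
        have e2 := sq_abs (h ω)
        linarith
    _ = ((∫ ω, g ω ^ 2 ∂P) + ∫ ω, h ω ^ 2 ∂P) / 2 := by
        rw [integral_div, integral_add i1 i2]
    _ ≤ c ^ 2 := by linarith

theorem abs_integral_le [IsProbabilityMeasure P] {g : Ω → ℝ} (hg : MemLp g 4 P) {c : ℝ}
    (hc : 0 ≤ c) (hgc : eLpNorm g 4 P ≤ ENNReal.ofReal c) : |∫ ω, g ω ∂P| ≤ c := by
  have h1 := (eLpNorm_le_eLpNorm_of_exponent_le (p := 1) (q := 4) (by norm_num) hg.1).trans hgc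
  have h2 : ‖∫ ω, g ω ∂P‖ₑ ≤ ENNReal.ofReal c := by
    refine (enorm_integral_le_lintegral_enorm _).trans ?_
    rwa [← eLpNorm_one_eq_lintegral_enorm]
  rw [← ofReal_norm, ENNReal.ofReal_le_ofReal_iff hc] at h2
  exact h2

theorem abs_integral_four_le {g h k l : Ω → ℝ} (hg : MemLp g 4 P) (hh : MemLp h 4 P)
    (hk : MemLp k 4 P) (hl : MemLp l 4 P) {c : ℝ} (hc : 0 ≤ c)
    (hgc : eLpNorm g 4 P ≤ ENNReal.ofReal c) (hhc : eLpNorm h 4 P ≤ ENNReal.ofReal c)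
    (hkc : eLpNorm k 4 P ≤ ENNReal.ofReal c) (hlc : eLpNorm l 4 P ≤ ENNReal.ofReal c) :
    |∫ ω, g ω * h ω * (k ω * l ω) ∂P| ≤ c ^ 4 := by
  have i4 {g : Ω → ℝ} (hg : MemLp g 4 P) : Integrable (fun ω => g ω ^ 4) P :=
    (hg.integrable_norm_pow (by norm_num)).congr (ae_of_all _ fun ω => by
      simp [Even.pow_abs (show Even 4 by decide)])
  have e1 := integral_pow_four_le_of_eLpNorm hg hc hgc
  have e2 := integral_pow_four_le_of_eLpNorm hh hc hhc
  have e3 := integral_pow_four_le_of_eLpNorm hk hc hkc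
  have e4 := integral_pow_four_le_of_eLpNorm hl hc hlc
  calc |∫ ω, g ω * h ω * (k ω * l ω) ∂P|
      ≤ ∫ ω, (g ω ^ 4 + h ω ^ 4 + (k ω ^ 4 + l ω ^ 4)) / 4 ∂P := by
        refine norm_integral_le_of_norm_le (f := fun ω => g ω * h ω * (k ω * l ω))
          ((((i4 hg).add (i4 hh)).add ((i4 hk).add (i4 hl))).div_const 4) (ae_of_all _ fun ω => ?_)
        rw [Real.norm_eq_abs, abs_le]
        constructor <;>
        nlinarith [sq_nonneg (g ω * h ω - k ω * l ω), sq_nonneg (g ω * h ω + k ω * l ω),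
          sq_nonneg (g ω ^ 2 - h ω ^ 2), sq_nonneg (k ω ^ 2 - l ω ^ 2)]
    _ = ((∫ ω, g ω ^ 4 ∂P) + (∫ ω, h ω ^ 4 ∂P) + ((∫ ω, k ω ^ 4 ∂P) + ∫ ω, l ω ^ 4 ∂P)) / 4 := by
        rw [integral_div, integral_add (f := fun ω => g ω ^ 4 + h ω ^ 4)
          (g := fun ω => k ω ^ 4 + l ω ^ 4) ((i4 hg).add (i4 hh)) ((i4 hk).add (i4 hl)), integral_add (i4 hg) (i4 hh), integral_add (i4 hk) (i4 hl)]
    _ ≤ c ^ 4 := by linarith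

end Norms

/-! ### Correlations of the sampled process -/

section Setup

open ProbabilityTheory

variable {Ω : Type*} [MeasurableSpace Ω] {P : Measure Ω} {r : ℕ}
  {X : ℝ≥0 → Ω → Fin r → ℝ} {Y : ℝ → ℝ≥0 → Ω → Fin r → ℝ} {ρ f : ℝ → ℝ} {ν : ℝ≥0}
  {Λ : ℝ≥0 → ℝ≥0}

theorem eLpNorm_apply_le {F : Ω → Fin r → ℝ} (p : ℝ≥0∞) (i : Fin r) :
    eLpNorm (fun ω => F ω i) p P ≤ eLpNorm F p P :=
  eLpNorm_mono fun ω => norm_le_pi_norm (F ω) i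

theorem memLp_apply_of_eLpNorm_le {F : Ω → Fin r → ℝ} (hF : Measurable F) {c : ℝ≥0}
    (h : eLpNorm F 4 P ≤ c) (i : Fin r) : MemLp (fun ω => F ω i) 4 P :=
  ⟨((measurable_pi_apply i).comp hF).aestronglyMeasurable,
    ((eLpNorm_apply_le 4 i).trans h).trans_lt ENNReal.coe_lt_top⟩

namespace IsSetup

theorem memLp_X (hS : IsSetup P X Y ρ ν Λ) (t : ℝ≥0) (i : Fin r) :
    MemLp (fun ω => X t ω i) 4 P :=
  memLp_apply_of_eLpNorm_le (hS.measurable_X t) (hS.bound_X t) i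

theorem eLpNorm_X (hS : IsSetup P X Y ρ ν Λ) (t : ℝ≥0) (i : Fin r) :
    eLpNorm (fun ω => X t ω i) 4 P ≤ ENNReal.ofReal ν :=
  (eLpNorm_apply_le 4 i).trans ((hS.bound_X t).trans_eq (ENNReal.ofReal_coe_nnreal).symm)

theorem memLp_Y (hS : IsSetup P X Y ρ ν Λ) {ε : ℝ} (hε : 0 < ε) (t : ℝ≥0) (i : Fin r) :
    MemLp (fun ω => Y ε t ω i) 4 P :=
  memLp_apply_of_eLpNorm_le (hS.measurable_Y ε hε t) (hS.bound_Y ε hε t) i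

theorem eLpNorm_Y (hS : IsSetup P X Y ρ ν Λ) {ε : ℝ} (hε : 0 < ε) (t : ℝ≥0) (i : Fin r) :
    eLpNorm (fun ω => Y ε t ω i) 4 P ≤ ENNReal.ofReal ν :=
  (eLpNorm_apply_le 4 i).trans ((hS.bound_Y ε hε t).trans_eq (ENNReal.ofReal_coe_nnreal).symm)

theorem eLpNorm_Y_sub_X (hS : IsSetup P X Y ρ ν Λ) {ε : ℝ} (hε : 0 < ε) (t : ℝ≥0) (i : Fin r) :
    eLpNorm (fun ω => Y ε t ω i - X t ω i) 4 P ≤ ENNReal.ofReal (ρ ε) :=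
  (eLpNorm_apply_le (F := fun ω => Y ε t ω - X t ω) 4 i).trans (hS.speed ε hε t)

theorem integral_shift (hS : IsSetup P X Y ρ ν Λ) {n : ℕ} (t : Fin n → ℝ≥0) (h : ℝ≥0)
    {g : (Fin n → Fin r → ℝ) → ℝ} (hg : Measurable g) :
    ∫ ω, g (fun k => X (t k + h) ω) ∂P = ∫ ω, g (fun k => X (t k) ω) ∂P := by
  have hm (t : Fin n → ℝ≥0) : AEMeasurable (fun ω k => X (t k) ω) P :=
    (measurable_pi_lambda _ fun k => hS.measurable_X (t k)).aemeasurable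
  rw [← integral_map (hm t) hg.aestronglyMeasurable, ← hS.stationary n t h,
    integral_map (hm fun k => t k + h) hg.aestronglyMeasurable]

theorem integral_X (hS : IsSetup P X Y ρ ν Λ) (t : ℝ≥0) (i : Fin r) :
    ∫ ω, X t ω i ∂P = mean P X i := by
  have := hS.integral_shift (n := 1) (fun _ => 0) t (g := fun x => x 0 i) (by fun_prop)
  simpa [mean] using this

theorem integral_X_mul_X (hS : IsSetup P X Y ρ ν Λ) (t u : ℝ≥0) (i j : Fin r) :
    ∫ ω, X t ω i * X (t + u) ω j ∂P = lagCov P X u i j + mean P X i * mean P X j := by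
  have := hS.integral_shift (n := 2) ![0, u] t (g := fun x => x 0 i * x 1 j) (by fun_prop)
  simp only [Matrix.cons_val_zero, Matrix.cons_val_one, zero_add] at this
  rw [add_comm t u, this]
  simp [lagCov]

variable [IsProbabilityMeasure P]

theorem abs_mean_le (hS : IsSetup P X Y ρ ν Λ) (i : Fin r) : |mean P X i| ≤ ν :=
  abs_integral_le (hS.memLp_X 0 i) ν.coe_nonneg (hS.eLpNorm_X 0 i)

theorem memLp_centered (hS : IsSetup P X Y ρ ν Λ) (t : ℝ≥0) (i : Fin r) :
    MemLp (fun ω => X t ω i - mean P X i) 4 P :=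
  (hS.memLp_X t i).sub (memLp_const _)

theorem eLpNorm_centered (hS : IsSetup P X Y ρ ν Λ) (t : ℝ≥0) (i : Fin r) :
    eLpNorm (fun ω => X t ω i - mean P X i) 4 P ≤ ENNReal.ofReal (2 * ν) := by
  refine (eLpNorm_sub_le (hS.memLp_X t i).1 aestronglyMeasurable_const (by norm_num)).trans ?_
  rw [two_mul, ENNReal.ofReal_add ν.coe_nonneg ν.coe_nonneg]
  refine add_le_add (hS.eLpNorm_X t i) ?_
  rw [eLpNorm_const _ (by norm_num) (NeZero.ne P)]
  simp only [measure_univ, ENNReal.one_rpow, mul_one]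
  rw [← ofReal_norm]
  exact ENNReal.ofReal_le_ofReal (hS.abs_mean_le i)

end IsSetup

/-- Between closed intervals the gap is attained, at the right end of the first and the left end of
the second. -/
theorem HasIntegrableDecorrelationRate.abs_sub_le (hf : HasIntegrableDecorrelationRate P X f)
    {s s' t t' : ℝ≥0} (hs : s ≤ s') (hst : s' < t) (ht : t ≤ t') {G H : Ω → ℝ}
    (hG : G ∈ lowMoments X (Set.Icc s s')) (hH : H ∈ lowMoments X (Set.Icc t t')) :
    |(∫ ω, G ω * H ω ∂P) - (∫ ω, G ω ∂P) * ∫ ω, H ω ∂P| ≤ f (t - s') := by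
  refine hf.decorrelation _ _ Set.ordConnected_Icc Set.ordConnected_Icc _
    (sub_pos.2 (NNReal.coe_lt_coe.2 hst)) (IsLeast.isGLB ⟨?_, ?_⟩) G hG H hH
  · exact ⟨s', ⟨hs, le_rfl⟩, t, ⟨le_rfl, ht⟩, rfl⟩
  · rintro d ⟨a, ha, b, hb, rfl⟩
    exact sub_le_sub (NNReal.coe_le_coe.2 hb.1) (NNReal.coe_le_coe.2 ha.2)

variable [IsProbabilityMeasure P]

/-- Decorrelation is assumed for uncentered monomials only. Expanding `(p - m)(q - m)` leaves the
covariances of `pq`, `mp` and `mq` with `H`, since constants do not count; hence the factor `1 +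
2ν`. -/
theorem abs_covariance_centered_mul_le {p q g H : Ω → ℝ} (hp : MemLp p 4 P) (hq : MemLp q 4 P)
    (hH : MemLp H 2 P) {m c ν : ℝ} (hm : |m| ≤ ν)
    (h1 : |cov[fun ω => p ω * q ω, H; P]| ≤ c) (h2 : |cov[p, H; P]| ≤ c) (h3 : |cov[q, H; P]| ≤ c)
    (hg : ∀ ω, g ω = (p ω - m) * (q ω - m)) : |cov[g, H; P]| ≤ (1 + 2 * ν) * c := by
  have hp2 : MemLp p 2 P := hp.mono_exponent (by norm_num)
  have hq2 : MemLp q 2 P := hq.mono_exponent (by norm_num)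
  have hpq := memLp_two_mul hp hq
  have hc : 0 ≤ c := (abs_nonneg _).trans h1
  have e : g = fun ω => (p ω * q ω - m * p ω - m * q ω) + m ^ 2 := by
    ext ω
    rw [hg]
    ring
  have i1 : MemLp (fun ω => p ω * q ω - m * p ω) 2 P := hpq.sub (hp2.const_mul m)
  have i2 : MemLp (fun ω => p ω * q ω - m * p ω - m * q ω) 2 P := i1.sub (hq2.const_mul m)
  rw [e, covariance_add_const_left (i2.integrable one_le_two),
    covariance_fun_sub_left i1 (hq2.const_mul m) hH, covariance_fun_sub_left hpq (hp2.const_mul m) hH,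
    covariance_const_mul_left, covariance_const_mul_left]
  have a1 : |m * cov[p, H; P]| ≤ ν * c := by
    rw [abs_mul]
    exact mul_le_mul hm h2 (abs_nonneg _) ((abs_nonneg _).trans hm)
  have a2 : |m * cov[q, H; P]| ≤ ν * c := by
    rw [abs_mul]
    exact mul_le_mul hm h3 (abs_nonneg _) ((abs_nonneg _).trans hm)
  rw [abs_le] at *
  constructor <;> linarith [h1.1, h1.2, a1.1, a1.2, a2.1, a2.2]

theorem abs_covariance_low_le (hS : IsSetup P X Y ρ ν Λ)
    (hf : HasIntegrableDecorrelationRate P X f)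
    {s s' t t' : ℝ≥0} (hs : s ≤ s') (hst : s' < t) (ht : t ≤ t') {G H : Ω → ℝ}
    (hG : G ∈ lowMoments X (Set.Icc s s')) (hH : H ∈ lowMoments X (Set.Icc t t')) :
    |cov[G, H; P]| ≤ f (t - s') := by
  have h2 {U : Set ℝ≥0} {G : Ω → ℝ} (hG : G ∈ lowMoments X U) : MemLp G 2 P := by
    rcases hG with ⟨s, -, i, rfl⟩ | ⟨s, -, t, -, i, j, rfl⟩
    · exact (hS.memLp_X s i).mono_exponent (by norm_num)
    · exact memLp_two_mul (hS.memLp_X s i) (hS.memLp_X t j)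
  rw [covariance_eq_sub (h2 hG) (h2 hH)]
  exact hf.abs_sub_le hs hst ht hG hH

/-- The two products are centered one after the other, and each centering costs a factor `1 + 2ν`.
-/
theorem abs_covariance_centered_le (hS : IsSetup P X Y ρ ν Λ)
    (hf : HasIntegrableDecorrelationRate P X f)
    {s s' t t' : ℝ≥0} (hs : s ≤ s') (hst : s' < t) (ht : t ≤ t') (i : Fin r) :
    |cov[fun ω => (X s ω i - mean P X i) * (X s' ω i - mean P X i),
      fun ω => (X t ω i - mean P X i) * (X t' ω i - mean P X i); P]|
      ≤ (1 + 2 * ν) ^ 2 * f (t - s') := by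
  have key : ∀ G ∈ lowMoments X (Set.Icc s s'), MemLp G 2 P → |cov[G,
      fun ω => (X t ω i - mean P X i) * (X t' ω i - mean P X i); P]|
      ≤ (1 + 2 * ν) * f (t - s') := by
    intro G hG hG2
    rw [covariance_comm]
    have low (H : Ω → ℝ) (hH : H ∈ lowMoments X (Set.Icc t t')) : |cov[H, G; P]| ≤ f (t - s') := by
      rw [covariance_comm]
      exact abs_covariance_low_le hS hf hs hst ht hG hH
    exact abs_covariance_centered_mul_le (hS.memLp_X t i) (hS.memLp_X t' i) hG2 (hS.abs_mean_le i)
      (low _ (Or.inr ⟨t, ⟨le_rfl, ht⟩, t', ⟨ht, le_rfl⟩, i, i, rfl⟩))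
      (low _ (Or.inl ⟨t, ⟨le_rfl, ht⟩, i, rfl⟩))
      (low _ (Or.inl ⟨t', ⟨ht, le_rfl⟩, i, rfl⟩)) fun ω => rfl
  have h := abs_covariance_centered_mul_le (hS.memLp_X s i) (hS.memLp_X s' i)
    (memLp_two_mul (hS.memLp_centered t i) (hS.memLp_centered t' i)) (hS.abs_mean_le i)
    (key _ (Or.inr ⟨s, ⟨le_rfl, hs⟩, s', ⟨hs, le_rfl⟩, i, i, rfl⟩)
      (memLp_two_mul (hS.memLp_X s i) (hS.memLp_X s' i)))
    (key _ (Or.inl ⟨s, ⟨le_rfl, hs⟩, i, rfl⟩) ((hS.memLp_X s i).mono_exponent (by norm_num)))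
    (key _ (Or.inl ⟨s', ⟨hs, le_rfl⟩, i, rfl⟩) ((hS.memLp_X s' i).mono_exponent (by norm_num)))
    (fun ω => rfl)
  exact h.trans_eq (by ring)

/-- The bound of the correlations of the sampled process at the distance of `k` steps. -/
noncomputable def sampledRate (f : ℝ → ℝ) (ν Δ : ℝ≥0) : ℕ → ℝ :=
  rateBound (fun T => (1 + 2 * (ν : ℝ)) ^ 2 * f T) (4 * (ν : ℝ) ^ 2 + 32 * (ν : ℝ) ^ 4) Δ

theorem sampled_gap {Δ : ℝ≥0} {b c : ℕ} (hbc : b ≤ c) (h : ¬ ((c - b : ℕ) : ℝ) * (Δ : ℝ) < 2) :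
    (b : ℝ≥0) * Δ < c * Δ ∧
      (((c : ℝ≥0) * Δ : ℝ≥0) : ℝ) - (((b : ℝ≥0) * Δ : ℝ≥0) : ℝ) = ((c - b : ℕ) : ℝ) * Δ := by
  have e : (((c : ℝ≥0) * Δ : ℝ≥0) : ℝ) - (((b : ℝ≥0) * Δ : ℝ≥0) : ℝ) = ((c - b : ℕ) : ℝ) * Δ := by
    push_cast [hbc]
    ring
  refine ⟨?_, e⟩
  rw [← NNReal.coe_lt_coe]
  linarith

theorem sampled_le {Δ : ℝ≥0} {b c : ℕ} (hbc : b ≤ c) : (b : ℝ≥0) * Δ ≤ c * Δ := by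
  gcongr

theorem abs_integral_sampled_le (hS : IsSetup P X Y ρ ν Λ)
    (hf : HasIntegrableDecorrelationRate P X f) (Δ : ℝ≥0) (i : Fin r) {a b : ℕ} (hab : a ≤ b) :
    |∫ ω, (X (a * Δ) ω i - mean P X i) * (X (b * Δ) ω i - mean P X i) ∂P|
      ≤ sampledRate f ν Δ (b - a) := by
  unfold sampledRate rateBound
  split_ifs with h
  · refine (abs_integral_mul_le (hS.memLp_centered _ i) (hS.memLp_centered _ i) (by positivity)
      (hS.eLpNorm_centered _ i) (hS.eLpNorm_centered _ i)).trans ?_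
    nlinarith [pow_nonneg ν.coe_nonneg 4]
  · obtain ⟨h1, h2⟩ := sampled_gap hab h
    have h3 := abs_covariance_low_le hS hf le_rfl h1 le_rfl (Or.inl ⟨_, ⟨le_rfl, le_rfl⟩, i, rfl⟩)
      (Or.inl ⟨_, ⟨le_rfl, le_rfl⟩, i, rfl⟩)
    rw [h2] at h3
    simp only [covariance, hS.integral_X] at h3
    have h4 : 0 ≤ f (((b - a : ℕ) : ℝ) * Δ) := (abs_nonneg _).trans h3
    refine h3.trans (le_mul_of_one_le_left h4 ?_)
    exact one_le_pow₀ (by linarith [ν.coe_nonneg])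

theorem abs_integral_sampled_four_le (hS : IsSetup P X Y ρ ν Λ)
    (hf : HasIntegrableDecorrelationRate P X f) (Δ : ℝ≥0) (i : Fin r) {a b c d : ℕ} (hab : a ≤ b)
    (hbc : b ≤ c) (hcd : c ≤ d) :
    |(∫ ω, (X (a * Δ) ω i - mean P X i) * (X (b * Δ) ω i - mean P X i) *
        ((X (c * Δ) ω i - mean P X i) * (X (d * Δ) ω i - mean P X i)) ∂P)
      - (∫ ω, (X (a * Δ) ω i - mean P X i) * (X (b * Δ) ω i - mean P X i) ∂P) *
        ∫ ω, (X (c * Δ) ω i - mean P X i) * (X (d * Δ) ω i - mean P X i) ∂P|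
      ≤ sampledRate f ν Δ (c - b) := by
  have m2 (a b : ℕ) : MemLp (fun ω => (X (a * Δ) ω i - mean P X i) * (X (b * Δ) ω i - mean P X i))
      2 P := memLp_two_mul (hS.memLp_centered _ i) (hS.memLp_centered _ i)
  unfold sampledRate rateBound
  split_ifs with h
  -- At short distance the centered variables, of `L⁴` norm at most `2ν`, give `(2ν)⁴ + ((2ν)²)² =
  -- 32ν⁴`. The other summand `4ν²` of the crude constant serves the pair correlations.
  · have b4 := abs_integral_four_le (hS.memLp_centered (a * Δ) i) (hS.memLp_centered (b * Δ) i)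
      (hS.memLp_centered (c * Δ) i) (hS.memLp_centered (d * Δ) i) (by positivity)
      (hS.eLpNorm_centered _ i) (hS.eLpNorm_centered _ i) (hS.eLpNorm_centered _ i)
      (hS.eLpNorm_centered _ i)
    have b2 (a b : ℕ) := abs_integral_mul_le (hS.memLp_centered (a * Δ) i)
      (hS.memLp_centered (b * Δ) i) (by positivity)
      (hS.eLpNorm_centered _ i) (hS.eLpNorm_centered _ i)
    refine (abs_sub _ _).trans ?_
    rw [abs_mul]
    have := mul_le_mul (b2 a b) (b2 c d) (abs_nonneg _) (by positivity)
    nlinarith [pow_nonneg ν.coe_nonneg 2]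
  · obtain ⟨h1, h2⟩ := sampled_gap hbc h
    have h3 := abs_covariance_centered_le hS hf (sampled_le (Δ := Δ) hab) h1
      (sampled_le (Δ := Δ) hcd) i
    rw [h2, covariance_eq_sub (m2 a b) (m2 c d)] at h3
    exact h3

/-- The products live on the windows from `nΔ` to `(n+κ)Δ` and from `mΔ` to `(m+κ)Δ`. If the windows
are disjoint the gap between them is `|n - m| - κ` steps, and decorrelation is used once it has
length at least `2`; all other cases get the crude moment bound. -/
theorem abs_covariance_sampled_le (hS : IsSetup P X Y ρ ν Λ)
    (hf : HasIntegrableDecorrelationRate P X f) (Δ : ℝ≥0) (κ : ℕ) (i j : Fin r) (n m : ℕ) :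
    |cov[fun ω => X (n * Δ) ω i * X ((n + κ : ℕ) * Δ) ω j,
      fun ω => X (m * Δ) ω i * X ((m + κ : ℕ) * Δ) ω j; P]|
      ≤ if Nat.dist n m < κ then 4 * (ν : ℝ) ^ 2 + 32 * (ν : ℝ) ^ 4
        else sampledRate f ν Δ (Nat.dist n m - κ) := by
  wlog hnm : n ≤ m generalizing n m
  · rw [covariance_comm, Nat.dist_comm]
    exact this m n (by omega)
  have m2 (a : ℕ) : MemLp (fun ω => X (a * Δ) ω i * X ((a + κ : ℕ) * Δ) ω j) 2 P :=
    memLp_two_mul (hS.memLp_X _ i) (hS.memLp_X _ j)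
  have crude : |cov[fun ω => X (n * Δ) ω i * X ((n + κ : ℕ) * Δ) ω j,
      fun ω => X (m * Δ) ω i * X ((m + κ : ℕ) * Δ) ω j; P]|
      ≤ 4 * (ν : ℝ) ^ 2 + 32 * (ν : ℝ) ^ 4 := by
    have b4 := abs_integral_four_le (hS.memLp_X (n * Δ) i) (hS.memLp_X ((n + κ : ℕ) * Δ) j)
      (hS.memLp_X (m * Δ) i) (hS.memLp_X ((m + κ : ℕ) * Δ) j) ν.coe_nonneg
      (hS.eLpNorm_X _ i) (hS.eLpNorm_X _ j) (hS.eLpNorm_X _ i) (hS.eLpNorm_X _ j)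
    have b2 (a : ℕ) := abs_integral_mul_le (hS.memLp_X (a * Δ) i)
      (hS.memLp_X ((a + κ : ℕ) * Δ) j) ν.coe_nonneg (hS.eLpNorm_X _ i) (hS.eLpNorm_X _ j)
    rw [covariance_eq_sub (m2 n) (m2 m)]
    refine (abs_sub _ _).trans ?_
    rw [abs_mul]
    have := mul_le_mul (b2 n) (b2 m) (abs_nonneg _) (by positivity)
    simp only [Pi.mul_apply]
    change _ ≤ (ν : ℝ) ^ 4 at b4
    change _ ≤ (ν : ℝ) ^ 2 * (ν : ℝ) ^ 2 at this
    nlinarith [pow_nonneg ν.coe_nonneg 2, pow_nonneg ν.coe_nonneg 4]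
  rw [Nat.dist_eq_sub_of_le hnm]
  split_ifs with hκ
  · exact crude
  unfold sampledRate rateBound
  split_ifs with h
  · exact crude
  · have hle : n + κ ≤ m := by omega
    rw [show m - n - κ = m - (n + κ) by omega] at h ⊢
    obtain ⟨h1, h2⟩ := sampled_gap hle h
    have e1 := sampled_le (Δ := Δ) (Nat.le_add_right n κ)
    have e2 := sampled_le (Δ := Δ) (Nat.le_add_right m κ)
    have h3 := abs_covariance_low_le hS hf e1 h1 e2
      (Or.inr ⟨_, ⟨le_rfl, e1⟩, _, ⟨e1, le_rfl⟩, i, j, rfl⟩)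
      (Or.inr ⟨_, ⟨le_rfl, e2⟩, _, ⟨e2, le_rfl⟩, i, j, rfl⟩)
    rw [h2] at h3
    have h4 := (abs_nonneg _).trans h3
    refine h3.trans (le_mul_of_one_le_left h4 ?_)
    exact one_le_pow₀ (by linarith [ν.coe_nonneg])

end Setup

/-! ### Fluctuations of empirical means and lagged products -/

section Assembly

open ProbabilityTheory

variable {Ω : Type*} {r : ℕ}

theorem empMean_apply (Z : ℝ≥0 → Ω → Fin r → ℝ) (N : ℕ) (Δ : ℝ≥0) (ω : Ω) (i : Fin r) :
    empMean Z N Δ ω i = (N : ℝ)⁻¹ * ∑ n ∈ Finset.Icc 1 N, Z (n * Δ) ω i := by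
  simp [empMean]

theorem shiftedEmpMean_apply (Z : ℝ≥0 → Ω → Fin r → ℝ) (N : ℕ) (Δ u : ℝ≥0) (ω : Ω) (i : Fin r) :
    shiftedEmpMean Z N Δ u ω i =
      (N : ℝ)⁻¹ * ∑ n ∈ Finset.Icc 1 N, Z ((n + lagIndex Δ u : ℕ) * Δ) ω i := by
  simp [shiftedEmpMean]

theorem empCov_apply (Z : ℝ≥0 → Ω → Fin r → ℝ) (N : ℕ) (Δ u : ℝ≥0) (ω : Ω) (i j : Fin r) :
    empCov Z N Δ u ω i j = (N : ℝ)⁻¹ * ∑ n ∈ Finset.Icc 1 N,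
        Z (n * Δ) ω i * Z ((n + lagIndex Δ u : ℕ) * Δ) ω j
      - empMean Z N Δ ω i * shiftedEmpMean Z N Δ u ω j := by
  simp [empCov, Matrix.sum_apply, Matrix.vecMulVec_apply]

variable [MeasurableSpace Ω] {P : Measure Ω}
  {X : ℝ≥0 → Ω → Fin r → ℝ} {Y : ℝ → ℝ≥0 → Ω → Fin r → ℝ} {ρ f : ℝ → ℝ} {ν : ℝ≥0}
  {Λ : ℝ≥0 → ℝ≥0}

/-- The rounded lag is within one step of the lag. -/
theorem abs_lagIndex_mul_sub_le {Δ : ℝ≥0} (hΔ : 0 < Δ) (u : ℝ≥0) :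
    |(lagIndex Δ u : ℝ) * Δ - u| ≤ Δ := by
  have hΔ' : (0 : ℝ) < Δ := hΔ
  have h1 : ((lagIndex Δ u : ℕ) : ℝ≥0) ≤ u / Δ + 1 / 2 := Nat.floor_le zero_le
  have h2 : u / Δ + 1 / 2 < (lagIndex Δ u : ℝ≥0) + 1 := Nat.lt_floor_add_one _
  rw [← NNReal.coe_le_coe] at h1
  rw [← NNReal.coe_lt_coe] at h2
  push_cast at h1 h2
  have e : (u : ℝ) / Δ * Δ = u := div_mul_cancel₀ _ hΔ'.ne'
  have h3 := mul_le_mul_of_nonneg_right h1 hΔ'.le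
  have h4 := mul_le_mul_of_nonneg_right h2.le hΔ'.le
  rw [abs_le]
  constructor <;> nlinarith

/-- The constant that controls the sums of the correlations of the sampled process. -/
noncomputable def correlationConstant (A ν : ℝ≥0) (J : ℝ) : ℝ :=
  (A + 4) * (4 * (ν : ℝ) ^ 2 + 32 * (ν : ℝ) ^ 4) + (1 + 2 * (ν : ℝ)) ^ 2 * J

theorem sampledRate_nonneg (hf : HasIntegrableDecorrelationRate P X f) (Δ : ℝ≥0) (k : ℕ) :
    0 ≤ sampledRate f ν Δ k :=
  rateBound_nonneg (fun T hT => mul_nonneg (by positivity) (hf.pos T hT).le) (by positivity) k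

theorem sum_sampledRate_le (hf : HasIntegrableDecorrelationRate P X f) {J : ℝ}
    (hJ : ∫ T in Set.Ioi (1 : ℝ), f T ≤ J) {Δ : ℝ≥0} (hΔ : 0 < Δ) (hΔ1 : Δ ≤ 1) (n : ℕ) :
    ∑ k ∈ Finset.range n, sampledRate f ν Δ k ≤
      (3 * (4 * (ν : ℝ) ^ 2 + 32 * (ν : ℝ) ^ 4) + (1 + 2 * (ν : ℝ)) ^ 2 * J) / Δ := by
  refine (sum_rateBound_le (fun T hT => mul_nonneg (by positivity) (hf.pos T hT).le)
    (fun a ha b hb hab => mul_le_mul_of_nonneg_left (hf.antitone ha hb hab) (by positivity))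
    (hf.integrable.const_mul _) (by positivity) (NNReal.coe_pos.2 hΔ)
    (by exact_mod_cast hΔ1) n).trans ?_
  rw [integral_const_mul]
  exact div_le_div_of_nonneg_right (by gcongr) Δ.coe_nonneg

theorem sum_sampledRate_le_correlationConstant (hf : HasIntegrableDecorrelationRate P X f) {J : ℝ}
    (hJ : ∫ T in Set.Ioi (1 : ℝ), f T ≤ J) {Δ : ℝ≥0} (hΔ : 0 < Δ) (hΔ1 : Δ ≤ 1) (A : ℝ≥0) (n : ℕ) :
    ∑ k ∈ Finset.range n, sampledRate f ν Δ k ≤ correlationConstant A ν J / Δ := by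
  refine (sum_sampledRate_le hf hJ hΔ hΔ1 n).trans ?_
  unfold correlationConstant
  gcongr
  linarith [A.coe_nonneg]

theorem correlationConstant_nonneg (hf : HasIntegrableDecorrelationRate P X f) {J : ℝ}
    (hJ : ∫ T in Set.Ioi (1 : ℝ), f T ≤ J) (A : ℝ≥0) : 0 ≤ correlationConstant A ν J := by
  have : 0 ≤ J := (setIntegral_nonneg measurableSet_Ioi fun T hT =>
    (hf.pos T (lt_trans one_pos hT)).le).trans hJ
  unfold correlationConstant
  positivity

theorem memLp_average {p : ℝ≥0∞} {g : ℕ → Ω → ℝ} (hg : ∀ n, MemLp (g n) p P) (N : ℕ) :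
    MemLp (fun ω => (N : ℝ)⁻¹ * ∑ n ∈ Finset.Icc 1 N, g n ω) p P :=
  (memLp_finsetSum _ fun n _ => hg n).const_mul _

theorem integral_average {g : ℕ → Ω → ℝ} (hg : ∀ n, Integrable (g n) P) {N : ℕ} (hN : 0 < N)
    {c : ℝ} (hc : ∀ n, ∫ ω, g n ω ∂P = c) :
    ∫ ω, (N : ℝ)⁻¹ * ∑ n ∈ Finset.Icc 1 N, g n ω ∂P = c := by
  have hN' : (N : ℝ) ≠ 0 := by exact_mod_cast hN.ne'
  rw [integral_const_mul, integral_finsetSum _ fun n _ => hg n]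
  simp [hc, hN']

theorem eLpNorm_average_Icc_le {p : ℝ≥0∞} (hp : 1 ≤ p) {N : ℕ} (hN : 0 < N)
    {g : ℕ → Ω → ℝ} (hg : ∀ n, AEStronglyMeasurable (g n) P) {c : ℝ≥0∞}
    (h : ∀ n, eLpNorm (g n) p P ≤ c) :
    eLpNorm (fun ω => (N : ℝ)⁻¹ * ∑ n ∈ Finset.Icc 1 N, g n ω) p P ≤ c := by
  have := eLpNorm_average_le hp (s := Finset.Icc 1 N) (Finset.nonempty_Icc.2 hN) hg h
  simpa using this

/-- `L²` bound of a difference of products of random variables that are close in `L⁴`. -/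
theorem eLpNorm_mul_sub_mul_le {x x' y y' : Ω → ℝ} (hx : MemLp x 4 P) (hx' : MemLp x' 4 P)
    (hy : MemLp y 4 P) (hy' : MemLp y' 4 P) {ν δ : ℝ} (hν : 0 ≤ ν) (hδ : 0 ≤ δ)
    (bx : eLpNorm x 4 P ≤ ENNReal.ofReal ν) (by' : eLpNorm y' 4 P ≤ ENNReal.ofReal ν)
    (h : eLpNorm (fun ω => y ω - x ω) 4 P ≤ ENNReal.ofReal δ)
    (h' : eLpNorm (fun ω => y' ω - x' ω) 4 P ≤ ENNReal.ofReal δ) :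
    eLpNorm (fun ω => y ω * y' ω - x ω * x' ω) 2 P ≤ ENNReal.ofReal (2 * ν * δ) := by
  have e : (fun ω => y ω * y' ω - x ω * x' ω) =
      (fun ω => (y ω - x ω) * y' ω) + fun ω => x ω * (y' ω - x' ω) := by
    ext ω
    simp only [Pi.add_apply]
    ring
  have m1 : AEStronglyMeasurable (fun ω => y ω - x ω) P := hy.1.sub hx.1
  have m2 : AEStronglyMeasurable (fun ω => y' ω - x' ω) P := hy'.1.sub hx'.1
  rw [e]
  refine (eLpNorm_add_le (m1.mul hy'.1) (hx.1.mul m2) one_le_two).trans ?_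
  have a1 := (eLpNorm_mul_two_le m1 hy'.1).trans (mul_le_mul' h by')
  have a2 := (eLpNorm_mul_two_le hx.1 m2).trans (mul_le_mul' bx h')
  rw [← ENNReal.ofReal_mul hδ] at a1
  rw [← ENNReal.ofReal_mul hν] at a2
  refine (add_le_add a1 a2).trans_eq ?_
  rw [← ENNReal.ofReal_add (by positivity) (by positivity)]
  ring_nf

theorem eLpNorm_empMean_sub_le (hS : IsSetup P X Y ρ ν Λ) {ε : ℝ} (hε : 0 < ε) {N : ℕ}
    (hN : 0 < N) (Δ : ℝ≥0) (k : ℕ) (i : Fin r) :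
    eLpNorm (fun ω => (N : ℝ)⁻¹ * ∑ n ∈ Finset.Icc 1 N, Y ε ((n + k : ℕ) * Δ) ω i
      - (N : ℝ)⁻¹ * ∑ n ∈ Finset.Icc 1 N, X ((n + k : ℕ) * Δ) ω i) 4 P
      ≤ ENNReal.ofReal (ρ ε) := by
  have e : (fun ω => (N : ℝ)⁻¹ * ∑ n ∈ Finset.Icc 1 N, Y ε ((n + k : ℕ) * Δ) ω i
      - (N : ℝ)⁻¹ * ∑ n ∈ Finset.Icc 1 N, X ((n + k : ℕ) * Δ) ω i) = fun ω =>
      (N : ℝ)⁻¹ * ∑ n ∈ Finset.Icc 1 N, (Y ε ((n + k : ℕ) * Δ) ω i - X ((n + k : ℕ) * Δ) ω i) := by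
    ext ω
    rw [Finset.sum_sub_distrib, mul_sub]
  rw [e]
  exact eLpNorm_average_Icc_le (by norm_num) hN
    (fun n => (hS.memLp_Y hε _ i).1.sub (hS.memLp_X _ i).1) fun n => hS.eLpNorm_Y_sub_X hε _ i

variable [IsProbabilityMeasure P]

theorem variance_sampled_mean_le (hS : IsSetup P X Y ρ ν Λ)
    (hf : HasIntegrableDecorrelationRate P X f) {J : ℝ}
    (hJ : ∫ T in Set.Ioi (1 : ℝ), f T ≤ J) {Δ : ℝ≥0} (hΔ : 0 < Δ) (hΔ1 : Δ ≤ 1) (A : ℝ≥0)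
    (i : Fin r) (N k : ℕ) :
    Var[fun ω => (N : ℝ)⁻¹ * ∑ n ∈ Finset.Icc 1 N, X ((n + k : ℕ) * Δ) ω i; P] ≤
      2 * correlationConstant A ν J / (N * Δ) := by
  have h := variance_average_le (P := P) (sampledRate_nonneg (ν := ν) hf Δ)
    (sum_sampledRate_le_correlationConstant hf hJ hΔ hΔ1 A) (Finset.Icc 1 N)
    (fun n ω => X ((n + k : ℕ) * Δ) ω i) (fun n => (hS.memLp_X _ i).mono_exponent (by norm_num))
    (fun n m => by
      wlog hnm : n ≤ m generalizing n m
      · rw [covariance_comm, Nat.dist_comm]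
        exact this m n (by omega)
      have := abs_integral_sampled_le hS hf Δ i (Nat.add_le_add_right hnm k)
      rw [Nat.add_sub_add_right] at this
      simpa only [covariance, hS.integral_X, Nat.dist_eq_sub_of_le hnm] using this)
  simp only [Nat.card_Icc, Nat.add_sub_cancel] at h
  refine h.trans_eq ?_
  rw [mul_div_assoc', div_div, mul_comm (Δ : ℝ)]

theorem integral_sampled_mean_pow_four_le (hS : IsSetup P X Y ρ ν Λ)
    (hf : HasIntegrableDecorrelationRate P X f) {J : ℝ}
    (hJ : ∫ T in Set.Ioi (1 : ℝ), f T ≤ J) {Δ : ℝ≥0} (hΔ : 0 < Δ) (hΔ1 : Δ ≤ 1) (A : ℝ≥0)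
    (i : Fin r) (N k : ℕ) :
    ∫ ω, ((N : ℝ)⁻¹ * ∑ n ∈ Finset.Icc 1 N, (X ((n + k : ℕ) * Δ) ω i - mean P X i)) ^ 4 ∂P ≤
      24 * (1 + 4 * (ν : ℝ) ^ 2) * correlationConstant A ν J / (N * Δ) := by
  have h := integral_average_pow_four_le (P := P) (sampledRate_nonneg (ν := ν) hf Δ)
    (sum_sampledRate_le_correlationConstant hf hJ hΔ hΔ1 A) (M := (2 * ν : ℝ) ^ 2)
    (Finset.Icc 1 N)
    (fun n ω => X ((n + k : ℕ) * Δ) ω i - mean P X i) (fun n => hS.memLp_centered _ i)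
    (fun a b => abs_integral_mul_le (hS.memLp_centered _ i) (hS.memLp_centered _ i) (by positivity)
      (hS.eLpNorm_centered _ i) (hS.eLpNorm_centered _ i))
    (fun a b hab => by
      have := abs_integral_sampled_le hS hf Δ i (Nat.add_le_add_right hab k)
      rwa [Nat.add_sub_add_right] at this)
    (fun a b c d hab hbc hcd => by
      have := abs_integral_sampled_four_le hS hf Δ i (Nat.add_le_add_right hab k)
        (Nat.add_le_add_right hbc k) (Nat.add_le_add_right hcd k)
      rwa [Nat.add_sub_add_right] at this)
  simp only [Nat.card_Icc, Nat.add_sub_cancel] at h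
  refine h.trans_eq ?_
  rw [mul_div_assoc', div_div, mul_comm (Δ : ℝ)]
  ring

theorem variance_sampled_product_le (hS : IsSetup P X Y ρ ν Λ)
    (hf : HasIntegrableDecorrelationRate P X f) {J : ℝ}
    (hJ : ∫ T in Set.Ioi (1 : ℝ), f T ≤ J) {Δ : ℝ≥0} (hΔ : 0 < Δ) (hΔ1 : Δ ≤ 1) {A : ℝ≥0}
    {κ : ℕ} (hκ : (κ : ℝ) * Δ ≤ A + 1) (i j : Fin r) (N : ℕ) :
    Var[fun ω => (N : ℝ)⁻¹ * ∑ n ∈ Finset.Icc 1 N,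
      X (n * Δ) ω i * X ((n + κ : ℕ) * Δ) ω j; P] ≤
      2 * correlationConstant A ν J / (N * Δ) := by
  have hΔ' : (0 : ℝ) < Δ := hΔ
  have hM : 0 ≤ 4 * (ν : ℝ) ^ 2 + 32 * (ν : ℝ) ^ 4 := by positivity
  have h := variance_average_le (P := P)
    (φ := fun k => if k < κ then 4 * (ν : ℝ) ^ 2 + 32 * (ν : ℝ) ^ 4
      else sampledRate f ν Δ (k - κ)) (B := correlationConstant A ν J / Δ)
    (fun k => by
      split_ifs
      exacts [hM, sampledRate_nonneg hf Δ _])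
    (fun n => by
      refine (sum_ite_lt_le (sampledRate_nonneg hf Δ) hM
        (sum_sampledRate_le hf hJ hΔ hΔ1) κ n).trans ?_
      -- The `κ` overlapping indices contribute `κΔ ≤ A + 1` and the short distances `3`, which
      -- explains `A + 4` in `correlationConstant`.
      rw [le_div_iff₀ hΔ', add_mul, div_mul_cancel₀ _ hΔ'.ne', correlationConstant]
      nlinarith)
    (Finset.Icc 1 N)
    (fun n ω => X (n * Δ) ω i * X ((n + κ : ℕ) * Δ) ω j)
    (fun n => memLp_two_mul (hS.memLp_X _ i) (hS.memLp_X _ j))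
    (fun n m => abs_covariance_sampled_le hS hf Δ κ i j n m)
  simp only [Nat.card_Icc, Nat.add_sub_cancel] at h
  refine h.trans_eq ?_
  rw [mul_div_assoc', div_div, mul_comm (Δ : ℝ)]

theorem eLpNorm_sub_integral_le {g : Ω → ℝ} (hg : MemLp g 2 P) {c : ℝ} (hc : 0 ≤ c)
    (h : Var[g; P] ≤ c ^ 2) : eLpNorm (fun ω => g ω - ∫ ω, g ω ∂P) 2 P ≤ ENNReal.ofReal c := by
  refine eLpNorm_two_le_ofReal (hg.sub (memLp_const _)) hc ?_
  rwa [variance_eq_integral hg.1.aemeasurable] at h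

theorem eLpNorm_sampled_mean_sub_le (hS : IsSetup P X Y ρ ν Λ)
    (hf : HasIntegrableDecorrelationRate P X f) {J : ℝ}
    (hJ : ∫ T in Set.Ioi (1 : ℝ), f T ≤ J) {Δ : ℝ≥0} (hΔ : 0 < Δ) (hΔ1 : Δ ≤ 1) (A : ℝ≥0)
    {N : ℕ} (hN : 0 < N) {η : ℝ} (hη : 0 ≤ η) (hNη : 1 / (N * Δ : ℝ) ≤ η ^ 2)
    (i : Fin r) (k : ℕ) :
    eLpNorm (fun ω => (N : ℝ)⁻¹ * ∑ n ∈ Finset.Icc 1 N, X ((n + k : ℕ) * Δ) ω i - mean P X i) 2 P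
      ≤ ENNReal.ofReal (√(2 * correlationConstant A ν J) * η) := by
  have hD := correlationConstant_nonneg (ν := ν) hf hJ A
  have h2 (n : ℕ) : MemLp (fun ω => X ((n + k : ℕ) * Δ) ω i) 2 P :=
    (hS.memLp_X _ i).mono_exponent (by norm_num)
  have h := eLpNorm_sub_integral_le (c := √(2 * correlationConstant A ν J) * η)
    (memLp_average h2 N) (by positivity) (by
      refine (variance_sampled_mean_le hS hf hJ hΔ hΔ1 A i N k).trans ?_
      rw [mul_pow, Real.sq_sqrt (by positivity), div_eq_mul_one_div]
      gcongr)
  rwa [integral_average (fun n => (h2 n).integrable one_le_two) hN fun n => hS.integral_X _ i] at h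

/-- The constant in the speed of the entries of the covariance estimator. -/
noncomputable def entryConstant (ν : ℝ≥0) (D : ℝ) : ℝ :=
  √(2 * D) + √(24 * (1 + 4 * (ν : ℝ) ^ 2) * D) + 2 * ν * √(2 * D)

/-- With centered averages `S`, the difference is `S_i S_j + μ_j S_i + μ_i S_j`. The linear terms
are of order `η` by the variance bound. For the quadratic term, `(S_i S_j)² ≤ (S_i⁴ + S_j⁴)/2`, and
a fourth moment of order `1/(NΔ) ≤ η²` suffices. -/
theorem eLpNorm_mean_product_sub_le (hS : IsSetup P X Y ρ ν Λ)
    (hf : HasIntegrableDecorrelationRate P X f) {J : ℝ}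
    (hJ : ∫ T in Set.Ioi (1 : ℝ), f T ≤ J) {Δ : ℝ≥0} (hΔ : 0 < Δ) (hΔ1 : Δ ≤ 1) (A : ℝ≥0)
    {N : ℕ} (hN : 0 < N) {η : ℝ} (hη : 0 ≤ η) (hNη : 1 / (N * Δ : ℝ) ≤ η ^ 2)
    (i j : Fin r) (k l : ℕ) :
    eLpNorm (fun ω => ((N : ℝ)⁻¹ * ∑ n ∈ Finset.Icc 1 N, X ((n + k : ℕ) * Δ) ω i) *
        ((N : ℝ)⁻¹ * ∑ n ∈ Finset.Icc 1 N, X ((n + l : ℕ) * Δ) ω j)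
        - mean P X i * mean P X j) 2 P
      ≤ ENNReal.ofReal ((√(24 * (1 + 4 * (ν : ℝ) ^ 2) * correlationConstant A ν J)
        + 2 * ν * √(2 * correlationConstant A ν J)) * η) := by
  set D := correlationConstant A ν J with hDdef
  have hD : 0 ≤ D := correlationConstant_nonneg (ν := ν) hf hJ A
  have hN' : (N : ℝ) ≠ 0 := by exact_mod_cast hN.ne'
  set S : ℕ → Fin r → Ω → ℝ := fun k i ω =>
    (N : ℝ)⁻¹ * ∑ n ∈ Finset.Icc 1 N, X ((n + k : ℕ) * Δ) ω i - mean P X i with hSdef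
  have hS4 (k i) : MemLp (S k i) 4 P :=
    (memLp_average (fun n => hS.memLp_X _ i) N).sub (memLp_const _)
  have hcent (k i) : S k i = fun ω => (N : ℝ)⁻¹ * ∑ n ∈ Finset.Icc 1 N,
      (X ((n + k : ℕ) * Δ) ω i - mean P X i) := by
    ext ω
    simp only [hSdef, Finset.sum_sub_distrib, Finset.sum_const, Nat.card_Icc, Nat.add_sub_cancel,
      nsmul_eq_mul]
    rw [mul_sub, inv_mul_cancel_left₀ hN']
  have h4 (k i) : ∫ ω, S k i ω ^ 4 ∂P ≤ 24 * (1 + 4 * (ν : ℝ) ^ 2) * D * η ^ 2 := by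
    rw [hcent]
    refine (integral_sampled_mean_pow_four_le hS hf hJ hΔ hΔ1 A i N k).trans ?_
    rw [div_eq_mul_one_div]
    gcongr
  have i4 (k i) : Integrable (fun ω => S k i ω ^ 4) P :=
    ((hS4 k i).integrable_norm_pow (by norm_num)).congr (ae_of_all _ fun ω => by
      simp [Even.pow_abs (show Even 4 by decide)])
  have hprod2 := memLp_two_mul (hS4 k i) (hS4 l j)
  have h1 : eLpNorm (fun ω => S k i ω * S l j ω) 2 P ≤
      ENNReal.ofReal (√(24 * (1 + 4 * (ν : ℝ) ^ 2) * D) * η) := by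
    refine eLpNorm_two_le_ofReal hprod2 (by positivity) ?_
    rw [mul_pow, Real.sq_sqrt (by positivity)]
    calc ∫ ω, (S k i ω * S l j ω) ^ 2 ∂P ≤ ∫ ω, (S k i ω ^ 4 + S l j ω ^ 4) / 2 ∂P := by
          refine integral_mono hprod2.integrable_sq (((i4 k i).add (i4 l j)).div_const 2) fun ω => ?_
          have := sq_nonneg (S k i ω ^ 2 - S l j ω ^ 2)
          dsimp only
          nlinarith
      _ = ((∫ ω, S k i ω ^ 4 ∂P) + ∫ ω, S l j ω ^ 4 ∂P) / 2 := by
          rw [integral_div, integral_add (i4 k i) (i4 l j)]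
      _ ≤ _ := by linarith [h4 k i, h4 l j]
  have h2 (k i) : eLpNorm (S k i) 2 P ≤ ENNReal.ofReal (√(2 * D) * η) :=
    eLpNorm_sampled_mean_sub_le hS hf hJ hΔ hΔ1 A hN hη hNη i k
  have h3 (k i j) : eLpNorm (fun ω => mean P X j * S k i ω) 2 P ≤
      ENNReal.ofReal (ν * (√(2 * D) * η)) := by
    have : (fun ω => mean P X j * S k i ω) = mean P X j • S k i := rfl
    rw [this, eLpNorm_const_smul, ENNReal.ofReal_mul ν.coe_nonneg, ← ofReal_norm]
    exact mul_le_mul' (ENNReal.ofReal_le_ofReal (hS.abs_mean_le j)) (h2 k i)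
  have e : (fun ω => ((N : ℝ)⁻¹ * ∑ n ∈ Finset.Icc 1 N, X ((n + k : ℕ) * Δ) ω i) *
        ((N : ℝ)⁻¹ * ∑ n ∈ Finset.Icc 1 N, X ((n + l : ℕ) * Δ) ω j)
        - mean P X i * mean P X j) = ((fun ω => S k i ω * S l j ω) +
        fun ω => mean P X j * S k i ω) + fun ω => mean P X i * S l j ω := by
    ext ω
    simp only [hSdef, Pi.add_apply]
    ring
  have m1 (k i j) : AEStronglyMeasurable (fun ω => mean P X j * S k i ω) P :=
    ((hS4 k i).const_mul _).1
  rw [e]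
  refine (eLpNorm_add_le (hprod2.1.add (m1 k i j)) (m1 l j i) one_le_two).trans ?_
  refine (add_le_add_left (eLpNorm_add_le hprod2.1 (m1 k i j) one_le_two) _).trans ?_
  refine (add_le_add (add_le_add h1 (h3 k i j)) (h3 l j i)).trans_eq ?_
  rw [← ENNReal.ofReal_add (by positivity) (by positivity),
    ← ENNReal.ofReal_add (by positivity) (by positivity)]
  ring_nf

end Assembly

/-! ### The upper bound for optimized schemes -/

section UpperBound

open ProbabilityTheory
open scoped Matrix.Norms.Elementwise

variable {Ω : Type*} [MeasurableSpace Ω] {P : Measure Ω} {r : ℕ}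
  {X : ℝ≥0 → Ω → Fin r → ℝ} {Y : ℝ → ℝ≥0 → Ω → Fin r → ℝ} {ρ f : ℝ → ℝ} {ν : ℝ≥0}
  {Λ : ℝ≥0 → ℝ≥0}

/-- The rounded lag may exceed `A`, by at most one step `Δ ≤ 1`; this is why the Lipschitz constant
is taken on `[0, A + 1]`. -/
theorem abs_lagCov_sub_le (hS : IsSetup P X Y ρ ν Λ) {Δ : ℝ≥0} (hΔ : 0 < Δ) (hΔ1 : Δ ≤ 1)
    {u A : ℝ≥0} (hu : u ≤ A) (i j : Fin r) :
    |lagCov P X (lagIndex Δ u * Δ) i j - lagCov P X u i j| ≤ Λ (A + 1) * Δ := by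
  have h1 := abs_lagIndex_mul_sub_le hΔ u
  have hκ : (lagIndex Δ u : ℝ≥0) * Δ ∈ Set.Iic (A + 1) := by
    rw [Set.mem_Iic, ← NNReal.coe_le_coe]
    push_cast
    have h2 : (u : ℝ) ≤ A := hu
    have h3 : (Δ : ℝ) ≤ 1 := hΔ1
    linarith [(abs_le.1 h1).2]
  have h2 := (hS.lipschitz (A + 1)).dist_le_mul _ hκ u (Set.mem_Iic.2 (hu.trans le_self_add))
  have h3 := Matrix.norm_entry_le_entrywise_sup_norm
    (lagCov P X (lagIndex Δ u * Δ) - lagCov P X u) (i := i) (j := j)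
  rw [Matrix.sub_apply, Real.norm_eq_abs] at h3
  refine h3.trans ?_
  rw [← dist_eq_norm]
  refine h2.trans ?_
  gcongr
  rw [NNReal.dist_eq]
  push_cast
  exact h1

variable [IsProbabilityMeasure P]

/-- Five errors are added: passing from `Y` to `X` in the lagged products (`E₁`) and in the product
of means (`E₂`), the fluctuation of the lagged products (`E₃`) and of the product of means (`E₄`),
and the rounding of the lag (`E₅`). -/
theorem eLpNorm_empCov_entry_le (hS : IsSetup P X Y ρ ν Λ)
    (hf : HasIntegrableDecorrelationRate P X f) {J : ℝ}
    (hJ : ∫ T in Set.Ioi (1 : ℝ), f T ≤ J) {Δ : ℝ≥0} (hΔ : 0 < Δ) (hΔ1 : Δ ≤ 1) {u A : ℝ≥0}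
    (hu : u ≤ A) {N : ℕ} (hN : 0 < N) {η : ℝ} (hη : 0 ≤ η) (hNη : 1 / (N * Δ : ℝ) ≤ η ^ 2)
    {ε : ℝ} (hε : 0 < ε) (i j : Fin r) :
    eLpNorm (fun ω => empCov (Y ε) N Δ u ω i j - lagCov P X u i j) 2 P ≤
      ENNReal.ofReal (4 * ν * ρ ε + entryConstant ν (correlationConstant A ν J) * η
        + Λ (A + 1) * Δ) := by
  set D := correlationConstant A ν J with hDdef
  have hD : 0 ≤ D := correlationConstant_nonneg (ν := ν) hf hJ A
  have hρ : 0 ≤ ρ ε := (hS.isSpeed.1 ε hε).le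
  set κ := lagIndex Δ u with hκdef
  have hκ : (κ : ℝ) * Δ ≤ A + 1 := by
    have h1 := (abs_le.1 (abs_lagIndex_mul_sub_le hΔ u)).2
    have h2 : (u : ℝ) ≤ A := hu
    have h3 : (Δ : ℝ) ≤ 1 := hΔ1
    linarith
  have p1 (n : ℕ) := memLp_two_mul (hS.memLp_Y hε (n * Δ) i) (hS.memLp_Y hε ((n + κ : ℕ) * Δ) j)
  have p2 (n : ℕ) := memLp_two_mul (hS.memLp_X (n * Δ) i) (hS.memLp_X ((n + κ : ℕ) * Δ) j)
  have aX (k i) : MemLp (fun ω => (N : ℝ)⁻¹ * ∑ n ∈ Finset.Icc 1 N, X ((n + k : ℕ) * Δ) ω i) 4 P :=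
    memLp_average (fun n => hS.memLp_X _ i) N
  have aY (k i) : MemLp (fun ω => (N : ℝ)⁻¹ * ∑ n ∈ Finset.Icc 1 N, Y ε ((n + k : ℕ) * Δ) ω i)
      4 P := memLp_average (fun n => hS.memLp_Y hε _ i) N
  let E₁ : Ω → ℝ := fun ω => (N : ℝ)⁻¹ * ∑ n ∈ Finset.Icc 1 N,
    (Y ε (n * Δ) ω i * Y ε ((n + κ : ℕ) * Δ) ω j - X (n * Δ) ω i * X ((n + κ : ℕ) * Δ) ω j)
  let E₂ : Ω → ℝ := fun ω =>
    ((N : ℝ)⁻¹ * ∑ n ∈ Finset.Icc 1 N, Y ε ((n + 0 : ℕ) * Δ) ω i) *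
        ((N : ℝ)⁻¹ * ∑ n ∈ Finset.Icc 1 N, Y ε ((n + κ : ℕ) * Δ) ω j) -
      ((N : ℝ)⁻¹ * ∑ n ∈ Finset.Icc 1 N, X ((n + 0 : ℕ) * Δ) ω i) *
        ((N : ℝ)⁻¹ * ∑ n ∈ Finset.Icc 1 N, X ((n + κ : ℕ) * Δ) ω j)
  let E₃ : Ω → ℝ := fun ω =>
    (N : ℝ)⁻¹ * ∑ n ∈ Finset.Icc 1 N, X (n * Δ) ω i * X ((n + κ : ℕ) * Δ) ω j -
      (lagCov P X (κ * Δ) i j + mean P X i * mean P X j)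
  let E₄ : Ω → ℝ := fun ω =>
    ((N : ℝ)⁻¹ * ∑ n ∈ Finset.Icc 1 N, X ((n + 0 : ℕ) * Δ) ω i) *
        ((N : ℝ)⁻¹ * ∑ n ∈ Finset.Icc 1 N, X ((n + κ : ℕ) * Δ) ω j) - mean P X i * mean P X j
  let E₅ : Ω → ℝ := fun _ => lagCov P X (κ * Δ) i j - lagCov P X u i j
  have b1 : eLpNorm E₁ 2 P ≤ ENNReal.ofReal (2 * ν * ρ ε) :=
    eLpNorm_average_Icc_le one_le_two hN (fun n => (p1 n).1.sub (p2 n).1) fun n =>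
      eLpNorm_mul_sub_mul_le (hS.memLp_X _ i) (hS.memLp_X _ j) (hS.memLp_Y hε _ i)
        (hS.memLp_Y hε _ j) ν.coe_nonneg hρ (hS.eLpNorm_X _ i) (hS.eLpNorm_Y hε _ j)
        (hS.eLpNorm_Y_sub_X hε _ i) (hS.eLpNorm_Y_sub_X hε _ j)
  have b2 : eLpNorm E₂ 2 P ≤ ENNReal.ofReal (2 * ν * ρ ε) :=
    eLpNorm_mul_sub_mul_le (aX 0 i) (aX κ j) (aY 0 i) (aY κ j) ν.coe_nonneg hρ
      (eLpNorm_average_Icc_le (by norm_num) hN (fun n => (hS.memLp_X _ i).1)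
        fun n => hS.eLpNorm_X _ i)
      (eLpNorm_average_Icc_le (by norm_num) hN (fun n => (hS.memLp_Y hε _ j).1)
        fun n => hS.eLpNorm_Y hε _ j)
      (eLpNorm_empMean_sub_le hS hε hN Δ 0 i) (eLpNorm_empMean_sub_le hS hε hN Δ κ j)
  have b3 : eLpNorm E₃ 2 P ≤ ENNReal.ofReal (√(2 * D) * η) := by
    have h := eLpNorm_sub_integral_le (c := √(2 * D) * η) (memLp_average p2 N) (by positivity) (by
      refine (variance_sampled_product_le hS hf hJ hΔ hΔ1 hκ i j N).trans ?_
      rw [mul_pow, Real.sq_sqrt (by positivity), div_eq_mul_one_div]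
      gcongr)
    rwa [integral_average (fun n => (p2 n).integrable one_le_two) hN fun n => by
      rw [Nat.cast_add, add_mul, hS.integral_X_mul_X]] at h
  have b4 : eLpNorm E₄ 2 P ≤ ENNReal.ofReal ((√(24 * (1 + 4 * (ν : ℝ) ^ 2) * D)
        + 2 * ν * √(2 * D)) * η) :=
    eLpNorm_mean_product_sub_le hS hf hJ hΔ hΔ1 A hN hη hNη i j 0 κ
  have b5 : eLpNorm E₅ 2 P ≤ ENNReal.ofReal (Λ (A + 1) * Δ) := by
    rw [eLpNorm_const _ (by norm_num) (NeZero.ne P)]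
    simp only [measure_univ, ENNReal.one_rpow, mul_one]
    rw [← ofReal_norm]
    exact ENNReal.ofReal_le_ofReal (abs_lagCov_sub_le hS hΔ hΔ1 hu i j)
  have e : (fun ω => empCov (Y ε) N Δ u ω i j - lagCov P X u i j) =
      E₁ + E₃ - E₂ - E₄ + E₅ := by
    ext ω
    simp only [empCov_apply, empMean_apply, shiftedEmpMean_apply, E₁, E₂, E₃, E₄, E₅, Pi.add_apply,
      Pi.sub_apply, Finset.sum_sub_distrib, mul_sub, Nat.add_zero, ← hκdef]
    ring
  have m1 : AEStronglyMeasurable E₁ P := (memLp_average (fun n => (p1 n).sub (p2 n)) N).1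
  have m2 : AEStronglyMeasurable E₂ P := ((aY 0 i).1.mul (aY κ j).1).sub ((aX 0 i).1.mul (aX κ j).1)
  have m3 : AEStronglyMeasurable E₃ P := (memLp_average p2 N).1.sub aestronglyMeasurable_const
  have m4 : AEStronglyMeasurable E₄ P :=
    ((aX 0 i).1.mul (aX κ j).1).sub aestronglyMeasurable_const
  have m5 : AEStronglyMeasurable E₅ P := aestronglyMeasurable_const
  rw [e]
  calc eLpNorm (E₁ + E₃ - E₂ - E₄ + E₅) 2 P
      ≤ eLpNorm E₁ 2 P + eLpNorm E₃ 2 P + eLpNorm E₂ 2 P + eLpNorm E₄ 2 P + eLpNorm E₅ 2 P := by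
        refine (eLpNorm_add_le (((m1.add m3).sub m2).sub m4) m5 one_le_two).trans ?_
        gcongr
        refine (eLpNorm_sub_le ((m1.add m3).sub m2) m4 one_le_two).trans ?_
        gcongr
        refine (eLpNorm_sub_le (m1.add m3) m2 one_le_two).trans ?_
        gcongr
        exact eLpNorm_add_le m1 m3 one_le_two
    _ ≤ ENNReal.ofReal (2 * ν * ρ ε) + ENNReal.ofReal (√(2 * D) * η) +
        ENNReal.ofReal (2 * ν * ρ ε) + ENNReal.ofReal ((√(24 * (1 + 4 * (ν : ℝ) ^ 2) * D)
        + 2 * ν * √(2 * D)) * η) + ENNReal.ofReal (Λ (A + 1) * Δ) := by gcongr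
    _ = _ := by
        rw [← ENNReal.ofReal_add (by positivity) (by positivity),
          ← ENNReal.ofReal_add (by positivity) (by positivity),
          ← ENNReal.ofReal_add (by positivity) (by positivity),
          ← ENNReal.ofReal_add (by positivity) (by positivity), entryConstant]
        ring_nf

theorem eLpNorm_empMean_entry_le (hS : IsSetup P X Y ρ ν Λ)
    (hf : HasIntegrableDecorrelationRate P X f) {J : ℝ}
    (hJ : ∫ T in Set.Ioi (1 : ℝ), f T ≤ J) {Δ : ℝ≥0} (hΔ : 0 < Δ) (hΔ1 : Δ ≤ 1) (A : ℝ≥0)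
    {N : ℕ} (hN : 0 < N) {η : ℝ} (hη : 0 ≤ η) (hNη : 1 / (N * Δ : ℝ) ≤ η ^ 2)
    {ε : ℝ} (hε : 0 < ε) (i : Fin r) :
    eLpNorm (fun ω => empMean (Y ε) N Δ ω i - mean P X i) 2 P ≤
      ENNReal.ofReal (ρ ε + √(2 * correlationConstant A ν J) * η) := by
  have hρ : 0 ≤ ρ ε := (hS.isSpeed.1 ε hε).le
  have aX := memLp_average (fun n : ℕ => hS.memLp_X ((n + 0 : ℕ) * Δ) i) N
  have aY := memLp_average (fun n : ℕ => hS.memLp_Y hε ((n + 0 : ℕ) * Δ) i) N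
  have h1 := (eLpNorm_le_eLpNorm_of_exponent_le (p := 2) (q := 4) (by norm_num)
    (aY.1.sub aX.1)).trans (eLpNorm_empMean_sub_le hS hε hN Δ 0 i)
  have h2 := eLpNorm_sampled_mean_sub_le hS hf hJ hΔ hΔ1 A hN hη hNη i 0
  rw [ENNReal.ofReal_add hρ (by positivity)]
  refine le_trans (le_of_eq ?_) ((eLpNorm_add_le (aY.1.sub aX.1)
    (aX.1.sub aestronglyMeasurable_const) one_le_two).trans (add_le_add h1 h2))
  congr 1
  ext ω
  simp [empMean_apply]

theorem exists_upperBound (r : ℕ) (A ν : ℝ≥0) (J : ℝ) (Λ : ℝ≥0 → ℝ≥0) (a b : ℝ) : ∃ C : ℝ,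
    ∀ {Ω : Type*} [MeasurableSpace Ω] (P : Measure Ω) [IsProbabilityMeasure P]
      (X : ℝ≥0 → Ω → Fin r → ℝ) (Y : ℝ → ℝ≥0 → Ω → Fin r → ℝ) (ρ f : ℝ → ℝ)
      (N : ℝ → ℕ) (Δ : ℝ → ℝ≥0), IsSetup P X Y ρ ν Λ → HasIntegrableDecorrelationRate P X f →
      (∫ T in Set.Ioi (1 : ℝ), f T) ≤ J → IsOptimizedScheme ρ a b N Δ →
      ∀ᶠ ε in 𝓝[>] (0 : ℝ),
        (∀ u : ℝ≥0, u ≤ A → covError P X Y N Δ u ε ≤ ENNReal.ofReal (C * ρ ε)) ∧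
        meanError P X Y N Δ ε ≤ ENNReal.ofReal (C * ρ ε) := by
  set D := correlationConstant A ν J with hD
  -- For small `ε` one has `N ≥ a/(2ρ³)` and `Δ ≥ bρ/2`, hence `1/(NΔ) ≤ (4/(ab)) ρ²`.
  set η := √(4 / (a * b)) with hη
  -- The constant is fixed before `a` and `b` are known to be positive; `|b|` and the square roots
  -- keep it nonnegative in any case.
  set C₁ : ℝ := 4 * ν + entryConstant ν D * η + Λ (A + 1) * (2 * |b|) with hC₁
  set C₂ : ℝ := 1 + √(2 * D) * η with hC₂
  have hC₁0 : 0 ≤ C₁ := by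
    have : 0 ≤ entryConstant ν D := by unfold entryConstant; positivity
    positivity
  have hC₂0 : 0 ≤ C₂ := by positivity
  -- Passing from entries to rows and from rows to the matrix costs a factor `r` each time; the mean
  -- vector costs one.
  refine ⟨r * (r * C₁) + r * C₂, ?_⟩
  intro Ω _ P _ X Y ρ f N Δ hS hf hJ hopt
  obtain ⟨ha, hlimN⟩ := hopt.number_similar
  obtain ⟨hb, hlimΔ⟩ := hopt.step_similar
  have hρ0 : ∀ᶠ ε in 𝓝[>] (0 : ℝ), 2 * b * ρ ε < 1 := by
    have := hS.isSpeed.2.const_mul (2 * b)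
    rw [mul_zero] at this
    exact this.eventually_lt_const one_pos
  filter_upwards [hlimN.eventually_const_lt (show a / 2 < a by linarith),
    hlimΔ.eventually_const_lt (show b / 2 < b by linarith),
    hlimΔ.eventually_lt_const (show b < 2 * b by linarith), hρ0, self_mem_nhdsWithin]
    with ε h1 h2 h3 h4 hε
  have hε : 0 < ε := hε
  have hρ := hS.isSpeed.1 ε hε
  have hΔ := hopt.step_pos ε hε
  have hΔ' : (0 : ℝ) < Δ ε := hΔ
  rw [div_div_eq_mul_div, div_one] at h1
  rw [lt_div_iff₀ hρ] at h2
  rw [div_lt_iff₀ hρ] at h3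
  have hΔ1 : Δ ε ≤ 1 := by
    rw [← NNReal.coe_le_coe]
    push_cast
    linarith
  have hN : 0 < N ε := by
    rcases Nat.eq_zero_or_pos (N ε) with h | h
    · rw [h] at h1
      simp at h1
      linarith
    · exact h
  have hN' : (0 : ℝ) < N ε := by exact_mod_cast hN
  have hη0 : 0 ≤ η * ρ ε := by positivity
  have hNη : 1 / ((N ε : ℝ) * Δ ε) ≤ (η * ρ ε) ^ 2 := by
    rw [mul_pow, hη, Real.sq_sqrt (by positivity), div_mul_eq_mul_div,
      div_le_div_iff₀ (by positivity) (by positivity)]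
    have h5 : (a / 2) * (b / 2 * ρ ε) ≤ (N ε : ℝ) * ρ ε ^ 3 * Δ ε :=
      mul_le_mul h1.le h2.le (by positivity) (by positivity)
    have h6 : (a * b) * ρ ε ≤ (4 * ρ ε ^ 2 * (N ε * Δ ε)) * ρ ε := by linarith
    rw [one_mul]
    exact le_of_mul_le_mul_right h6 hρ
  refine ⟨fun u hu => ?_, ?_⟩
  · have hent (i j : Fin r) : eLpNorm (fun ω => (empCov (Y ε) (N ε) (Δ ε) u ω - lagCov P X u) i j)
        2 P ≤ ENNReal.ofReal (C₁ * ρ ε) := by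
      refine (eLpNorm_empCov_entry_le hS hf hJ hΔ hΔ1 hu hN hη0 hNη hε i j).trans ?_
      refine ENNReal.ofReal_le_ofReal ?_
      have h5 : (Λ (A + 1) : ℝ) * Δ ε ≤ Λ (A + 1) * (2 * |b| * ρ ε) := by
        rw [abs_of_pos hb]
        gcongr
      rw [hC₁]
      linarith
    have hmeas (i j : Fin r) : AEStronglyMeasurable
        (fun ω => (empCov (Y ε) (N ε) (Δ ε) u ω - lagCov P X u) i j) P := by
      simp only [Matrix.sub_apply, empCov_apply, empMean_apply, shiftedEmpMean_apply]
      have := fun t i => (hS.memLp_Y hε t i).1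
      refine AEStronglyMeasurable.sub (AEStronglyMeasurable.sub ?_ ?_) aestronglyMeasurable_const
      · exact (memLp_average (fun n => memLp_two_mul (hS.memLp_Y hε _ i) (hS.memLp_Y hε _ j)) _).1
      · exact (memLp_average (fun n => hS.memLp_Y hε _ i) _).1.mul
          (memLp_average (fun n => hS.memLp_Y hε _ j) _).1
    have hrow (i : Fin r) : eLpNorm (fun ω => (empCov (Y ε) (N ε) (Δ ε) u ω - lagCov P X u) i)
        2 P ≤ r * ENNReal.ofReal (C₁ * ρ ε) :=
      eLpNorm_pi_le one_le_two (hmeas i) (hent i)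
    have hrowm (i : Fin r) : AEStronglyMeasurable
        (fun ω => (empCov (Y ε) (N ε) (Δ ε) u ω - lagCov P X u) i) P :=
      (aemeasurable_pi_lambda _ fun j => (hmeas i j).aemeasurable).aestronglyMeasurable
    refine (eLpNorm_pi_le (E := Fin r → ℝ) one_le_two hrowm hrow).trans ?_
    have hr : (r : ℝ≥0∞) = ENNReal.ofReal r := by simp
    rw [hr, ← ENNReal.ofReal_mul (by positivity), ← ENNReal.ofReal_mul (by positivity)]
    refine ENNReal.ofReal_le_ofReal ?_
    have : 0 ≤ r * C₂ * ρ ε := by positivity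
    linarith
  · have hent (i : Fin r) : eLpNorm (fun ω => (empMean (Y ε) (N ε) (Δ ε) ω - mean P X) i)
        2 P ≤ ENNReal.ofReal (C₂ * ρ ε) := by
      refine (eLpNorm_empMean_entry_le hS hf hJ hΔ hΔ1 A hN hη0 hNη hε i).trans_eq ?_
      rw [hC₂, ← hD]
      ring_nf
    have hmeas (i : Fin r) : AEStronglyMeasurable
        (fun ω => (empMean (Y ε) (N ε) (Δ ε) ω - mean P X) i) P := by
      simp only [Pi.sub_apply, empMean_apply]
      exact (memLp_average (fun n => hS.memLp_Y hε _ i) _).1.sub aestronglyMeasurable_const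
    refine (eLpNorm_pi_le one_le_two hmeas hent).trans ?_
    have hr : (r : ℝ≥0∞) = ENNReal.ofReal r := by simp
    rw [hr, ← ENNReal.ofReal_mul (by positivity)]
    refine ENNReal.ofReal_le_ofReal ?_
    have : 0 ≤ r * (r * C₁) * ρ ε := by positivity
    linarith

end UpperBound

/-! ### Existence and adaptivity of optimized schemes -/

section Schemes

/-- The span is `(Nρ³)(Δ/ρ) ρ⁻²`, where the first two factors tend to `a` and `b`; the step is
`(Δ/ρ) ρ`. -/
theorem IsOptimizedScheme.isAdaptiveScheme {ρ : ℝ → ℝ} (hρ : IsSpeed ρ) {a b : ℝ} {N : ℝ → ℕ}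
    {Δ : ℝ → ℝ≥0} (h : IsOptimizedScheme ρ a b N Δ) : IsAdaptiveScheme N Δ := by
  obtain ⟨ha, hN⟩ := h.number_similar
  obtain ⟨hb, hΔ⟩ := h.step_similar
  have hpos : ∀ᶠ ε in 𝓝[>] (0 : ℝ), 0 < ρ ε :=
    eventually_nhdsWithin_of_forall fun ε hε => hρ.1 ε hε
  refine ⟨h.step_pos, ?_, ?_⟩
  · rw [← NNReal.tendsto_coe, NNReal.coe_zero]
    have := hΔ.mul hρ.2
    rw [mul_zero] at this
    refine this.congr' ?_
    filter_upwards [hpos] with ε hε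
    field_simp
  · have h1 : Tendsto (fun ε => (ρ ε ^ 2)⁻¹) (𝓝[>] 0) atTop := by
      refine Tendsto.inv_tendsto_nhdsGT_zero ?_
      refine tendsto_nhdsWithin_iff.2 ⟨?_, ?_⟩
      · simpa using hρ.2.pow 2
      · filter_upwards [hpos] with ε hε
        exact Set.mem_Ioi.2 (by positivity)
    refine ((hN.mul hΔ).pos_mul_atTop (mul_pos ha hb) h1).congr' ?_
    filter_upwards [hpos] with ε hε
    field_simp

theorem exists_isOptimizedScheme {ρ : ℝ → ℝ} (hρ : IsSpeed ρ) {a b : ℝ} (ha : 0 < a) (hb : 0 < b) :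
    ∃ (N : ℝ → ℕ) (Δ : ℝ → ℝ≥0), IsOptimizedScheme ρ a b N Δ := by
  have hpos : ∀ᶠ ε in 𝓝[>] (0 : ℝ), 0 < ρ ε :=
    eventually_nhdsWithin_of_forall fun ε hε => hρ.1 ε hε
  refine ⟨fun ε => ⌊a / ρ ε ^ 3⌋₊, fun ε => Real.toNNReal (b * ρ ε), ?_, ⟨ha, ?_⟩, hb, ?_⟩
  · intro ε hε
    exact Real.toNNReal_pos.2 (mul_pos hb (hρ.1 ε hε))
  · have h1 : Tendsto (fun ε => 1 / ρ ε ^ 3) (𝓝[>] 0) atTop := by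
      simp only [one_div]
      refine Tendsto.inv_tendsto_nhdsGT_zero ?_
      refine tendsto_nhdsWithin_iff.2 ⟨?_, ?_⟩
      · simpa using hρ.2.pow 3
      · filter_upwards [hpos] with ε hε
        exact Set.mem_Ioi.2 (by positivity)
    refine ((tendsto_nat_floor_mul_div_atTop ha.le).comp h1).congr fun ε => ?_
    simp [div_eq_mul_inv]
  · refine tendsto_const_nhds.congr' ?_
    filter_upwards [hpos] with ε hε
    rw [Real.coe_toNNReal _ (by positivity), mul_div_cancel_right₀ _ hε.ne']

end Schemes

/-! ### Bias and variance of the Ornstein-Uhlenbeck covariance estimator -/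

section OrnsteinUhlenbeck

open ProbabilityTheory

/-- A geometric sum whose ratio satisfies `1 - exp(-Δ) ≥ Δ/(1+Δ) ≥ Δ/2`. -/
theorem sum_exp_neg_mul_le {Δ : ℝ} (hΔ : 0 < Δ) (hΔ1 : Δ ≤ 1) (n : ℕ) :
    ∑ k ∈ Finset.range n, Real.exp (-(k * Δ)) ≤ 2 / Δ := by
  have h1 : ∀ k : ℕ, Real.exp (-(k * Δ)) = Real.exp (-Δ) ^ k := fun k => by
    rw [← Real.exp_nat_mul]
    ring_nf
  simp only [h1]
  have h2 : Real.exp (-Δ) * (1 + Δ) ≤ 1 := by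
    rw [Real.exp_neg, inv_mul_le_iff₀ (Real.exp_pos _), mul_one]
    linarith [Real.add_one_le_exp Δ]
  have h3 := mul_neg_geom_sum (Real.exp (-Δ)) n
  have h4 : 0 ≤ Real.exp (-Δ) ^ n := by positivity
  have h5 : 0 ≤ ∑ k ∈ Finset.range n, Real.exp (-Δ) ^ k := Finset.sum_nonneg fun k _ => by positivity
  have h6 : Δ / 2 ≤ 1 - Real.exp (-Δ) := by nlinarith [Real.exp_pos (-Δ)]
  rw [le_div_iff₀ hΔ]
  nlinarith [mul_le_mul_of_nonneg_right h6 h5]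

/-- Each sample has about `1/Δ` neighbours within time `1`, each contributing at least `exp(-2)`. -/
theorem sum_sum_exp_neg_ge {Δ : ℝ} (hΔ : 0 < Δ) (hΔ1 : Δ ≤ 1) {N : ℕ} (hN : 2 ≤ N * Δ) :
    N * (Real.exp (-2) / (2 * Δ)) ≤ ∑ n ∈ Finset.Icc 1 N, ∑ m ∈ Finset.Icc 1 N,
      Real.exp (-(Nat.dist n m * Δ)) ^ 2 := by
  set L := ⌊1 / Δ⌋₊ with hL
  have hL1 : (L : ℝ) ≤ 1 / Δ := Nat.floor_le (by positivity)
  have hL2 : 1 / Δ < L + 1 := Nat.lt_floor_add_one _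
  have hL3 : (1 : ℝ) ≤ L := by
    have : 1 ≤ L := Nat.le_floor (by rw [Nat.cast_one, le_div_iff₀ hΔ]; linarith)
    exact_mod_cast this
  have hL4 : 1 / (2 * Δ) ≤ L := by
    have : 1 / (2 * Δ) = (1 / Δ) / 2 := by field_simp
    linarith
  have hLΔ : L * Δ ≤ 1 := by rwa [le_div_iff₀ hΔ] at hL1
  have hLN : 2 * L ≤ N := by
    have : (2 * L : ℝ) ≤ N := by
      refine le_of_mul_le_mul_right ?_ hΔ
      linarith
    exact_mod_cast this
  have hrow (n : ℕ) (hn : n ∈ Finset.Icc 1 N) :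
      Real.exp (-2) / (2 * Δ) ≤ ∑ m ∈ Finset.Icc 1 N, Real.exp (-(Nat.dist n m * Δ)) ^ 2 := by
    rw [Finset.mem_Icc] at hn
    -- Since `2L ≤ N`, the `L` indices at distances `0, …, L - 1` from `n` fit into the sample on at
    -- least one side of `n`.
    obtain ⟨g, hg, hgN, hgd⟩ : ∃ g : ℕ → ℕ, Set.InjOn g (Finset.range L) ∧
        (∀ j < L, g j ∈ Finset.Icc 1 N) ∧ ∀ j < L, Nat.dist n (g j) = j := by
      by_cases h : n + L ≤ N
      · refine ⟨fun j => n + j, fun a _ b _ hab => by simpa using hab, fun j hj => ?_,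
          fun j hj => ?_⟩
        · rw [Finset.mem_Icc]
          dsimp only
          omega
        · simp [Nat.dist]
      · refine ⟨fun j => n - j, fun a ha b hb hab => ?_, fun j hj => ?_, fun j hj => ?_⟩
        · simp only [Finset.coe_range, Set.mem_Iio] at ha hb
          dsimp only at hab
          omega
        · rw [Finset.mem_Icc]
          dsimp only
          omega
        · simp only [Nat.dist]
          omega
    calc Real.exp (-2) / (2 * Δ) = (1 / (2 * Δ)) * Real.exp (-2) := by ring
      _ ≤ L * Real.exp (-2) := by gcongr
      _ = ∑ j ∈ Finset.range L, Real.exp (-2) := by simp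
      _ ≤ ∑ j ∈ Finset.range L, Real.exp (-(Nat.dist n (g j) * Δ)) ^ 2 := by
          refine Finset.sum_le_sum fun j hj => ?_
          rw [Finset.mem_range] at hj
          rw [hgd j hj, ← Real.exp_nat_mul]
          refine Real.exp_le_exp.2 ?_
          have : (j : ℝ) * Δ ≤ L * Δ := by gcongr
          push_cast
          linarith
      _ = ∑ m ∈ (Finset.range L).image g, Real.exp (-(Nat.dist n m * Δ)) ^ 2 :=
          (Finset.sum_image (f := fun m => Real.exp (-(Nat.dist n m * Δ)) ^ 2) hg).symm
      _ ≤ _ := by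
          refine Finset.sum_le_sum_of_subset_of_nonneg ?_ fun _ _ _ => by positivity
          intro m hm
          obtain ⟨j, hj, rfl⟩ := Finset.mem_image.1 hm
          exact hgN j (Finset.mem_range.1 hj)
  calc N * (Real.exp (-2) / (2 * Δ)) = ∑ n ∈ Finset.Icc 1 N, Real.exp (-2) / (2 * Δ) := by simp
    _ ≤ _ := Finset.sum_le_sum hrow

variable {Ω : Type*}

/-- The empirical covariance of a scalar process at the lag of `κ` steps. -/
noncomputable def scalarCov (x : ℝ≥0 → Ω → ℝ) (N κ : ℕ) (Δ : ℝ≥0) (ω : Ω) : ℝ :=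
  (N : ℝ)⁻¹ * ∑ n ∈ Finset.Icc 1 N, x (n * Δ) ω * x ((n + κ : ℕ) * Δ) ω -
    ((N : ℝ)⁻¹ * ∑ n ∈ Finset.Icc 1 N, x (n * Δ) ω) *
      ((N : ℝ)⁻¹ * ∑ n ∈ Finset.Icc 1 N, x ((n + κ : ℕ) * Δ) ω)

/-- Written as a linear combination of products of two values, the estimator has a mean and a
variance that involve moments of order two and four only. -/
theorem scalarCov_eq (x : ℝ≥0 → Ω → ℝ) (N κ : ℕ) (Δ : ℝ≥0) (ω : Ω) :
    scalarCov x N κ Δ ω =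
      (N : ℝ)⁻¹ * ∑ n ∈ Finset.Icc 1 N, x (n * Δ) ω * x ((n + κ : ℕ) * Δ) ω -
      (N : ℝ)⁻¹ ^ 2 * ∑ p ∈ Finset.Icc 1 N ×ˢ Finset.Icc 1 N,
        x (p.1 * Δ) ω * x ((p.2 + κ : ℕ) * Δ) ω := by
  rw [scalarCov, Finset.sum_product]
  dsimp only
  rw [← Finset.sum_mul_sum]
  ring

variable [MeasurableSpace Ω] {P : Measure Ω} {x : ℝ≥0 → Ω → ℝ}

theorem abs_sampled_sub (Δ : ℝ≥0) (n m : ℕ) :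
    |(((m : ℝ≥0) * Δ : ℝ≥0) : ℝ) - (((n : ℝ≥0) * Δ : ℝ≥0) : ℝ)| = Nat.dist n m * Δ := by
  push_cast
  rw [← sub_mul, abs_mul, abs_of_nonneg Δ.coe_nonneg]
  congr 1
  rcases le_total n m with h | h
  · rw [Nat.dist_eq_sub_of_le h, abs_of_nonneg (by simpa using h)]
    push_cast [h]
    rfl
  · rw [Nat.dist_eq_sub_of_le_right h, abs_of_nonpos (by simpa using h)]
    push_cast [h]
    ring

namespace IsOrnsteinUhlenbeck

theorem integral_sampled (hx : IsOrnsteinUhlenbeck P x) (Δ : ℝ≥0) (n m : ℕ) :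
    ∫ ω, x (n * Δ) ω * x (m * Δ) ω ∂P = Real.exp (-(Nat.dist n m * Δ)) := by
  rw [hx.integral_mul, abs_sampled_sub]

theorem memLp_mul (hx : IsOrnsteinUhlenbeck P x) (s t : ℝ≥0) :
    MemLp (fun ω => x s ω * x t ω) 2 P :=
  memLp_two_mul (hx.memLp s) (hx.memLp t)

theorem memLp_scalarCov (hx : IsOrnsteinUhlenbeck P x) (N κ : ℕ) (Δ : ℝ≥0) :
    MemLp (scalarCov x N κ Δ) 2 P := by
  have : scalarCov x N κ Δ = fun ω =>
      (N : ℝ)⁻¹ * ∑ n ∈ Finset.Icc 1 N, x (n * Δ) ω * x ((n + κ : ℕ) * Δ) ω -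
      (N : ℝ)⁻¹ ^ 2 * ∑ p ∈ Finset.Icc 1 N ×ˢ Finset.Icc 1 N,
        x (p.1 * Δ) ω * x ((p.2 + κ : ℕ) * Δ) ω := funext (scalarCov_eq x N κ Δ)
  rw [this]
  exact ((memLp_finsetSum _ fun n _ => hx.memLp_mul _ _).const_mul _).sub
    ((memLp_finsetSum _ fun n _ => hx.memLp_mul _ _).const_mul _)

variable [IsProbabilityMeasure P]

theorem covariance_sampled (hx : IsOrnsteinUhlenbeck P x) (Δ : ℝ≥0) (a b c d : ℕ) :
    cov[fun ω => x (a * Δ) ω * x (b * Δ) ω, fun ω => x (c * Δ) ω * x (d * Δ) ω; P] =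
      Real.exp (-(Nat.dist a c * Δ)) * Real.exp (-(Nat.dist b d * Δ))
      + Real.exp (-(Nat.dist a d * Δ)) * Real.exp (-(Nat.dist b c * Δ)) := by
  rw [covariance_eq_sub (hx.memLp_mul _ _) (hx.memLp_mul _ _)]
  simp only [Pi.mul_apply]
  rw [hx.integral_four, hx.integral_mul, hx.integral_mul]
  simp only [abs_sampled_sub]
  ring

/-- The lagged products are unbiased at the rounded lag. The whole bias is the covariance of the two
empirical means, a double sum with rows at most `4/Δ`. -/
theorem abs_integral_scalarCov_sub_le (hx : IsOrnsteinUhlenbeck P x) {N : ℕ} (hN : 0 < N) (κ : ℕ)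
    {Δ : ℝ≥0} (hΔ : 0 < Δ) (hΔ1 : Δ ≤ 1) :
    |∫ ω, scalarCov x N κ Δ ω ∂P - Real.exp (-(κ * Δ))| ≤ 4 / ((N : ℝ) * (Δ : ℝ)) := by
  have hΔ' : (0 : ℝ) < Δ := hΔ
  have hN' : (0 : ℝ) < N := by exact_mod_cast hN
  have i1 (a b : ℕ) : Integrable (fun ω => x (a * Δ) ω * x (b * Δ) ω) P :=
    (hx.memLp_mul _ _).integrable one_le_two
  have h1 : ∫ ω, scalarCov x N κ Δ ω ∂P = Real.exp (-(κ * Δ)) - (N : ℝ)⁻¹ ^ 2 *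
      ∑ p ∈ Finset.Icc 1 N ×ˢ Finset.Icc 1 N, Real.exp (-(Nat.dist p.1 (p.2 + κ) * Δ)) := by
    simp only [scalarCov_eq]
    rw [integral_sub ((integrable_finsetSum _ fun n _ => i1 _ _).const_mul _)
      ((integrable_finsetSum _ fun n _ => i1 _ _).const_mul _), integral_const_mul,
      integral_const_mul, integral_finsetSum _ fun n _ => i1 _ _,
      integral_finsetSum _ fun n _ => i1 _ _]
    simp only [hx.integral_sampled]
    simp [Nat.dist, hN'.ne']
  rw [h1, sub_sub_cancel_left, abs_neg, abs_of_nonneg (by positivity), Finset.sum_product]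
  have h2 (n : ℕ) : ∑ m ∈ Finset.Icc 1 N, Real.exp (-(Nat.dist n (m + κ) * Δ)) ≤ 2 * (2 / (Δ : ℝ)) := by
    have := sum_dist_le (φ := fun k => Real.exp (-(k * Δ))) (fun k => by positivity)
      (sum_exp_neg_mul_le hΔ' hΔ1) ((Finset.Icc 1 N).image (· + κ)) n
    rwa [Finset.sum_image fun a _ b _ h => by simpa using h] at this
  calc (N : ℝ)⁻¹ ^ 2 * ∑ n ∈ Finset.Icc 1 N, ∑ m ∈ Finset.Icc 1 N,
        Real.exp (-(Nat.dist n (m + κ) * Δ))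
      ≤ (N : ℝ)⁻¹ ^ 2 * ∑ n ∈ Finset.Icc 1 N, 2 * (2 / (Δ : ℝ)) := by
        gcongr with n _
        exact h2 n
    _ = 4 / ((N : ℝ) * (Δ : ℝ)) := by
        simp only [Finset.sum_const, Nat.card_Icc, Nat.add_sub_cancel, nsmul_eq_mul]
        field_simp
        norm_num

/-- For `G` the averaged lagged products and `H` the product of means, `Var(G - H) ≥ Var G - 2
Cov(G, H)`. All covariances are positive, so `Var G` is at least of order `1/(NΔ)`. Each term of
`Cov(G, H)` has two decaying factors with separate summation indices, which makes it of order
`1/(NΔ)²`. -/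
theorem variance_scalarCov_ge (hx : IsOrnsteinUhlenbeck P x) {N : ℕ} (κ : ℕ)
    {Δ : ℝ≥0} (hΔ : 0 < Δ) (hΔ1 : Δ ≤ 1) (hNΔ : 2 ≤ (N : ℝ) * Δ) :
    Real.exp (-2) / (2 * ((N : ℝ) * (Δ : ℝ))) - 64 / ((N : ℝ) * (Δ : ℝ)) ^ 2 ≤ Var[scalarCov x N κ Δ; P] := by
  have hΔ' : (0 : ℝ) < Δ := hΔ
  have hN' : (0 : ℝ) < N := by
    by_contra h
    nlinarith
  let φ : ℕ → ℝ := fun k => Real.exp (-(k * Δ))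
  have hφ (k) : 0 ≤ φ k := by positivity
  have hB := sum_exp_neg_mul_le hΔ' hΔ1
  set s := Finset.Icc 1 N with hs
  have hcard : (s.card : ℝ) = N := by simp [hs]
  let G : ℕ → Ω → ℝ := fun n ω => x (n * Δ) ω * x ((n + κ : ℕ) * Δ) ω
  let H : ℕ × ℕ → Ω → ℝ := fun p ω => x (p.1 * Δ) ω * x ((p.2 + κ : ℕ) * Δ) ω
  have hG (n) : MemLp (G n) 2 P := hx.memLp_mul _ _
  have hH (p) : MemLp (H p) 2 P := hx.memLp_mul _ _
  have hGs : MemLp (fun ω => (N : ℝ)⁻¹ * ∑ n ∈ s, G n ω) 2 P :=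
    (memLp_finsetSum _ fun n _ => hG n).const_mul _
  have hHs : MemLp (fun ω => (N : ℝ)⁻¹ ^ 2 * ∑ p ∈ s ×ˢ s, H p ω) 2 P :=
    (memLp_finsetSum _ fun n _ => hH n).const_mul _
  have e : scalarCov x N κ Δ = (fun ω => (N : ℝ)⁻¹ * ∑ n ∈ s, G n ω) -
      fun ω => (N : ℝ)⁻¹ ^ 2 * ∑ p ∈ s ×ˢ s, H p ω := funext (scalarCov_eq x N κ Δ)
  have hshift (n m : ℕ) : Nat.dist (n + κ) (m + κ) = Nat.dist n m := Nat.dist_add_add_right n κ m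
  have hvar : Real.exp (-2) / (2 * ((N : ℝ) * (Δ : ℝ))) ≤ Var[fun ω => (N : ℝ)⁻¹ * ∑ n ∈ s, G n ω; P] := by
    rw [variance_const_mul, variance_fun_sum' fun n _ => hG n]
    calc Real.exp (-2) / (2 * ((N : ℝ) * (Δ : ℝ))) = (N : ℝ)⁻¹ ^ 2 * (N * (Real.exp (-2) / (2 * Δ))) := by
          field_simp
      _ ≤ (N : ℝ)⁻¹ ^ 2 * ∑ n ∈ s, ∑ m ∈ s, Real.exp (-(Nat.dist n m * Δ)) ^ 2 := by
          gcongr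
          exact sum_sum_exp_neg_ge hΔ' hΔ1 hNΔ
      _ ≤ _ := by
          gcongr with n _ m _
          rw [hx.covariance_sampled, hshift, ← pow_two]
          exact le_add_of_nonneg_right (by positivity)
  have hsum (n : ℕ) : ∑ m ∈ s, φ (Nat.dist n m) ≤ 2 * (2 / (Δ : ℝ)) := sum_dist_le hφ hB s n
  have hsum' (n : ℕ) : ∑ m ∈ s, φ (Nat.dist n (m + κ)) ≤ 2 * (2 / (Δ : ℝ)) := by
    have := sum_dist_le hφ hB (s.image (· + κ)) n
    rwa [Finset.sum_image fun a _ b _ h => by simpa using h] at this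
  have hcov : cov[fun ω => (N : ℝ)⁻¹ * ∑ n ∈ s, G n ω,
      fun ω => (N : ℝ)⁻¹ ^ 2 * ∑ p ∈ s ×ˢ s, H p ω; P] ≤ 32 / ((N : ℝ) * (Δ : ℝ)) ^ 2 := by
    rw [covariance_const_mul_left, covariance_const_mul_right,
      covariance_fun_sum_fun_sum' (fun n _ => hG n) (fun p _ => hH p)]
    have hrow (n : ℕ) : ∑ p ∈ s ×ˢ s, cov[G n, H p; P] ≤ 2 * (2 * (2 / (Δ : ℝ))) ^ 2 := by
      have : ∑ p ∈ s ×ˢ s, cov[G n, H p; P] =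
          (∑ a ∈ s, φ (Nat.dist n a)) * (∑ b ∈ s, φ (Nat.dist n b)) +
          (∑ a ∈ s, φ (Nat.dist (n + κ) a)) * (∑ b ∈ s, φ (Nat.dist n (b + κ))) := by
        rw [Finset.sum_mul_sum, Finset.sum_mul_sum, Finset.sum_product, ← Finset.sum_add_distrib]
        refine Finset.sum_congr rfl fun a _ => ?_
        rw [← Finset.sum_add_distrib]
        refine Finset.sum_congr rfl fun b _ => ?_
        simp only [G, H, φ]
        rw [hx.covariance_sampled, hshift]
        ring
      rw [this]
      have p1 (g : ℕ → ℕ) : 0 ≤ ∑ a ∈ s, φ (g a) := Finset.sum_nonneg fun a _ => hφ _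
      have q1 := mul_le_mul (hsum n) (hsum n) (p1 _) (by positivity)
      have q2 := mul_le_mul (hsum (n + κ)) (hsum' n) (p1 _) (by positivity)
      nlinarith
    calc (N : ℝ)⁻¹ * ((N : ℝ)⁻¹ ^ 2 * ∑ n ∈ s, ∑ p ∈ s ×ˢ s, cov[G n, H p; P])
        ≤ (N : ℝ)⁻¹ * ((N : ℝ)⁻¹ ^ 2 * ∑ n ∈ s, 2 * (2 * (2 / (Δ : ℝ))) ^ 2) := by
          gcongr with n _
          exact hrow n
      _ = 32 / ((N : ℝ) * (Δ : ℝ)) ^ 2 := by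
          simp only [Finset.sum_const, nsmul_eq_mul, hcard]
          field_simp
          norm_num
  rw [e, variance_sub hGs hHs]
  have := variance_nonneg (fun ω => (N : ℝ)⁻¹ ^ 2 * ∑ p ∈ s ×ˢ s, H p ω) P
  have e2 : 64 / ((N : ℝ) * Δ) ^ 2 = 2 * (32 / ((N : ℝ) * Δ) ^ 2) := by ring
  linarith

end IsOrnsteinUhlenbeck

end OrnsteinUhlenbeck

/-! ### Distortion by a random factor -/

section RandomSign

open ProbabilityTheory

/-- The uniform probability on `Bool`. -/
noncomputable def coin : Measure Bool :=
  (2⁻¹ : ℝ≥0∞) • (Measure.dirac true + Measure.dirac false)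

instance isProbabilityMeasure_coin : IsProbabilityMeasure coin :=
  ⟨by simp [coin, ENNReal.inv_two_add_inv_two]⟩

/-- The sign attached to the outcome of a coin. -/
def coinSign (b : Bool) : ℝ := if b then 1 else -1

theorem abs_coinSign (b : Bool) : |coinSign b| = 1 := by
  cases b <;> simp [coinSign]

variable {Ω : Type*} [MeasurableSpace Ω] {P : Measure Ω} [IsProbabilityMeasure P]

theorem integral_prod_coin {F : Ω × Bool → ℝ} (hF : Integrable F (P.prod coin)) :
    ∫ p, F p ∂(P.prod coin) = 2⁻¹ * (∫ ω, F (ω, true) ∂P + ∫ ω, F (ω, false) ∂P) := by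
  rw [integral_prod_symm _ hF, coin, integral_smul_measure,
    integral_add_measure (integrable_dirac (by simp)) (integrable_dirac (by simp)),
    integral_dirac, integral_dirac]
  simp

variable {Q : Ω → ℝ} {δ α k : ℝ}

/-- The error on a target `k` of the estimator `α Q` when the observations of a quadratic
functional are distorted by the random factor `1 ± δ`. -/
def distortedError (Q : Ω → ℝ) (δ α k : ℝ) (p : Ω × Bool) : ℝ :=
  (1 + δ * coinSign p.2) ^ 2 * (α * Q p.1) - k

theorem memLp_distortedError (hQ : MemLp Q 2 P) :
    MemLp (distortedError Q δ α k) 2 (P.prod coin) := by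
  refine MemLp.sub ?_ (memLp_const k)
  refine MemLp.of_le_mul (c := (1 + |δ|) ^ 2) ((hQ.const_mul α).comp_fst coin) ?_ ?_
  · refine AEStronglyMeasurable.mul ?_ ((hQ.const_mul α).comp_fst coin).1
    exact (((measurable_of_finite coinSign).comp measurable_snd).const_mul δ |>.const_add 1
      |>.pow_const 2).aestronglyMeasurable
  · refine ae_of_all _ fun p => ?_
    rw [norm_mul, norm_pow]
    gcongr
    refine (abs_add_le _ _).trans ?_
    rw [abs_one, abs_mul, abs_coinSign, mul_one]

theorem integral_distortedError_sq (hQ : MemLp Q 2 P) :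
    ∫ p, distortedError Q δ α k p ^ 2 ∂(P.prod coin) =
      2⁻¹ * (∫ ω, ((1 + δ) ^ 2 * (α * Q ω) - k) ^ 2 ∂P
        + ∫ ω, ((1 - δ) ^ 2 * (α * Q ω) - k) ^ 2 ∂P) := by
  rw [integral_prod_coin (memLp_distortedError hQ).integrable_sq]
  simp [distortedError, coinSign, ← sub_eq_add_neg]

/-- If `p` and `q` are the errors for the two signs, then `(p² + q²)/2 ≥ ((p - q)/2)²`, and the
target cancels in `p - q = 4δαQ`. Jensen's inequality then replaces `Q` by its mean. -/
theorem sq_integral_le_integral_distortedError_sq (hQ : MemLp Q 2 P) :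
    (2 * δ * α * ∫ ω, Q ω ∂P) ^ 2 ≤ ∫ p, distortedError Q δ α k p ^ 2 ∂(P.prod coin) := by
  have hm (a : ℝ) : MemLp (fun ω => a * (α * Q ω) - k) 2 P :=
    ((hQ.const_mul α).const_mul a).sub (memLp_const k)
  have h1 : (∫ ω, 2 * δ * α * Q ω ∂P) ^ 2 ≤ ∫ ω, (2 * δ * α * Q ω) ^ 2 ∂P := by
    have h := variance_nonneg (fun ω => 2 * δ * α * Q ω) P
    rw [variance_eq_sub (hQ.const_mul _)] at h
    simpa using h
  rw [integral_const_mul] at h1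
  refine h1.trans ?_
  rw [integral_distortedError_sq hQ, ← integral_add (hm _).integrable_sq (hm _).integrable_sq,
    ← integral_const_mul]
  refine integral_mono (hQ.const_mul _).integrable_sq
    (((hm _).integrable_sq.add (hm _).integrable_sq).const_mul _) fun ω => ?_
  dsimp only [Pi.add_apply]
  nlinarith [sq_nonneg (((1 + δ) ^ 2 * (α * Q ω) - k) + ((1 - δ) ^ 2 * (α * Q ω) - k))]

/-- The positive sign has probability `1/2` and multiplies `Q` by `(1 + δ)² ≥ 1`, so half of the
variance survives. -/
theorem variance_le_integral_distortedError_sq (hQ : MemLp Q 2 P) (hδ : 0 ≤ δ) :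
    α ^ 2 * Var[Q; P] / 2 ≤ ∫ p, distortedError Q δ α k p ^ 2 ∂(P.prod coin) := by
  have hm : MemLp (fun ω => (1 + δ) ^ 2 * (α * Q ω) - k) 2 P :=
    ((hQ.const_mul α).const_mul _).sub (memLp_const k)
  have h1 : Var[fun ω => (1 + δ) ^ 2 * (α * Q ω) - k; P] =
      ((1 + δ) ^ 2) ^ 2 * (α ^ 2 * Var[Q; P]) := by
    rw [variance_sub_const (((hQ.const_mul α).const_mul _).1), variance_const_mul,
      variance_const_mul]
  have h2 := variance_le_expectation_sq hm.1
  simp only [Pi.pow_apply] at h2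
  have h3 : 0 ≤ ∫ ω, ((1 - δ) ^ 2 * (α * Q ω) - k) ^ 2 ∂P := integral_nonneg fun _ => sq_nonneg _
  have h4 : 0 ≤ α ^ 2 * Var[Q; P] := mul_nonneg (sq_nonneg _) (variance_nonneg _ _)
  have h5 : (1 : ℝ) ≤ ((1 + δ) ^ 2) ^ 2 := one_le_pow₀ (one_le_pow₀ (by linarith))
  rw [integral_distortedError_sq hQ]
  nlinarith [mul_le_mul_of_nonneg_right h5 h4]

theorem IsOrnsteinUhlenbeck.comp_fst {x : ℝ≥0 → Ω → ℝ} (hx : IsOrnsteinUhlenbeck P x)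
    {Ω' : Type*} [MeasurableSpace Ω'] (P' : Measure Ω') [IsProbabilityMeasure P'] :
    IsOrnsteinUhlenbeck (P.prod P') fun t p => x t p.1 where
  measurable t := (hx.measurable t).comp measurable_fst
  stationary n t h := by
    have e (s : Fin n → ℝ≥0) : (P.prod P').map (fun p k => x (s k) p.1) =
        P.map fun ω k => x (s k) ω := by
      have hm : Measurable fun ω k => x (s k) ω := measurable_pi_lambda _ fun k => hx.measurable _
      conv_rhs => rw [← (measurePreserving_fst (μ := P) (ν := P')).map_eq]
      rw [Measure.map_map hm measurable_fst]
      rfl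
    rw [e t, ← hx.stationary n t h]
    exact e fun k => t k + h
  memLp t := (hx.memLp t).comp_fst P'
  integral t := by rw [integral_fun_fst (x t), hx.integral, smul_zero]
  integral_mul s t := by
    rw [integral_fun_fst fun ω => x s ω * x t ω, hx.integral_mul]
    simp
  integral_mul_mul s t u := by
    rw [integral_fun_fst fun ω => x s ω * x t ω * x u ω, hx.integral_mul_mul, smul_zero]
  integral_four s t u v := by
    rw [integral_fun_fst fun ω => x s ω * x t ω * (x u ω * x v ω), hx.integral_four]
    simp

end RandomSign

/-! ### The vector-valued Ornstein-Uhlenbeck process -/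

section DiagonalLift

open scoped Matrix.Norms.Elementwise

variable {Ω : Type*} [MeasurableSpace Ω] {P : Measure Ω}
  {x : ℝ≥0 → Ω → ℝ} {r : ℕ} {c : ℝ}

/-- The vector-valued process whose coordinates are all equal to `c x`. -/
def diagonalLift (r : ℕ) (c : ℝ) (x : ℝ≥0 → Ω → ℝ) : ℝ≥0 → Ω → Fin r → ℝ :=
  fun t ω _ => c * x t ω

theorem abs_exp_neg_sub_exp_neg_le {s t : ℝ} (hs : 0 ≤ s) (ht : 0 ≤ t) :
    |Real.exp (-s) - Real.exp (-t)| ≤ |s - t| := by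
  wlog h : s ≤ t generalizing s t
  · rw [abs_sub_comm, abs_sub_comm s]
    exact this ht hs (le_of_not_ge h)
  have h1 : Real.exp (-t) = Real.exp (-s) * Real.exp (s - t) := by
    rw [← Real.exp_add]
    ring_nf
  have h2 : Real.exp (-s) ≤ 1 := Real.exp_le_one_iff.2 (by linarith)
  have h3 := Real.add_one_le_exp (s - t)
  have h4 : Real.exp (s - t) ≤ 1 := Real.exp_le_one_iff.2 (by linarith)
  rw [abs_sub_comm s, abs_of_nonneg (by linarith : 0 ≤ t - s), h1, abs_of_nonneg (by
    nlinarith [Real.exp_pos (-s)])]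
  nlinarith [Real.exp_pos (-s)]

namespace IsOrnsteinUhlenbeck

theorem mean_diagonalLift (hx : IsOrnsteinUhlenbeck P x) :
    mean P (diagonalLift r c x) = 0 := by
  ext i
  simp [mean, diagonalLift, integral_const_mul, hx.integral]

theorem lagCov_diagonalLift (hx : IsOrnsteinUhlenbeck P x) (u : ℝ≥0) (i j : Fin r) :
    lagCov P (diagonalLift r c x) u i j = c ^ 2 * Real.exp (-u) := by
  have e (ω) : c * x 0 ω * (c * x u ω) = c ^ 2 * (x 0 ω * x u ω) := by ring
  simp [lagCov, hx.mean_diagonalLift, diagonalLift, e, integral_const_mul, hx.integral_mul]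

theorem lipschitz_lagCov (hx : IsOrnsteinUhlenbeck P x) {lam : ℝ≥0} (hc : c ^ 2 ≤ lam)
    (s : Set ℝ≥0) : LipschitzOnWith lam (lagCov P (diagonalLift r c x)) s := by
  refine LipschitzWith.lipschitzOnWith (LipschitzWith.of_dist_le_mul fun u v => ?_)
  rw [dist_eq_norm, Matrix.norm_le_iff (by positivity)]
  intro i j
  rw [Matrix.sub_apply, hx.lagCov_diagonalLift, hx.lagCov_diagonalLift, ← mul_sub, norm_mul,
    Real.norm_of_nonneg (sq_nonneg c), NNReal.dist_eq]
  gcongr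
  exact abs_exp_neg_sub_exp_neg_le u.coe_nonneg v.coe_nonneg

theorem isStrictlyStationary (hx : IsOrnsteinUhlenbeck P x) :
    IsStrictlyStationary P (diagonalLift r c x) := by
  intro n t h
  have hm : Measurable fun (y : Fin n → ℝ) k (_ : Fin r) => c * y k := by fun_prop
  have e (s : Fin n → ℝ≥0) : P.map (fun ω k => diagonalLift r c x (s k) ω) =
      (P.map fun ω k => x (s k) ω).map fun (y : Fin n → ℝ) k (_ : Fin r) => c * y k := by
    rw [Measure.map_map hm (measurable_pi_lambda _ fun k => hx.measurable _)]
    rfl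
  rw [e t, ← hx.stationary n t h]
  exact e fun k => t k + h

theorem eLpNorm_diagonalLift_le (hx : IsOrnsteinUhlenbeck P x) {m : ℝ} (hm : 0 ≤ m)
    (hc : 2 * c ^ 2 ≤ m ^ 2) (t : ℝ≥0) :
    eLpNorm (diagonalLift r c x t) 4 P ≤ ENNReal.ofReal m := by
  have h1 : eLpNorm (diagonalLift r c x t) 4 P ≤ eLpNorm (fun ω => c * x t ω) 4 P :=
    eLpNorm_mono fun ω => (pi_norm_le_iff_of_nonneg (norm_nonneg _)).2 fun _ => le_rfl
  refine h1.trans (eLpNorm_four_le_ofReal ((hx.memLp t).const_mul c) hm ?_)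
  have e (ω) : (c * x t ω) ^ 4 = c ^ 4 * (x t ω * x t ω * (x t ω * x t ω)) := by ring
  simp only [e]
  rw [integral_const_mul, hx.integral_four]
  simp only [sub_self, abs_zero, neg_zero, Real.exp_zero]
  -- The fourth moment is `3c⁴ ≤ (2c²)² ≤ m⁴`.
  nlinarith [sq_nonneg (c ^ 2), mul_self_le_mul_self (by positivity) hc]

/-- Two single values give `c² exp(-T)`; mixed moments of order three vanish; for two products the
pairing within each product cancels, and each of the two cross pairings is at most `c⁴ exp(-T)`. -/
theorem hasIntegrableDecorrelationRate (hx : IsOrnsteinUhlenbeck P x) (hc : 0 < c) :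
    HasIntegrableDecorrelationRate P (diagonalLift r c x)
      fun T => (c ^ 2 + 2 * c ^ 4) * Real.exp (-T) where
  pos T _ := by positivity
  antitone S _ T _ h := by
    dsimp only
    gcongr
  continuous := by fun_prop
  integrable := (integrableOn_exp_neg_Ioi 1).const_mul _
  decorrelation U V _ _ T hT hGLB G hG H hH := by
    have hgap (s) (hs : s ∈ U) (t) (ht : t ∈ V) : Real.exp (-|(t : ℝ) - s|) ≤ Real.exp (-T) := by
      have := hGLB.1 ⟨s, hs, t, ht, rfl⟩
      exact Real.exp_le_exp.2 (neg_le_neg (this.trans (le_abs_self _)))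
    have hexp (y : ℝ) : Real.exp (-|y|) ≤ 1 := Real.exp_le_one_iff.2 (by simp)
    have hE := Real.exp_pos (-T)
    have hlin (s) : ∫ ω, c * x s ω ∂P = 0 := by rw [integral_const_mul, hx.integral, mul_zero]
    rcases hG with ⟨s, hs, i, rfl⟩ | ⟨s, hs, t, ht, i, j, rfl⟩ <;>
    rcases hH with ⟨u, hu, k, rfl⟩ | ⟨u, hu, v, hv, k, l, rfl⟩ <;>
    simp only [diagonalLift, hlin, mul_zero, zero_mul, sub_zero]
    · have e (ω) : c * x s ω * (c * x u ω) = c ^ 2 * (x s ω * x u ω) := by ring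
      simp only [e]
      rw [integral_const_mul, hx.integral_mul, abs_of_nonneg (by positivity)]
      have := hgap s hs u hu
      calc c ^ 2 * Real.exp (-|(u : ℝ) - s|) ≤ c ^ 2 * Real.exp (-T) := by gcongr
        _ ≤ _ := by
          gcongr
          exact le_add_of_nonneg_right (by positivity)
    · have e (ω) : c * x s ω * (c * x u ω * (c * x v ω)) = c ^ 3 * (x s ω * x u ω * x v ω) := by
        ring
      simp only [e]
      rw [integral_const_mul, hx.integral_mul_mul, mul_zero, abs_zero]
      positivity
    · have e (ω) : c * x s ω * (c * x t ω) * (c * x u ω) = c ^ 3 * (x s ω * x t ω * x u ω) := by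
        ring
      simp only [e]
      rw [integral_const_mul, hx.integral_mul_mul, mul_zero, abs_zero]
      positivity
    · have e (ω) : c * x s ω * (c * x t ω) * (c * x u ω * (c * x v ω)) =
          c ^ 4 * (x s ω * x t ω * (x u ω * x v ω)) := by ring
      have e' (s t ω) : c * x s ω * (c * x t ω) = c ^ 2 * (x s ω * x t ω) := by ring
      simp only [e]
      simp only [e', integral_const_mul, hx.integral_four, hx.integral_mul]
      have h1 := mul_le_mul (hgap s hs u hu) (hexp ((v : ℝ) - t)) (Real.exp_pos _).le hE.le
      have h2 := mul_le_mul (hgap s hs v hv) (hexp ((u : ℝ) - t)) (Real.exp_pos _).le hE.le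
      have e2 : c ^ 4 * (Real.exp (-|(t : ℝ) - s|) * Real.exp (-|(v : ℝ) - u|)
          + Real.exp (-|(u : ℝ) - s|) * Real.exp (-|(v : ℝ) - t|)
          + Real.exp (-|(v : ℝ) - s|) * Real.exp (-|(u : ℝ) - t|))
          - c ^ 2 * Real.exp (-|(t : ℝ) - s|) * (c ^ 2 * Real.exp (-|(v : ℝ) - u|)) =
          c ^ 4 * (Real.exp (-|(u : ℝ) - s|) * Real.exp (-|(v : ℝ) - t|)
          + Real.exp (-|(v : ℝ) - s|) * Real.exp (-|(u : ℝ) - t|)) := by ring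
      rw [e2, abs_of_nonneg (by positivity)]
      have h3 : c ^ 4 * (Real.exp (-|(u : ℝ) - s|) * Real.exp (-|(v : ℝ) - t|)
          + Real.exp (-|(v : ℝ) - s|) * Real.exp (-|(u : ℝ) - t|)) ≤
          c ^ 4 * (Real.exp (-T) * 1 + Real.exp (-T) * 1) := by gcongr
      nlinarith [mul_nonneg (sq_nonneg c) hE.le]

end IsOrnsteinUhlenbeck

end DiagonalLift

/-! ### The lower bounds for the error and the time span -/

section LowerBound

open ProbabilityTheory
open scoped Matrix.Norms.Elementwise

variable {Ω : Type*} {r : ℕ}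

/-- The process with all coordinates `c x`, multiplied by the random factor `1 ± δ ε`. -/
def distortedLift (r : ℕ) (c : ℝ) (δ : ℝ → ℝ) (x : ℝ≥0 → Ω → ℝ) :
    ℝ → ℝ≥0 → Ω × Bool → Fin r → ℝ :=
  fun ε t p => (1 + δ ε * coinSign p.2) • diagonalLift r c (fun t p => x t p.1) t p

theorem empCov_distortedLift (c : ℝ) (δ : ℝ → ℝ) (x : ℝ≥0 → Ω → ℝ) (ε : ℝ) (N : ℕ)
    (Δ u : ℝ≥0) (p : Ω × Bool) (i j : Fin r) :
    empCov (distortedLift r c δ x ε) N Δ u p i j =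
      (1 + δ ε * coinSign p.2) ^ 2 * (c ^ 2 * scalarCov x N (lagIndex Δ u) Δ p.1) := by
  rw [empCov_apply, empMean_apply, shiftedEmpMean_apply]
  simp only [distortedLift, diagonalLift, Pi.smul_apply, smul_eq_mul, scalarCov]
  set d := 1 + δ ε * coinSign p.2
  have e1 (t) : d * (c * x t p.1) = d * c * x t p.1 := by ring
  have e2 (s t) : d * (c * x s p.1) * (d * (c * x t p.1)) = d ^ 2 * c ^ 2 * (x s p.1 * x t p.1) := by
    ring
  simp only [e2]
  simp only [e1, ← Finset.mul_sum]
  ring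

variable [MeasurableSpace Ω] {P : Measure Ω} [IsProbabilityMeasure P] {x : ℝ≥0 → Ω → ℝ} {c : ℝ}
  {δ ρ : ℝ → ℝ}

namespace IsOrnsteinUhlenbeck

/-- Here `m` bounds the `L⁴` norm of `X`. The factor `1 ± δ` at most doubles it, hence `2m ≤ ν`; and
`Y - X` has norm at most `δ m ≤ ρ` because `m ≤ 1`. -/
theorem isSetup_distortedLift (hx : IsOrnsteinUhlenbeck P x) {ν lam : ℝ≥0} {m : ℝ} (hm : 0 ≤ m)
    (hm1 : m ≤ 1) (hmν : 2 * m ≤ ν) (hc : 2 * c ^ 2 ≤ m ^ 2) (hlam : c ^ 2 ≤ lam)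
    (hρ : IsSpeed ρ) (hδ0 : ∀ ε, 0 < ε → 0 ≤ δ ε) (hδ1 : ∀ ε, δ ε ≤ 1) (hδρ : ∀ ε, δ ε ≤ ρ ε) :
    IsSetup (P.prod coin) (diagonalLift r c fun t p => x t p.1) (distortedLift r c δ x)
      ρ ν fun _ => lam := by
  have hz := hx.comp_fst coin
  have hX (t) := hz.eLpNorm_diagonalLift_le (r := r) hm hc t
  have hmeas (t) : Measurable (diagonalLift r c (fun t (p : Ω × Bool) => x t p.1) t) :=
    measurable_pi_lambda _ fun _ => (hz.measurable t).const_mul c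
  have hν : ENNReal.ofReal ν = ν := ENNReal.ofReal_coe_nnreal
  refine ⟨hmeas, fun ε _ t => ?_, hz.isStrictlyStationary, fun t => (hX t).trans ?_,
    fun ε hε t => ?_, hρ, fun ε hε t => ?_, fun B => hz.lipschitz_lagCov hlam _⟩
  · exact ((((measurable_of_finite coinSign).comp measurable_snd).const_mul (δ ε)).const_add 1).smul
      (hmeas t)
  · rw [← hν]
    exact ENNReal.ofReal_le_ofReal (by linarith)
  · have h1 : eLpNorm (distortedLift r c δ x ε t) 4 (P.prod coin) ≤ ENNReal.ofReal 2 *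
        eLpNorm (diagonalLift r c (fun t (p : Ω × Bool) => x t p.1) t) 4 (P.prod coin) := by
      refine eLpNorm_le_mul_eLpNorm_of_ae_le_mul (ae_of_all _ fun p => ?_) _
      rw [distortedLift, norm_smul]
      gcongr
      refine (abs_add_le _ _).trans ?_
      rw [abs_one, abs_mul, abs_coinSign, mul_one, abs_of_nonneg (hδ0 ε hε)]
      linarith [hδ1 ε]
    refine (h1.trans (mul_le_mul_right (hX t) _)).trans ?_
    rw [← hν, ← ENNReal.ofReal_mul zero_le_two]
    exact ENNReal.ofReal_le_ofReal hmν
  · have h1 : eLpNorm (fun p => distortedLift r c δ x ε t p -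
        diagonalLift r c (fun t (p : Ω × Bool) => x t p.1) t p) 4 (P.prod coin) ≤
        ENNReal.ofReal (δ ε) *
          eLpNorm (diagonalLift r c (fun t (p : Ω × Bool) => x t p.1) t) 4 (P.prod coin) := by
      refine eLpNorm_le_mul_eLpNorm_of_ae_le_mul (ae_of_all _ fun p => ?_) _
      rw [distortedLift, add_smul, one_smul, add_sub_cancel_left, norm_smul, norm_mul,
        Real.norm_eq_abs (coinSign _), abs_coinSign, mul_one, Real.norm_of_nonneg (hδ0 ε hε)]
    refine (h1.trans (mul_le_mul_right (hX t) _)).trans ?_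
    rw [← ENNReal.ofReal_mul (hδ0 ε hε)]
    exact ENNReal.ofReal_le_ofReal ((mul_le_of_le_one_right (hδ0 ε hε) hm1).trans (hδρ ε))

theorem eLpNorm_distortedError_le_covError (hx : IsOrnsteinUhlenbeck P x) (hr : 0 < r)
    (N : ℝ → ℕ) (Δ : ℝ → ℝ≥0) (u : ℝ≥0) (ε : ℝ) :
    eLpNorm (distortedError (scalarCov x (N ε) (lagIndex (Δ ε) u) (Δ ε)) (δ ε) (c ^ 2)
        (c ^ 2 * Real.exp (-u))) 2 (P.prod coin) ≤
      covError (P.prod coin) (diagonalLift r c fun t p => x t p.1) (distortedLift r c δ x)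
        N Δ u ε := by
  refine eLpNorm_mono fun p => ?_
  refine le_trans (le_of_eq ?_) (Matrix.norm_entry_le_entrywise_sup_norm _ (i := ⟨0, hr⟩)
    (j := ⟨0, hr⟩))
  rw [Matrix.sub_apply, empCov_distortedLift, (hx.comp_fst coin).lagCov_diagonalLift,
    distortedError]

theorem tendsto_integral_scalarCov (hx : IsOrnsteinUhlenbeck P x) {N : ℝ → ℕ} {Δ : ℝ → ℝ≥0}
    (h : IsAdaptiveScheme N Δ) (u : ℝ≥0) :
    Tendsto (fun ε => ∫ ω, scalarCov x (N ε) (lagIndex (Δ ε) u) (Δ ε) ω ∂P) (𝓝[>] 0)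
      (𝓝 (Real.exp (-u))) := by
  have hlim : Tendsto (fun ε => 4 / ((N ε : ℝ) * Δ ε) + (Δ ε : ℝ)) (𝓝[>] 0) (𝓝 0) := by
    simpa using (h.span_tendsto.const_div_atTop 4).add (NNReal.tendsto_coe.2 h.step_tendsto)
  rw [tendsto_iff_dist_tendsto_zero]
  refine squeeze_zero' (Eventually.of_forall fun _ => dist_nonneg) ?_ hlim
  filter_upwards [self_mem_nhdsWithin, h.step_tendsto.eventually_le_const zero_lt_one,
    h.span_tendsto.eventually_gt_atTop 0] with ε hε hΔ1 hS
  have hN : 0 < N ε := by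
    rcases Nat.eq_zero_or_pos (N ε) with h0 | h0
    · simp [h0] at hS
    · exact h0
  refine (dist_triangle _ (Real.exp (-(lagIndex (Δ ε) u * Δ ε))) _).trans (add_le_add ?_ ?_)
  · exact hx.abs_integral_scalarCov_sub_le hN _ (h.step_pos ε hε) hΔ1
  · exact (abs_exp_neg_sub_exp_neg_le (by positivity) u.coe_nonneg).trans
      (abs_lagIndex_mul_sub_le (h.step_pos ε hε) u)

/-- The mean of the undistorted scalar estimator tends to `exp(-u)` and so eventually exceeds half
of it; this half absorbs the factor `2` of the distortion bound `2δα`, where `α = c²` and `δ = ρ`.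
-/
theorem eventually_le_covError (hx : IsOrnsteinUhlenbeck P x) (hr : 0 < r) (hc : 0 < c)
    (hρ : IsSpeed ρ) {N : ℝ → ℕ} {Δ : ℝ → ℝ≥0} (h : IsAdaptiveScheme N Δ)
    (hδρ : δ =ᶠ[𝓝[>] 0] ρ) (u : ℝ≥0) :
    ∀ᶠ ε in 𝓝[>] (0 : ℝ), ENNReal.ofReal (c ^ 2 * Real.exp (-u) * ρ ε) ≤
      covError (P.prod coin) (diagonalLift r c fun t p => x t p.1) (distortedLift r c δ x)
        N Δ u ε := by
  filter_upwards [self_mem_nhdsWithin, hδρ, (hx.tendsto_integral_scalarCov h u).eventually_const_lt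
    (half_lt_self (Real.exp_pos _))] with ε hε hδε hI
  have hρε := hρ.1 ε hε
  refine le_trans ?_ (hx.eLpNorm_distortedError_le_covError hr N Δ u ε)
  by_contra! hlt
  have hQ := hx.memLp_scalarCov (N ε) (lagIndex (Δ ε) u) (Δ ε)
  have h1 := integral_sq_le_of_eLpNorm (memLp_distortedError hQ) (by positivity) hlt.le
  have h2 := (sq_integral_le_integral_distortedError_sq hQ).trans h1
  have h3 := abs_le_of_sq_le_sq' h2 (by positivity)
  rw [hδε] at h3
  have h4 : 0 < ρ ε * c ^ 2 := by positivity
  nlinarith [h3.2, mul_lt_mul_of_pos_left hI h4]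

/-- The surviving variance, of order `1/S`, must be at most `C²ρ²`, whereas an optimized span is
eventually at most `4ab ρ⁻²`. -/
theorem isBigO_span (hx : IsOrnsteinUhlenbeck P x) (hr : 0 < r) (hc : 0 < c)
    (hρ : IsSpeed ρ) (hδ0 : ∀ ε, 0 < ε → 0 ≤ δ ε) {N : ℝ → ℕ} {Δ : ℝ → ℝ≥0}
    (h : IsAdaptiveScheme N Δ) {u : ℝ≥0} {C : ℝ}
    (hC : ∀ᶠ ε in 𝓝[>] (0 : ℝ), covError (P.prod coin) (diagonalLift r c fun t p => x t p.1)
      (distortedLift r c δ x) N Δ u ε ≤ ENNReal.ofReal (C * ρ ε))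
    {a b : ℝ} {N' : ℝ → ℕ} {Δ' : ℝ → ℝ≥0} (h' : IsOptimizedScheme ρ a b N' Δ') :
    span N' Δ' =O[𝓝[>] (0 : ℝ)] span N Δ := by
  obtain ⟨ha, hlimN⟩ := h'.number_similar
  obtain ⟨hb, hlimΔ⟩ := h'.step_similar
  have hE := Real.exp_pos (-2)
  -- The amplitude gives `c⁴`, the variance bound `exp(-2)/(4S)`, and the coin a factor `1/2`.
  set κ := c ^ 4 * Real.exp (-2) / 8 with hκ
  have hκ0 : 0 < κ := by positivity
  refine Asymptotics.IsBigO.of_bound (4 * a * b * C ^ 2 / κ) ?_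
  filter_upwards [self_mem_nhdsWithin, hC, h.step_tendsto.eventually_le_const zero_lt_one,
    h.span_tendsto.eventually_ge_atTop 2,
    h.span_tendsto.eventually_ge_atTop (256 / Real.exp (-2)),
    hlimN.eventually_lt_const (show a < 2 * a by linarith),
    hlimΔ.eventually_lt_const (show b < 2 * b by linarith)] with ε hε hCε hΔ1 hS2 hS hN' hΔ'
  have hρε := hρ.1 ε hε
  have hQ := hx.memLp_scalarCov (N ε) (lagIndex (Δ ε) u) (Δ ε)
  have h1 : eLpNorm (distortedError (scalarCov x (N ε) (lagIndex (Δ ε) u) (Δ ε)) (δ ε) (c ^ 2)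
      (c ^ 2 * Real.exp (-u))) 2 (P.prod coin) ≤ ENNReal.ofReal (|C| * ρ ε) :=
    (hx.eLpNorm_distortedError_le_covError hr N Δ u ε).trans (hCε.trans
      (ENNReal.ofReal_le_ofReal (by gcongr; exact le_abs_self C)))
  have h2 := (variance_le_integral_distortedError_sq hQ (hδ0 ε hε)).trans
    (integral_sq_le_of_eLpNorm (memLp_distortedError hQ) (by positivity) h1)
  have h3 := hx.variance_scalarCov_ge (lagIndex (Δ ε) u) (h.step_pos ε hε) hΔ1 hS2
  rw [mul_pow, sq_abs] at h2
  set S := (N ε : ℝ) * (Δ ε : ℝ) with hSdef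
  have hS0 : 0 < S := by linarith
  -- Once `S ≥ 256/exp(-2)`, the second-order term takes away at most half of the leading one.
  have h4 : Real.exp (-2) / (4 * S) ≤ Real.exp (-2) / (2 * S) - 64 / S ^ 2 := by
    have h5 : 256 ≤ Real.exp (-2) * S := by rwa [div_le_iff₀' hE] at hS
    have h6 : 64 / S ^ 2 ≤ Real.exp (-2) / (4 * S) := by
      rw [div_le_div_iff₀ (by positivity) (by positivity)]
      nlinarith
    have h7 : Real.exp (-2) / (2 * S) = 2 * (Real.exp (-2) / (4 * S)) := by
      field_simp
      norm_num
    linarith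
  have h5 : κ / S ≤ C ^ 2 * ρ ε ^ 2 := by
    refine le_trans (le_of_eq ?_) ((div_le_div_of_nonneg_right (mul_le_mul_of_nonneg_left
      (h4.trans h3) (by positivity : 0 ≤ (c ^ 2) ^ 2)) zero_le_two).trans h2)
    rw [hκ]
    field_simp
    norm_num
  rw [div_le_iff₀ hS0] at h5
  rw [div_div_eq_mul_div, div_one] at hN'
  rw [div_lt_iff₀ hρε] at hΔ'
  have h6 : span N' Δ' ε * ρ ε ^ 2 ≤ 4 * a * b := by
    have h7 : (N' ε : ℝ) * ρ ε ^ 3 * Δ' ε ≤ 2 * a * (2 * b * ρ ε) :=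
      mul_le_mul hN'.le hΔ'.le (by positivity) (by positivity)
    refine le_of_mul_le_mul_right ?_ hρε
    rw [span]
    linarith
  have h8 : 0 ≤ span N' Δ' ε := by rw [span]; positivity
  have h9 : span N Δ ε = S := rfl
  rw [Real.norm_of_nonneg h8, h9, Real.norm_of_nonneg hS0.le, div_mul_eq_mul_div, le_div_iff₀ hκ0]
  calc span N' Δ' ε * κ ≤ span N' Δ' ε * (C ^ 2 * ρ ε ^ 2 * S) := by gcongr
    _ = span N' Δ' ε * ρ ε ^ 2 * (C ^ 2 * S) := by ring
    _ ≤ 4 * a * b * (C ^ 2 * S) := by gcongr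
    _ = 4 * a * b * C ^ 2 * S := by ring

end IsOrnsteinUhlenbeck

theorem exists_lowerBound {r : ℕ} {ν lam : ℝ≥0} {J : ℝ} (hr : 0 < r) (hν : 0 < ν)
    (hlam : 0 < lam) (hJ : 0 < J) :
    ∃ c : ℝ≥0 → ℝ, (∀ u, 0 < c u) ∧ ∀ ρ : ℝ → ℝ, IsSpeed ρ →
      ∃ (Ω : Type) (_ : MeasurableSpace Ω) (P : Measure Ω) (_ : IsProbabilityMeasure P)
        (X : ℝ≥0 → Ω → Fin r → ℝ) (Y : ℝ → ℝ≥0 → Ω → Fin r → ℝ) (f : ℝ → ℝ),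
        IsSetup P X Y ρ ν (fun _ => lam) ∧ HasIntegrableDecorrelationRate P X f ∧
        (∫ T in Set.Ioi (1 : ℝ), f T) ≤ J ∧
        ∀ u : ℝ≥0, ∀ (N : ℝ → ℕ) (Δ : ℝ → ℝ≥0), IsAdaptiveScheme N Δ →
          (∀ᶠ ε in 𝓝[>] (0 : ℝ), ENNReal.ofReal (c u * ρ ε) ≤ covError P X Y N Δ u ε) ∧
          ((∃ C : ℝ, ∀ᶠ ε in 𝓝[>] (0 : ℝ),
              covError P X Y N Δ u ε ≤ ENNReal.ofReal (C * ρ ε)) →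
            ∀ (a b : ℝ) (N' : ℝ → ℕ) (Δ' : ℝ → ℝ≥0), IsOptimizedScheme ρ a b N' Δ' →
              span N' Δ' =O[𝓝[>] (0 : ℝ)] span N Δ) := by
  have hν' : (0 : ℝ) < ν := hν
  have hlam' : (0 : ℝ) < lam := hlam
  set m : ℝ := min (ν / 2) 1 with hm
  have hm0 : 0 < m := by positivity
  have hm1 : m ≤ 1 := min_le_right _ _
  have hmν : 2 * m ≤ ν := by linarith [min_le_left ((ν : ℝ) / 2) 1]
  -- The amplitude is chosen before the speed, so that `c(u)` does not depend on `ρ`. With `c ≤ 1`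
  -- the rate integral is at most `c² + 2c⁴ ≤ 3c²`; the other conditions are the Lipschitz and `L⁴`
  -- bounds.
  obtain ⟨c, hc, hc1, hclam, hcJ, hcm⟩ : ∃ c : ℝ, 0 < c ∧ c ^ 2 ≤ 1 ∧ c ^ 2 ≤ lam ∧
      3 * c ^ 2 ≤ J ∧ 2 * c ^ 2 ≤ m ^ 2 := by
    set α : ℝ := min (min 1 lam) (min (J / 3) (m ^ 2 / 2)) with hα
    have hα0 : 0 < α := by positivity
    have h1 : α ≤ min (1 : ℝ) (lam : ℝ) := min_le_left _ _
    have h2 : α ≤ min (J / 3) (m ^ 2 / 2) := min_le_right _ _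
    rw [le_min_iff] at h1 h2
    refine ⟨√α, Real.sqrt_pos.2 hα0, ?_⟩
    rw [Real.sq_sqrt hα0.le]
    exact ⟨h1.1, h1.2, by linarith, by linarith⟩
  refine ⟨fun u => c ^ 2 * Real.exp (-u), fun u => by positivity, fun ρ hρ => ?_⟩
  obtain ⟨Ω, _, P, _, x, hx⟩ := exists_isOrnsteinUhlenbeck
  -- Away from `0` a speed may be large; the truncation keeps the `L⁴` bound for every `ε` and
  -- changes nothing near `0`.
  set δ : ℝ → ℝ := fun ε => min (ρ ε) 1 with hδ
  have hδ0 (ε : ℝ) (hε : 0 < ε) : 0 ≤ δ ε := le_min (hρ.1 ε hε).le zero_le_one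
  have hδρ : δ =ᶠ[𝓝[>] 0] ρ := by
    filter_upwards [hρ.2.eventually_le_const zero_lt_one] with ε hε
    exact min_eq_left hε
  refine ⟨Ω × Bool, inferInstance, P.prod coin, inferInstance,
    diagonalLift r c fun t p => x t p.1, distortedLift r c δ x,
    fun T => (c ^ 2 + 2 * c ^ 4) * Real.exp (-T),
    hx.isSetup_distortedLift hm0.le hm1 hmν hcm hclam hρ hδ0 (fun ε => min_le_right _ _)
      (fun ε => min_le_left _ _), (hx.comp_fst coin).hasIntegrableDecorrelationRate hc, ?_,
    fun u N Δ h => ⟨hx.eventually_le_covError hr hc hρ h hδρ u, ?_⟩⟩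
  · rw [integral_const_mul, integral_exp_neg_Ioi]
    have h1 : Real.exp (-1) ≤ 1 := Real.exp_le_one_iff.2 (by norm_num)
    have h2 : c ^ 4 ≤ c ^ 2 := by nlinarith [sq_nonneg c]
    calc (c ^ 2 + 2 * c ^ 4) * Real.exp (-1) ≤ (c ^ 2 + 2 * c ^ 4) * 1 := by gcongr
      _ ≤ J := by linarith
  · rintro ⟨C, hC⟩ a b N' Δ' h'
    exact hx.isBigO_span hr hc hρ hδ0 h hC h'

end LowerBound

end IndirectObs

theorem mainTheorem1 :
    -- optimized schemes exist for every speed, and they are adaptive sub-sampling schemes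
    (∀ ρ : ℝ → ℝ, IndirectObs.IsSpeed ρ → ∀ a b : ℝ, 0 < a → 0 < b →
      (∃ (N : ℝ → ℕ) (Δ : ℝ → ℝ≥0), IndirectObs.IsOptimizedScheme ρ a b N Δ) ∧
      ∀ (N : ℝ → ℕ) (Δ : ℝ → ℝ≥0), IndirectObs.IsOptimizedScheme ρ a b N Δ →
        IndirectObs.IsAdaptiveScheme N Δ) ∧
    -- every optimized scheme achieves the speed `ρ`, with a constant that depends only on the
    -- listed parameters
    (∀ (r : ℕ) (A ν : ℝ≥0) (J : ℝ) (Λ : ℝ≥0 → ℝ≥0) (a b : ℝ), ∃ C : ℝ,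
      ∀ {Ω : Type*} [MeasurableSpace Ω] (P : Measure Ω) [IsProbabilityMeasure P]
        (X : ℝ≥0 → Ω → Fin r → ℝ) (Y : ℝ → ℝ≥0 → Ω → Fin r → ℝ) (ρ f : ℝ → ℝ)
        (N : ℝ → ℕ) (Δ : ℝ → ℝ≥0),
        IndirectObs.IsSetup P X Y ρ ν Λ →
        IndirectObs.HasIntegrableDecorrelationRate P X f →
        (∫ T in Set.Ioi (1 : ℝ), f T) ≤ J →
        IndirectObs.IsOptimizedScheme ρ a b N Δ →
        ∀ᶠ ε in 𝓝[>] (0 : ℝ),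
          (∀ u : ℝ≥0, u ≤ A →
            IndirectObs.covError P X Y N Δ u ε ≤ ENNReal.ofReal (C * ρ ε)) ∧
          IndirectObs.meanError P X Y N Δ ε ≤ ENNReal.ofReal (C * ρ ε)) ∧
    -- in every class of setups no adaptive scheme can do better than `ρ`, and no adaptive scheme
    -- that achieves `ρ` can have a time span of smaller order than an optimized scheme
    (∀ (r : ℕ) (ν lam : ℝ≥0) (J : ℝ), 0 < r → 0 < ν → 0 < lam → 0 < J →
      ∃ c : ℝ≥0 → ℝ, (∀ u, 0 < c u) ∧
      ∀ ρ : ℝ → ℝ, IndirectObs.IsSpeed ρ →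
        ∃ (Ω : Type) (_ : MeasurableSpace Ω) (P : Measure Ω) (_ : IsProbabilityMeasure P)
          (X : ℝ≥0 → Ω → Fin r → ℝ) (Y : ℝ → ℝ≥0 → Ω → Fin r → ℝ) (f : ℝ → ℝ),
          IndirectObs.IsSetup P X Y ρ ν (fun _ => lam) ∧
          IndirectObs.HasIntegrableDecorrelationRate P X f ∧
          (∫ T in Set.Ioi (1 : ℝ), f T) ≤ J ∧
          ∀ u : ℝ≥0, ∀ (N : ℝ → ℕ) (Δ : ℝ → ℝ≥0), IndirectObs.IsAdaptiveScheme N Δ →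
            (∀ᶠ ε in 𝓝[>] (0 : ℝ),
              ENNReal.ofReal (c u * ρ ε) ≤ IndirectObs.covError P X Y N Δ u ε) ∧
            ((∃ C : ℝ, ∀ᶠ ε in 𝓝[>] (0 : ℝ),
                IndirectObs.covError P X Y N Δ u ε ≤ ENNReal.ofReal (C * ρ ε)) →
              ∀ (a b : ℝ) (N' : ℝ → ℕ) (Δ' : ℝ → ℝ≥0),
                IndirectObs.IsOptimizedScheme ρ a b N' Δ' →
                IndirectObs.span N' Δ' =O[𝓝[>] (0 : ℝ)] IndirectObs.span N Δ)) :=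
  ⟨fun _ hρ _ _ ha hb => ⟨IndirectObs.exists_isOptimizedScheme hρ ha hb,
      fun _ _ h => h.isAdaptiveScheme hρ⟩,
    IndirectObs.exists_upperBound,
    fun _ _ _ _ hr hν hlam hJ => IndirectObs.exists_lowerBound hr hν hlam hJ⟩
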